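/- Consider tree-level massless QED with $N$ fermion flavors of equal charge and coupling $g$, $\mathcal L=-\tfrac14F^2+\sum_f\bar\psi_f(i\slashed\partial+g\slashed A)\psi_f$, and a gauge-invariant operator $\mathcal O=\bar\psi_1\cdots\psi_N$ at $x=0$, containing one field ($\bar\psi_j$ or $\psi_j$) of each flavor $j$, with as many $\bar\psi$'s as $\psi$'s, the spinor indices being contracted with an arbitrary constant tensor. Let $Q_j=1$ if the $j$-th field is $\bar\psi_j$ and $Q_j=-1$ if it is $\psi_j$. Consider outgoing $N$-jet states $\langle X_1\cdots X_N;X_s|$ of photons, fermions and antifermions of definite helicity, depending on a parameter $\lambda\to0^+$: $X_j$ has the flavor quantum numbers of the single particle created by the $j$-th field and $X_s$ is neutral in each flavor; collinear energies are $\sim1$ and soft energies $\sim\lambda^2$; $p\cdot q\sim\lambda^2$ for two momenta of the same jet, $p\cdot p'\sim1$ for momenta of different jets, $p\cdot k\sim\lambda^2$ for $p$ collinear and $k$ soft, $k\cdot k'\sim\lambda^4$ for two soft momenta. Photon polarizations are helicity vectors $\epsilon^\pm(r)$ with arbitrary lightlike reference vectors $r$ not parallel to the photon momentum. Let $n_j=(1,\vec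 P_j/|\vec P_j|)$ with $P_j$ the total momentum of $X_j$, let $t_j$ be lightlike directions, normalized to $t_j^0\sim1$ and not collinear to jet $j$ ($t_j\cdot p\sim1$ for $p$ in $X_j$), and set $Y_j^\dagger=\exp\big(ig\int_0^\infty ds\,n_j\cdot A(sn_j)e^{-\varepsilon s}\big)$, $W_j=\exp\big(-ig\int_0^\infty ds\,t_j\cdot A(st_j)e^{-\varepsilon s}\big)$, $\varepsilon\to0^+$. Then, at tree level, $$\langle X_1\cdots X_N;X_s|\mathcal O|0\rangle\cong\langle X_1|\bar\psi_1W_1|0\rangle\cdots\langle X_N|W_N^\dagger\psi_N|0\rangle\,\langle X_s|Y_1^\dagger\cdots Y_N|0\rangle ,$$ with $\bar\psi_jW_j$ and $Y_j^\dagger$ if $Q_j=1$, and $W_j^\dagger\psi_j$ and $Y_j$ if $Q_j=-1$. Here $\cong$ is agreement at leading power: both sides are $O(\lambda^{-m})$ and their difference is $o(\lambda^{-m})$, where $m=\sum_j(|X_j|-1)+2|X_s|$ and $|X|$ is the number of particles in $X$. Moreover, the emission of a photon of momentum $q$ and polarization $\epsilon$ from an outgoing fermion of momentum $p$ satisfies,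 for all small $\lambda$, $$\frac{-g\,\bar u\slashed\epsilon(\slashed p+\slashed q)}{2p\cdot q}=-g\frac{p\cdot\epsilon}{p\cdot q}\bar u-\frac{g\,\bar u\slashed\epsilon\slashed q}{2p\cdot q}$$ (for an antifermion, $\frac{g(\slashed p+\slashed q)\slashed\epsilon v}{2p\cdot q}=g\frac{p\cdot\epsilon}{p\cdot q}v+\frac{g\slashed q\slashed\epsilon v}{2p\cdot q}$), and: the last term is independent of the reference vector; for $p$ and $q$ collinear momenta of the state it is $O(\lambda^{-1})$ if they belong to the same jet and only $O(1)$ otherwise; for $q$ soft and $p$ collinear the left-hand side equals the spin-independent eikonal term $\mp g\frac{p\cdot\epsilon}{p\cdot q}$ times the wave function up to $o(\lambda^{-2})$. -/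

import Mathlib

open Filter Topology Asymptotics Matrix

namespace TreeQED

noncomputable section

/- Minkowski space, signature (+,-,-,-), and the Weyl (chiral) gamma matrices. -/

/-- Complex four-vectors `V^μ` (upper index). -/
abbrev Vec := Fin 4 → ℂ

/-- Two-component Weyl spinors. -/
abbrev Weyl := Fin 2 → ℂ

/-- Index of a four-component Dirac spinor: left-handed block, then right-handed block. -/
abbrev DIdx := Fin 2 ⊕ Fin 2

/-- Dirac spinors. -/
abbrev Dirac := DIdx → ℂ

/-- `σ^μ = (1, σ₁, σ₂, σ₃)`. -/
def sig : Fin 4 → Matrix (Fin 2) (Fin 2) ℂ :=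
  ![1, !![0, 1; 1, 0], !![0, -Complex.I; Complex.I, 0], !![1, 0; 0, -1]]

/-- The sign `g_{μμ}` of the metric. -/
def metric (μ : Fin 4) : ℂ := if μ = 0 then 1 else -1

/-- `σbar^μ = (1, -σ₁, -σ₂, -σ₃)`. -/
def sigBar (μ : Fin 4) : Matrix (Fin 2) (Fin 2) ℂ := metric μ • sig μ

/-- Dirac matrices `γ^μ`. -/
def gam (μ : Fin 4) : Matrix DIdx DIdx ℂ := Matrix.fromBlocks 0 (sig μ) (sigBar μ) 0

/-- Minkowski product `V · W` (bilinear). -/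
def mdot (V W : Vec) : ℂ := ∑ μ, metric μ * V μ * W μ

/-- Feynman slash `V_μ γ^μ`. -/
def slash (V : Vec) : Matrix DIdx DIdx ℂ := ∑ μ, (metric μ * V μ) • gam μ

/- Helicity spinors. A Weyl spinor `a` stands for `a⟩`; for real momenta `[a` is its
conjugate transpose. -/

/-- The four-vector whose bispinor is `a⟩[b`, that is
`V^μ = (1/2) σbar^μ_{α' α} V^{α α'}` with `V^{α α'} = a^α (b^α')^*`. -/
def bivec (a b : Weyl) : Vec :=
  fun μ => (1 / 2) * ∑ i, ∑ j, star (b i) * sigBar μ i j * a j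

/-- The real, lightlike, future-directed momentum `p = a⟩[a`. Every nonzero momentum of this
kind arises, from a spinor that is unique up to a phase. -/
def momentum (a : Weyl) : Vec := bivec a a

/-- The product `⟨a b⟩`. -/
def angle (a b : Weyl) : ℂ := a 0 * b 1 - a 1 * b 0

/-- The product `[a b] = ⟨b a⟩^*` (real momenta). -/
def square (a b : Weyl) : ℂ := star (angle b a)

/-- Polarization vector of a photon of momentum `q⟩[q` with reference vector `r⟩[r`:
`ε⁻ = √2 q⟩[r / [q r]` for `false` and `ε⁺ = √2 r⟩[q / ⟨r q⟩` for `true`. -/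
def pol (h : Bool) (q r : Weyl) : Vec :=
  if h then ((Real.sqrt 2 : ℂ) / angle r q) • bivec r q
  else ((Real.sqrt 2 : ℂ) / square q r) • bivec q r

/-- Massless Dirac spinor `u` with `p̸ u = 0` and `u† u = 2E`: left-handed `p⟩` for `false`,
right-handed `p]` for `true`. In the massless theory the antiparticle spinors `v` are
the same two solutions. -/
def uSpinor (c : Bool) (p : Weyl) : Dirac :=
  if c then Sum.elim 0 ![star (p 1), -star (p 0)] else Sum.elim p 0

/-- The Dirac conjugate `u† γ^0`. -/
def uBar (c : Bool) (p : Weyl) : Dirac := star (uSpinor c p) ᵥ* gam 0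

/- External states. There are `N` fermion flavors, all massless and of the same charge. -/

/-- Species of an outgoing particle: a photon with a helicity, or a fermion or antifermion
with a flavor and a chirality. -/
inductive Species (N : ℕ)
  | photon (h : Bool)
  | fermion (f : Fin N) (c : Bool)
  | antifermion (f : Fin N) (c : Bool)

/-- Electric charge in units of the coupling. -/
def Species.charge {N : ℕ} : Species N → ℤ
  | .photon _ => 0
  | .fermion _ _ => 1
  | .antifermion _ _ => -1

/-- Fermion number of flavor `f`. -/
def Species.flavorNumber {N : ℕ} : Species N → Fin N → ℤ
  | .photon _, _ => 0
  | .fermion f' _, f => if f' = f then 1 else 0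
  | .antifermion f' _, f => if f' = f then -1 else 0

variable {N n : ℕ}

/-- The total momentum `K_S` of a set of outgoing particles. -/
def totalMomentum (χ : Fin n → Weyl) (S : Finset (Fin n)) : Vec := ∑ a ∈ S, momentum (χ a)

/-- Sign from reordering the fermions of `T ∪ U` (listed increasingly) into those of `T`
followed by those of `U`. -/
def fermiSign (sp : Fin n → Species N) (T U : Finset (Fin n)) : ℂ :=
  (-1) ^ ((T ×ˢ U).filter fun x =>
    (sp x.1).charge ≠ 0 ∧ (sp x.2).charge ≠ 0 ∧ x.2 < x.1).card

/-- Values of the elementary fields `ψbar_f`, `ψ_f`, `A^μ`. -/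
structure Fields (N : ℕ) where
  bar : Fin N → Dirac
  psi : Fin N → Dirac
  pho : Vec

/-- External legs: `⟨a| ψbar_f(0) |0⟩ = ubar`, `⟨a| ψ_f(0) |0⟩ = v`, `⟨a| A(0) |0⟩ = ε` at
order `g^0`; all other one-particle elements vanish. -/
def externalLeg (sp : Species N) (χ ρ : Weyl) : Fields N :=
  match sp with
  | .photon h => ⟨0, 0, pol h χ ρ⟩
  | .fermion f c => ⟨fun f' => if f' = f then uBar c χ else 0, 0, 0⟩
  | .antifermion f c => ⟨0, fun f' => if f' = f then uSpinor c χ else 0, 0⟩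

/-- The tree-level matrix elements `⟨S| ψbar_f(0) |0⟩`, `⟨S| ψ_f(0) |0⟩`, `⟨S| A^μ(0) |0⟩` of
massless QED, `L = -F²/4 + ∑_f ψbar_f (i ∂̸ + g A̸) ψ_f`, in Feynman gauge: the sum of all tree
Feynman diagrams whose root is the field and whose leaves are the particles of `S`.

The root of a diagram with at least two leaves is a propagator of momentum `K = K_S` ending on a
vertex `i g γ^μ`, from which two subdiagrams with complementary sets `T`, `U` of leaves grow.
Outgoing momenta flow along the fermion arrow on a `ψbar` line (propagator `i K̸ / K²`) and against
it on a `ψ` line (propagator `-i K̸ / K²`); the photon propagator is `-i g_{μν} / K²`. -/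
def tree (g : ℝ) (sp : Fin n → Species N) (χ ρ : Fin n → Weyl) (S : Finset (Fin n)) : Fields N :=
  let K := totalMomentum χ S
  let splits := S.ssubsets.filter Finset.Nonempty
  if S.card ≤ 1 then
    { bar := ∑ a ∈ S, (externalLeg (sp a) (χ a) (ρ a)).bar
      psi := ∑ a ∈ S, (externalLeg (sp a) (χ a) (ρ a)).psi
      pho := ∑ a ∈ S, (externalLeg (sp a) (χ a) (ρ a)).pho }
  else
    { bar := fun f => (-(g : ℂ) / mdot K K) • ∑ T ∈ splits.attach, fermiSign sp T.1 (S \ T.1) •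
        (((tree g sp χ ρ T.1).bar f ᵥ* slash (tree g sp χ ρ (S \ T.1)).pho) ᵥ* slash K)
      psi := fun f => ((g : ℂ) / mdot K K) • ∑ T ∈ splits.attach, fermiSign sp T.1 (S \ T.1) •
        (slash K *ᵥ (slash (tree g sp χ ρ T.1).pho *ᵥ (tree g sp χ ρ (S \ T.1)).psi f))
      pho := fun μ => ((g : ℂ) / mdot K K) * ∑ T ∈ splits.attach, fermiSign sp T.1 (S \ T.1) *
        ∑ f, ((tree g sp χ ρ T.1).bar f ᵥ* gam μ) ⬝ᵥ (tree g sp χ ρ (S \ T.1)).psi f }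
termination_by S.card
decreasing_by
  all_goals
    have hT := T.2
    simp only [Finset.mem_filter, Finset.mem_ssubsets, splits] at hT
    first
      | exact Finset.card_lt_card hT.1
      | exact Finset.card_lt_card (Finset.sdiff_ssubset hT.1.subset hT.2)

/- Composite operators at the point `x = 0`. At tree level the matrix element of a product of
fields is the sum, over all ways to distribute the outgoing particles among the factors, of the
product of the matrix elements of the factors: a diagram that is a tree, with the operator as one of
its vertices, falls into one rooted tree for each field when that vertex is removed. -/

/-- Tree-level matrix elements `S ↦ ⟨S| F(0) |0⟩` of an operator `F`. -/
abbrev MatEl (n : ℕ) := Finset (Fin n) → ℂ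

/-- Matrix elements of the identity operator. -/
def MatEl.one : MatEl n := fun S => if S = ∅ then 1 else 0

/-- Matrix elements of the product of two operators. -/
def MatEl.mul (sp : Fin n → Species N) (F G : MatEl n) : MatEl n :=
  fun S => ∑ T ∈ S.powerset, fermiSign sp T (S \ T) * F T * G (S \ T)

/-- Matrix elements of the ordered product `F 0 * F 1 * ⋯`. -/
def MatEl.prod (sp : Fin n → Species N) {m : ℕ} (F : Fin m → MatEl n) : MatEl n :=
  (List.ofFn F).foldr (MatEl.mul sp) MatEl.one

/-- Matrix elements of the exponential `∑ₘ Lᵐ / m!` of an operator with `⟨0| L |0⟩ = 0`, for which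
the powers `m > |S|` have vanishing matrix elements in `⟨S|`. -/
def MatEl.exp (sp : Fin n → Species N) (L : MatEl n) : MatEl n :=
  fun S => ∑ m ∈ Finset.range (S.card + 1),
    (m.factorial : ℂ)⁻¹ * ((MatEl.mul sp L)^[m] MatEl.one) S

/-- The line integral `∫₀^∞ e^{i s x} e^{-ε s} ds` of an outgoing Wilson line tends to `i / x` as
`ε → 0⁺`. -/
theorem tendsto_eikonal_integral {x : ℝ} (hx : x ≠ 0) :
    Tendsto (fun ε : ℝ => ∫ s in Set.Ioi (0 : ℝ),
        Complex.exp (Complex.I * s * x) * Complex.exp (-(ε * s)))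
      (𝓝[>] 0) (𝓝 (Complex.I / x)) := by
  have h1 : ∀ᶠ ε : ℝ in 𝓝[>] 0, -1 / (Complex.I * x - ε) =
      ∫ s in Set.Ioi (0 : ℝ), Complex.exp (Complex.I * s * x) * Complex.exp (-(ε * s)) := by
    filter_upwards [self_mem_nhdsWithin] with ε hε
    have hε' : (Complex.I * x - ε : ℂ).re < 0 := by simpa using hε
    have h := integral_exp_mul_complex_Ioi hε' 0
    simp only [Complex.ofReal_zero, mul_zero, Complex.exp_zero] at h
    rw [← h]
    congr 1
    ext s
    rw [← Complex.exp_add]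
    congr 1
    ring
  refine Tendsto.congr' h1 ?_
  have hx' : (x : ℂ) ≠ 0 := by exact_mod_cast hx
  have h2 : Complex.I / x = -1 / (Complex.I * x - (0 : ℝ)) := by
    rw [Complex.ofReal_zero, sub_zero, div_eq_div_iff hx' (by simp [hx'])]
    linear_combination (x : ℂ) * Complex.I_mul_I
  rw [h2]
  refine Tendsto.mono_left ?_ nhdsWithin_le_nhds
  refine ContinuousAt.tendsto (f := fun ε : ℝ => (-1 : ℂ) / (Complex.I * x - ε)) ?_
  refine ContinuousAt.div (by fun_prop) (by fun_prop) ?_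
  simp [hx']

/-- Matrix elements of the Abelian outgoing Wilson line `exp(i κ g ∫₀^∞ ds m·A(s m))`, `ε → 0⁺`.
Since `⟨S| A(x) |0⟩ = e^{i K_S · x} ⟨S| A(0) |0⟩`, each line integral gives `i / (m · K_S)`. -/
def wilson (g : ℝ) (sp : Fin n → Species N) (χ ρ : Fin n → Weyl) (κ : ℤ) (m : Vec) : MatEl n :=
  MatEl.exp sp fun S => Complex.I * κ * g * mdot m (tree g sp χ ρ S).pho *
    (Complex.I / mdot m (totalMomentum χ S))

/-- The `j`-th field of the operator `ψbar_1 ⋯ ψ_N`, spinor component `i`: it is `ψbar_j` if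
`barred j`, and `ψ_j` otherwise. -/
def opField (g : ℝ) (sp : Fin n → Species N) (χ ρ : Fin n → Weyl) (barred : Fin N → Bool)
    (j : Fin N) (i : DIdx) : MatEl n :=
  fun S => if barred j then (tree g sp χ ρ S).bar j i else (tree g sp χ ρ S).psi j i

/-- Charge of the particle created by the `j`-th field: `1` for `ψbar_j`, `-1` for `ψ_j`. -/
def opCharge (barred : Fin N → Bool) (j : Fin N) : ℤ := if barred j then 1 else -1

/- Jets. The particles are listed sector by sector, as in `⟨X_1 ⋯ X_N; X_s|`: the sector of a
particle is the label of its jet, or `⊤` if it is soft. -/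

/-- The particles in the sector `s`. -/
def sectorSet (sector : Fin n → WithTop (Fin N)) (s : WithTop (Fin N)) : Finset (Fin n) :=
  Finset.univ.filter fun a => sector a = s

/-- `(1, P⃗ / |P⃗|)` for a real momentum `P`. -/
def lightDirection (P : Vec) : Vec := fun μ =>
  if μ = 0 then 1 else P μ / (Real.sqrt (‖P 1‖ ^ 2 + ‖P 2‖ ^ 2 + ‖P 3‖ ^ 2) : ℂ)

/-- The jet direction `n_j`, from the total momentum of the jet. -/
def jetDirection (sector : Fin n → WithTop (Fin N)) (χ : Fin n → Weyl) (j : Fin N) : Vec :=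
  lightDirection (totalMomentum χ (sectorSet sector j))

/-- The full matrix element `⟨X_1 ⋯ X_N; X_s| O |0⟩` of
`O = ∑_α Γ_α (ψbar_1)_{α 1} ⋯ (ψ_N)_{α N}`. -/
def fullMatrixElement (g : ℝ) (sp : Fin n → Species N) (χ ρ : Fin n → Weyl)
    (barred : Fin N → Bool) (Γ : (Fin N → DIdx) → ℂ) : ℂ :=
  ∑ α : Fin N → DIdx, Γ α *
    MatEl.prod sp (fun j => opField g sp χ ρ barred j (α j)) Finset.univ

/-- The factorized expression
`⟨X_1| ψbar_1 W_1 |0⟩ ⋯ ⟨X_N| W_N† ψ_N |0⟩ ⟨X_s| Y_1† ⋯ Y_N |0⟩`, contracted with `Γ`.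
The Wilson line `W_j`, in the direction `t_j`, has the charge opposite to that of the jet, and the
soft Wilson line, in the direction `n_j`, has the charge of the jet. -/
def factorizedMatrixElement (g : ℝ) (sp : Fin n → Species N) (χ ρ : Fin n → Weyl)
    (barred : Fin N → Bool) (Γ : (Fin N → DIdx) → ℂ) (sector : Fin n → WithTop (Fin N))
    (t : Fin N → Vec) : ℂ :=
  (∑ α : Fin N → DIdx, Γ α *
    ∏ j, MatEl.mul sp (opField g sp χ ρ barred j (α j))
      (wilson g sp χ ρ (-opCharge barred j) (t j)) (sectorSet sector j)) *
  MatEl.prod sp (fun j => wilson g sp χ ρ (opCharge barred j) (jetDirection sector χ j))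
    (sectorSet sector ⊤)

/-- Each collinear sector has the flavor quantum numbers of the one particle created by its field,
and the soft sector is neutral in every flavor. -/
def FlavorsMatch (sp : Fin n → Species N) (barred : Fin N → Bool)
    (sector : Fin n → WithTop (Fin N)) : Prop :=
  (∀ j f : Fin N, ∑ a ∈ sectorSet sector (j : WithTop (Fin N)), (sp a).flavorNumber f =
    if f = j then opCharge barred j else 0) ∧
  ∀ f, ∑ a ∈ sectorSet sector ⊤, (sp a).flavorNumber f = 0

/-- A family of `N`-jet states, indexed by `λ → 0⁺`, with the hard scale equal to `1`. Collinear
momenta have energies of order `1`, soft momenta have energies of order `λ²`; two momenta that are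
collinear to each other have `p · q ∼ λ²`, a soft and a collinear momentum have `p · k ∼ λ²`, two
soft momenta have `k · k' ∼ λ⁴`, and momenta in different jets have `p · p' ∼ 1`. For on-shell
momenta this means the light-cone scalings `(λ², 1, λ)` and `(λ², λ², λ²)`. -/
structure JetScaling (sector : Fin n → WithTop (Fin N)) (χ : ℝ → Fin n → Weyl) : Prop where
  energy_coll : ∀ a (j : Fin N), sector a = j →
    (fun l => momentum (χ l a) 0) =Θ[𝓝[>] 0] fun _ => (1 : ℝ)
  energy_soft : ∀ a, sector a = ⊤ →
    (fun l => momentum (χ l a) 0) =Θ[𝓝[>] 0] fun l : ℝ => l ^ 2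
  same_jet : ∀ a b (j : Fin N), a ≠ b → sector a = j → sector b = j →
    (fun l => mdot (momentum (χ l a)) (momentum (χ l b))) =Θ[𝓝[>] 0] fun l : ℝ => l ^ 2
  diff_jet : ∀ a b (i j : Fin N), i ≠ j → sector a = i → sector b = j →
    (fun l => mdot (momentum (χ l a)) (momentum (χ l b))) =Θ[𝓝[>] 0] fun _ => (1 : ℝ)
  soft_jet : ∀ a b (j : Fin N), sector a = ⊤ → sector b = j →
    (fun l => mdot (momentum (χ l a)) (momentum (χ l b))) =Θ[𝓝[>] 0] fun l : ℝ => l ^ 2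
  soft_soft : ∀ a b, a ≠ b → sector a = ⊤ → sector b = ⊤ →
    (fun l => mdot (momentum (χ l a)) (momentum (χ l b))) =Θ[𝓝[>] 0] fun l : ℝ => l ^ 4

/-- The lightlike Wilson line directions `t_j = τ_j⟩[τ_j` are not collinear to the `j`-th jet. -/
structure WilsonDirections (sector : Fin n → WithTop (Fin N)) (χ : ℝ → Fin n → Weyl)
    (τ : ℝ → Fin N → Weyl) : Prop where
  energy : ∀ j, (fun l => momentum (τ l j) 0) =Θ[𝓝[>] 0] fun _ => (1 : ℝ)
  not_collinear : ∀ a (j : Fin N), sector a = j →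
    (fun l => mdot (momentum (τ l j)) (momentum (χ l a))) =Θ[𝓝[>] 0] fun _ => (1 : ℝ)

/-- The reference vectors `ρ_a⟩[ρ_a` of the photons are admissible: linearly independent of the
photon momentum. -/
def AdmissibleRef (sp : Fin n → Species N) (χ ρ : Fin n → Weyl) : Prop :=
  ∀ a, (sp a).charge = 0 → angle (ρ a) (χ a) ≠ 0

/-- The exponent `m` of the leading power `λ^{-m}` of an `N`-jet matrix element: each collinear
particle beyond the first in its jet counts one, each soft particle counts two. -/
def leadingExponent (sector : Fin n → WithTop (Fin N)) : ℕ :=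
  ∑ j : Fin N, ((sectorSet sector (j : WithTop (Fin N))).card - 1) +
    2 * (sectorSet sector ⊤).card

/-- `F ≅ G` at leading power `λ^{-m}`: both are of order at most `λ^{-m}`, and they differ by terms
of higher order in `λ`. -/
def AgreeAtLeadingPower (m : ℕ) (F G : ℝ → ℂ) : Prop :=
  F =O[𝓝[>] 0] (fun l : ℝ => (l ^ m)⁻¹) ∧ G =O[𝓝[>] 0] (fun l : ℝ => (l ^ m)⁻¹) ∧
    (fun l => F l - G l) =o[𝓝[>] 0] (fun l : ℝ => (l ^ m)⁻¹)

/- One photon `a` emitted from a charged external leg `b`. -/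

/-- The component of the fields that creates a charged particle of the given species. -/
def Fields.leg (F : Fields N) : Species N → Dirac
  | .photon _ => 0
  | .fermion f _ => F.bar f
  | .antifermion f _ => F.psi f

/-- The polarization vector of the particle `a`, if it is a photon. -/
def polOf (sp : Fin n → Species N) (χ ρ : Fin n → Weyl) (a : Fin n) : Vec :=
  (externalLeg (sp a) (χ a) (ρ a)).pho

/-- The wave function `ubar` or `v` of the charged particle `b`. -/
def waveFunction (sp : Fin n → Species N) (χ ρ : Fin n → Weyl) (b : Fin n) : Dirac :=
  (externalLeg (sp b) (χ b) (ρ b)).leg (sp b)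

/-- The line of the charged particle `b` after emission of the photon `a`, propagator included:
`-g ubar ε̸ (p̸ + q̸) / (2 p·q)` for a fermion, `g (p̸ + q̸) ε̸ v / (2 p·q)` for an antifermion. -/
def emissionLine (g : ℝ) (sp : Fin n → Species N) (χ ρ : Fin n → Weyl) (b a : Fin n) : Dirac :=
  (tree g sp χ ρ {b, a}).leg (sp b)

/-- The eikonal factor `-Q_b g p·ε / p·q` times the wave function of `b`. -/
def eikonalTerm (g : ℝ) (sp : Fin n → Species N) (χ ρ : Fin n → Weyl) (b a : Fin n) : Dirac :=
  (-((sp b).charge : ℂ) * g * (mdot (momentum (χ b)) (polOf sp χ ρ a) /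
    mdot (momentum (χ b)) (momentum (χ a)))) • waveFunction sp χ ρ b

/-- The spin-dependent term `-g ubar ε̸ q̸ / (2 p·q)` for a fermion, `g q̸ ε̸ v / (2 p·q)` for an
antifermion. -/
def spinTerm (g : ℝ) (sp : Fin n → Species N) (χ ρ : Fin n → Weyl) (b a : Fin n) : Dirac :=
  let q := momentum (χ a)
  let w := waveFunction sp χ ρ b
  ((g : ℂ) / (2 * mdot (momentum (χ b)) q)) •
    match sp b with
    | .photon _ => 0
    | .fermion _ _ => -((w ᵥ* slash (polOf sp χ ρ a)) ᵥ* slash q)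
    | .antifermion _ _ => slash q *ᵥ (slash (polOf sp χ ρ a) *ᵥ w)

end

end TreeQED

open TreeQED

/-!
The matrix elements of operators between the vacuum and subsets of the external particles form a
graded algebra `FieldAlg`: every particle is a nilpotent generator, photons commute with everything
and charged particles anticommute. Operators that preserve flavor have even elements, which are
central. A gauge parameter is such an element `Λ`, and it acts on the tree-level fields by
`ψbar ↦ ψbar exp (-gΛ)`, `ψ ↦ exp (gΛ) ψ`, `A_S ↦ A_S + Λ_S K_S`. The equations of motion are
covariant, so the off-shell recursion for `ψbar`, `ψ` and `A` holds in every gauge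
(`gaugeBar_recursion`, `gaugePsi_recursion`, `tree_pho_eq_gauge`).

**Both sides are products of gauge transformed fields.** The Wilson line along `m` is the
exponential of the gauge parameter `-m·A_S / m·K_S`, which imposes `m·A = 0` (`wilson_apply_eq`).
Hence a jet created by `ψbar_j W_j` is a matrix element of `ψbar_j` in light-cone gauge
`t_j·A = 0` (`mul_wilson_jet`). Because the operator is neutral, the full matrix element is the same
in every gauge (`prod_opField_eq`), and so is the soft factor (`prod_wilson_soft`). Everything is
expressed in one common gauge: `t_j·A = 0` for the photons of the `j`-th jet and `A⁰ = 0` for the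
soft photons.

**Power counting** is an induction on the recursion (`fieldBound_step`). It closes with optimal
exponents in a frame where all momenta of a sector have components of the same size, and in a gauge
where the photon field is no larger than its physical components. The recursion is covariant also
under the action of `2 × 2` matrices of positive determinant, so each sector may use its own frame.
Soft particles are rescaled by a dilatation (`soft_fieldBound`). In the `j`-th jet, one boosts
along the jet and uses the gauge `t_j·A = 0` for collinear and `n_j·A = 0` for soft photons
(`jet_fieldBound`). In this gauge the enhanced component of the soft field vanishes, so that the
first soft particle coupled to a jet costs one power of `λ`: this is the decoupling of soft
radiation. Particles of different jets are combined in the original frame (`common_fieldBound`).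

**Factorization of a field.** The change from the gauge of the `j`-th jet to the common gauge
involves soft particles only, and its exponential is the soft Wilson line of the jet
(`gaugeField_common`). At leading power all soft particles come from it, so that the field in its
own jet dressed with soft particles is the jet matrix element times the soft Wilson line
(`gaugeField_sub_factorField`).

**Only one distribution of the particles is leading.** A field pays one power of `λ` for each jet
from which it creates particles, and at least one in all; by flavor conservation it needs two if it
creates exactly another jet (`gaugeField_order`). In a product of `N` fields that create `N` jets
the minimum, `N`, is attained only if each field creates its own jet (`isDressedJet_or_excess`).

**One emission.** The decomposition of the emission line is the Clifford relation together with the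
massless Dirac equation (`emissionLine_eq`). A change of the reference vector shifts `ε` by a
multiple of `q`, which drops out of the spin term because `slash q * slash q = 0`. For one helicity
of the photon the spin term vanishes; for the other the reference spinor cancels, which leaves the
wave function of a particle with the momentum of the photon, divided by a single spinor product
(`uBar_pol_slash`, `slash_pol_uSpinor`). Its size can then be read off (`spinTerm_order`).
-/

namespace TreeQED

variable {N n : ℕ}

/-! ### The graded algebra of tree-level matrix elements -/

/-- The charged particles of a set. Reordering signs only see these. -/
def chargedPart (sp : Fin n → Species N) (S : Finset (Fin n)) : Finset (Fin n) :=
  S.filter fun a => (sp a).charge ≠ 0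

theorem fermiSign_union_left (sp : Fin n → Species N) {T U : Finset (Fin n)} (V : Finset (Fin n))
    (h : Disjoint T U) :
    fermiSign sp (T ∪ U) V = fermiSign sp T V * fermiSign sp U V := by
  unfold fermiSign
  rw [← pow_add, ← Finset.card_union_of_disjoint, ← Finset.filter_union, Finset.union_product]
  exact Finset.disjoint_filter_filter (Finset.disjoint_product.2 (Or.inl h))

theorem fermiSign_union_right (sp : Fin n → Species N) {U V : Finset (Fin n)}
    (T : Finset (Fin n)) (h : Disjoint U V) :
    fermiSign sp T (U ∪ V) = fermiSign sp T U * fermiSign sp T V := by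
  unfold fermiSign
  rw [← pow_add, ← Finset.card_union_of_disjoint, ← Finset.filter_union, Finset.product_union]
  exact Finset.disjoint_filter_filter (Finset.disjoint_product.2 (Or.inr h))

@[simp] theorem fermiSign_empty_left (sp : Fin n → Species N) (U : Finset (Fin n)) :
    fermiSign sp ∅ U = 1 := by simp [fermiSign]

@[simp] theorem fermiSign_empty_right (sp : Fin n → Species N) (U : Finset (Fin n)) :
    fermiSign sp U ∅ = 1 := by simp [fermiSign]

/-- No sign arises if the first set precedes the second one. -/
theorem fermiSign_of_lt (sp : Fin n → Species N) {T U : Finset (Fin n)}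
    (h : ∀ a ∈ T, ∀ b ∈ U, a < b) : fermiSign sp T U = 1 := by
  unfold fermiSign
  rw [Finset.filter_eq_empty_iff.2, Finset.card_empty, pow_zero]
  rintro ⟨a, b⟩ hab ⟨-, -, hlt⟩
  rw [Finset.mem_product] at hab
  exact absurd (h a hab.1 b hab.2) (not_lt.2 hlt.le)

theorem fermiSign_mul_swap (sp : Fin n → Species N) {T U : Finset (Fin n)} (h : Disjoint T U) :
    fermiSign sp T U * fermiSign sp U T =
      (-1) ^ ((chargedPart sp T).card * (chargedPart sp U).card) := by
  unfold fermiSign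
  rw [← pow_add]
  congr 1
  rw [← Finset.card_product]
  rw [← Finset.card_map (⟨Prod.swap, Prod.swap_injective⟩ : Fin n × Fin n ↪ Fin n × Fin n)
    (s := (U ×ˢ T).filter _), ← Finset.card_union_of_disjoint]
  · congr 1
    ext ⟨a, b⟩
    simp only [Finset.mem_union, Finset.mem_filter, Finset.mem_product, Finset.mem_map,
      Function.Embedding.coeFn_mk, Prod.exists, Prod.swap_prod_mk, Prod.mk.injEq, chargedPart]
    constructor
    · rintro (⟨⟨h1, h2⟩, h3, h4, -⟩ | ⟨x, y, ⟨⟨h1, h2⟩, h3, h4, -⟩, rfl, rfl⟩)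
      · exact ⟨⟨h1, h3⟩, h2, h4⟩
      · exact ⟨⟨h2, h4⟩, h1, h3⟩
    · rintro ⟨⟨h1, h2⟩, h3, h4⟩
      rcases lt_trichotomy a b with hab | rfl | hab
      · exact Or.inr ⟨b, a, ⟨⟨h3, h1⟩, h4, h2, hab⟩, rfl, rfl⟩
      · exact absurd h3 (Finset.disjoint_left.1 h h1)
      · exact Or.inl ⟨⟨h1, h3⟩, h2, h4, hab⟩
  · rw [Finset.disjoint_left]
    rintro ⟨a, b⟩ h1 h2
    simp only [Finset.mem_filter, Finset.mem_map, Function.Embedding.coeFn_mk, Prod.exists,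
      Prod.swap_prod_mk, Prod.mk.injEq] at h1 h2
    obtain ⟨x, y, h3, rfl, rfl⟩ := h2
    exact absurd h1.2.2.2 (not_lt.2 h3.2.2.2.le)

theorem fermiSign_comm_of_even (sp : Fin n → Species N) {T U : Finset (Fin n)}
    (h : Disjoint T U) (hT : Even (chargedPart sp T).card) :
    fermiSign sp T U = fermiSign sp U T := by
  have h1 := fermiSign_mul_swap sp h
  rw [(hT.mul_right _).neg_one_pow] at h1
  have h2 : fermiSign sp U T * fermiSign sp U T = 1 := by
    unfold fermiSign
    rw [← pow_add, Even.neg_one_pow ⟨_, rfl⟩]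
  have h3 : fermiSign sp U T ≠ 0 := fun h0 => by simp [h0] at h2
  exact mul_right_cancel₀ h3 (h1.trans h2.symm)

/-- Tree-level matrix elements, as an algebra under the product of operators. It is generated by one
element of square zero for each external particle, those of charged particles anticommuting and
those of photons being central; `F S` is the coefficient of the product of the generators in `S`. -/
def FieldAlg (_sp : Fin n → Species N) : Type := Finset (Fin n) → ℂ

namespace FieldAlg

variable {sp : Fin n → Species N}

instance : AddCommGroup (FieldAlg sp) := inferInstanceAs (AddCommGroup (Finset (Fin n) → ℂ))
instance : Module ℂ (FieldAlg sp) := inferInstanceAs (Module ℂ (Finset (Fin n) → ℂ))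
noncomputable instance : Module ℚ (FieldAlg sp) := inferInstanceAs (Module ℚ (Finset (Fin n) → ℂ))
instance : Mul (FieldAlg sp) := ⟨MatEl.mul sp⟩
instance : One (FieldAlg sp) := ⟨MatEl.one⟩

theorem mul_apply (F G : FieldAlg sp) (S : Finset (Fin n)) :
    (F * G) S = ∑ T ∈ S.powerset, fermiSign sp T (S \ T) * F T * G (S \ T) := rfl

theorem one_apply (S : Finset (Fin n)) : (1 : FieldAlg sp) S = if S = ∅ then 1 else 0 := rfl

theorem add_apply (F G : FieldAlg sp) (S : Finset (Fin n)) : (F + G) S = F S + G S := rfl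

theorem zero_apply (S : Finset (Fin n)) : (0 : FieldAlg sp) S = 0 := rfl

theorem sub_apply (F G : FieldAlg sp) (S : Finset (Fin n)) : (F - G) S = F S - G S := rfl

theorem smul_apply (c : ℂ) (F : FieldAlg sp) (S : Finset (Fin n)) : (c • F) S = c * F S := rfl

theorem sum_apply {ι : Type*} (s : Finset ι) (F : ι → FieldAlg sp) (S : Finset (Fin n)) :
    (∑ i ∈ s, F i) S = ∑ i ∈ s, F i S := Finset.sum_apply S s F

@[ext] theorem ext {F G : FieldAlg sp} (h : ∀ S, F S = G S) : F = G := funext h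

theorem mul_assoc' (F G H : FieldAlg sp) : F * G * H = F * (G * H) := by
  ext S
  simp only [mul_apply, Finset.mul_sum, Finset.sum_mul]
  rw [Finset.sum_sigma', Finset.sum_sigma']
  refine Finset.sum_bij' (fun x _ => ⟨x.2, x.1 \ x.2⟩) (fun x _ => ⟨x.1 ∪ x.2, x.1⟩)
    ?_ ?_ ?_ ?_ ?_
  · rintro ⟨T, U⟩ h
    simp only [Finset.mem_sigma, Finset.mem_powerset] at h ⊢
    exact ⟨h.2.trans h.1, Finset.sdiff_subset_sdiff h.1 le_rfl⟩
  · rintro ⟨T, U⟩ h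
    simp only [Finset.mem_sigma, Finset.mem_powerset] at h ⊢
    exact ⟨Finset.union_subset h.1 (h.2.trans Finset.sdiff_subset), Finset.subset_union_left⟩
  · rintro ⟨T, U⟩ h
    simp only [Finset.mem_sigma, Finset.mem_powerset] at h ⊢
    rw [Finset.union_sdiff_of_subset h.2]
  · rintro ⟨T, U⟩ h
    simp only [Finset.mem_sigma, Finset.mem_powerset] at h ⊢
    rw [Finset.union_sdiff_cancel_left]
    exact Finset.disjoint_of_subset_right h.2 Finset.disjoint_sdiff
  · rintro ⟨T, U⟩ h
    simp only [Finset.mem_sigma, Finset.mem_powerset] at h ⊢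
    obtain ⟨hT, hU⟩ := h
    have e1 : (S \ U) \ (T \ U) = S \ T := by
      ext a
      have := @hU a
      simp only [Finset.mem_sdiff]
      tauto
    have e2 : S \ U = (T \ U) ∪ (S \ T) := by
      rw [Finset.union_comm]
      exact (Finset.sdiff_union_sdiff_cancel hT hU).symm
    have d1 : Disjoint (T \ U) (S \ T) :=
      Finset.disjoint_of_subset_left Finset.sdiff_subset Finset.disjoint_sdiff
    have s1 : fermiSign sp T (S \ T) = fermiSign sp U (S \ T) * fermiSign sp (T \ U) (S \ T) := by
      rw [← fermiSign_union_left sp _ Finset.disjoint_sdiff, Finset.union_sdiff_of_subset hU]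
    have s2 : fermiSign sp U (S \ U) = fermiSign sp U (T \ U) * fermiSign sp U (S \ T) := by
      rw [← fermiSign_union_right sp _ d1, ← e2]
    rw [e1, s1, s2]
    ring

instance : Ring (FieldAlg sp) :=
  { (inferInstance : AddCommGroup (FieldAlg sp)),
    (inferInstance : Mul (FieldAlg sp)),
    (inferInstance : One (FieldAlg sp)) with
    left_distrib := fun F G H => by
      ext S
      simp only [mul_apply, add_apply, mul_add, Finset.sum_add_distrib]
    right_distrib := fun F G H => by
      ext S
      simp only [mul_apply, add_apply, mul_add, add_mul, Finset.sum_add_distrib]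
    zero_mul := fun F => by
      ext S
      simp only [mul_apply, zero_apply, mul_zero, zero_mul, Finset.sum_const_zero]
    mul_zero := fun F => by
      ext S
      simp only [mul_apply, zero_apply, mul_zero, Finset.sum_const_zero]
    mul_assoc := mul_assoc'
    one_mul := fun F => by
      ext S
      rw [mul_apply, Finset.sum_eq_single ∅]
      · simp [one_apply]
      · intro T _ hT
        simp [one_apply, hT]
      · intro h
        exact absurd (Finset.empty_mem_powerset S) h
    mul_one := fun F => by
      ext S
      rw [mul_apply, Finset.sum_eq_single S]
      · simp [one_apply]
      · intro T hT hTS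
        have : S \ T ≠ ∅ := fun h =>
          hTS (Finset.Subset.antisymm (Finset.mem_powerset.1 hT)
            (Finset.sdiff_eq_empty_iff_subset.1 h))
        simp [one_apply, this]
      · intro h
        exact absurd (Finset.mem_powerset_self S) h
    zsmul := fun z F => z • F
    nsmul := fun k F => k • F
    nsmul_zero := fun F => zero_smul ℕ F
    nsmul_succ := fun k F => succ_nsmul F k
    zsmul_zero' := fun F => zero_smul ℤ F
    zsmul_succ' := fun k F => SubNegMonoid.zsmul_succ' k F
    zsmul_neg' := fun k F => SubNegMonoid.zsmul_neg' k F
    neg_add_cancel := fun F => neg_add_cancel F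
    sub_eq_add_neg := fun F G => sub_eq_add_neg F G }

theorem smul_mul (c : ℂ) (F G : FieldAlg sp) : (c • F) * G = c • (F * G) := by
  ext S
  simp only [mul_apply, smul_apply, Finset.mul_sum]
  exact Finset.sum_congr rfl fun _ _ => by ring

theorem mul_smul' (c : ℂ) (F G : FieldAlg sp) : F * (c • G) = c • (F * G) := by
  ext S
  simp only [mul_apply, smul_apply, Finset.mul_sum]
  exact Finset.sum_congr rfl fun _ _ => by ring

instance : Algebra ℂ (FieldAlg sp) := Algebra.ofModule smul_mul mul_smul'

theorem rat_smul_apply (q : ℚ) (F : FieldAlg sp) (S : Finset (Fin n)) :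
    (q • F) S = (q : ℂ) * F S := by
  change q • (F S) = _
  rw [Rat.smul_def]

/-- Products at `S` only depend on the factors at subsets of `S`. -/
theorem mul_congr {F F' G G' : FieldAlg sp} {S : Finset (Fin n)}
    (hF : ∀ T ⊆ S, F T = F' T) (hG : ∀ T ⊆ S, G T = G' T) : (F * G) S = (F' * G') S := by
  rw [mul_apply, mul_apply]
  refine Finset.sum_congr rfl fun T hT => ?_
  rw [hF T (Finset.mem_powerset.1 hT), hG _ Finset.sdiff_subset]

theorem pow_congr {F F' : FieldAlg sp} {S : Finset (Fin n)}
    (hF : ∀ T ⊆ S, F T = F' T) (m : ℕ) : ∀ T ⊆ S, (F ^ m) T = (F' ^ m) T := by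
  induction m with
  | zero => intro T _; simp
  | succ m ih =>
    intro T hT
    rw [pow_succ, pow_succ]
    exact mul_congr (fun U hU => ih U (hU.trans hT)) (fun U hU => hF U (hU.trans hT))

/-- If the vacuum expectation value vanishes, then at least `m` particles are needed for an
`m`-th power. -/
theorem pow_apply_eq_zero {F : FieldAlg sp} (hF : F ∅ = 0) {m : ℕ} {S : Finset (Fin n)}
    (h : S.card < m) : (F ^ m) S = 0 := by
  induction m generalizing S with
  | zero => omega
  | succ m ih =>
    rw [pow_succ, mul_apply]
    refine Finset.sum_eq_zero fun T hT => ?_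
    rw [Finset.mem_powerset] at hT
    by_cases hc : T.card < m
    · rw [ih hc]; ring
    · have : T = S := Finset.eq_of_subset_of_card_le hT (by omega)
      rw [this, Finset.sdiff_self, hF, mul_zero]

theorem pow_eq_zero {F : FieldAlg sp} (hF : F ∅ = 0) : F ^ (n + 1) = 0 := by
  ext S
  exact pow_apply_eq_zero hF (Nat.lt_succ_of_le ((Finset.card_le_univ S).trans (by simp)))

theorem isNilpotent {F : FieldAlg sp} (hF : F ∅ = 0) : IsNilpotent F := ⟨n + 1, pow_eq_zero hF⟩

theorem exp_eq {F : FieldAlg sp} (hF : F ∅ = 0) (S : Finset (Fin n)) :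
    IsNilpotent.exp F S = ∑ m ∈ Finset.range (n + 1), (m.factorial : ℂ)⁻¹ * (F ^ m) S := by
  rw [IsNilpotent.exp_eq_sum (pow_eq_zero hF), sum_apply]
  refine Finset.sum_congr rfl fun m _ => ?_
  rw [rat_smul_apply]
  push_cast
  rfl

/-- The truncated exponential series is the exponential of a nilpotent element. -/
theorem matEl_exp_eq {F : FieldAlg sp} (hF : F ∅ = 0) : MatEl.exp sp F = IsNilpotent.exp F := by
  ext S
  have hit : ∀ m, (MatEl.mul sp F)^[m] MatEl.one = F ^ m := by
    intro m
    induction m with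
    | zero => rfl
    | succ m ih =>
      rw [Function.iterate_succ_apply', ih, pow_succ']
      rfl
  have hcard : S.card ≤ n := (Finset.card_le_univ S).trans (by simp)
  rw [exp_eq hF]
  unfold MatEl.exp
  simp only [hit]
  refine Finset.sum_subset (Finset.range_mono (by omega)) fun m _ hm => ?_
  rw [pow_apply_eq_zero hF (by simpa using hm), mul_zero]

theorem exp_congr {F F' : FieldAlg sp} {S : Finset (Fin n)} (h0 : F ∅ = 0)
    (hF : ∀ T ⊆ S, F T = F' T) : IsNilpotent.exp F S = IsNilpotent.exp F' S := by
  rw [exp_eq h0, exp_eq ((hF ∅ (Finset.empty_subset S)) ▸ h0)]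
  exact Finset.sum_congr rfl fun m _ => by rw [pow_congr hF m S le_rfl]

theorem exp_apply_empty {F : FieldAlg sp} (hF : F ∅ = 0) :
    IsNilpotent.exp F ∅ = 1 := by
  rw [exp_eq hF, Finset.sum_eq_single 0]
  · simp [one_apply]
  · intro m _ hm
    rw [pow_apply_eq_zero hF (by simpa using Nat.pos_of_ne_zero hm), mul_zero]
  · simp

/-- Bosonic elements: only states with an even number of fermions occur. -/
def IsEven (F : FieldAlg sp) : Prop := ∀ S, F S ≠ 0 → Even (chargedPart sp S).card

theorem IsEven.commute {F : FieldAlg sp} (hF : IsEven F) (G : FieldAlg sp) : Commute F G := by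
  ext S
  rw [mul_apply, mul_apply]
  refine Finset.sum_bij' (fun T _ => S \ T) (fun T _ => S \ T) ?_ ?_ ?_ ?_ ?_
  · intro T _; simp
  · intro T _; simp
  · intro T hT; simpa using hT
  · intro T hT; simpa using hT
  · intro T hT
    have hT' : S \ (S \ T) = T := by simpa using hT
    rw [hT']
    by_cases h0 : F T = 0
    · simp [h0]
    · rw [fermiSign_comm_of_even sp Finset.disjoint_sdiff (hF T h0)]
      ring

theorem IsEven.mul {F G : FieldAlg sp} (hF : IsEven F) (hG : IsEven G) : IsEven (F * G) := by
  intro S hS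
  obtain ⟨T, hT, h⟩ := Finset.exists_ne_zero_of_sum_ne_zero hS
  have h1 := hF T (fun h0 => h (by simp [h0]))
  have h2 := hG (S \ T) (fun h0 => h (by simp [h0]))
  rw [Finset.mem_powerset] at hT
  have h3 : chargedPart sp S = chargedPart sp T ∪ chargedPart sp (S \ T) := by
    unfold chargedPart
    rw [← Finset.filter_union, Finset.union_sdiff_of_subset hT]
  have h4 : Disjoint (chargedPart sp T) (chargedPart sp (S \ T)) :=
    Finset.disjoint_filter_filter Finset.disjoint_sdiff
  rw [h3, Finset.card_union_of_disjoint h4]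
  exact h1.add h2

theorem IsEven.one : IsEven (1 : FieldAlg sp) := by
  intro S hS
  rw [one_apply] at hS
  have : S = ∅ := by by_contra h; simp [h] at hS
  simp [this, chargedPart]

theorem IsEven.pow {F : FieldAlg sp} (hF : IsEven F) (m : ℕ) : IsEven (F ^ m) := by
  induction m with
  | zero => simpa using IsEven.one
  | succ m ih => rw [pow_succ]; exact ih.mul hF

theorem IsEven.exp {F : FieldAlg sp} (hF : IsEven F) (h0 : F ∅ = 0) :
    IsEven (IsNilpotent.exp F) := by
  intro S hS
  rw [exp_eq h0] at hS
  obtain ⟨m, _, h⟩ := Finset.exists_ne_zero_of_sum_ne_zero hS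
  exact hF.pow m S (right_ne_zero_of_mul h)

theorem IsEven.smul {F : FieldAlg sp} (hF : IsEven F) (c : ℂ) : IsEven (c • F) :=
  fun S hS => hF S (right_ne_zero_of_mul (a := c) hS)

theorem IsEven.sub {F G : FieldAlg sp} (hF : IsEven F) (hG : IsEven G) : IsEven (F - G) := by
  intro S hS
  by_cases h : F S = 0
  · exact hG S fun h' => hS (by rw [sub_apply, h, h', sub_zero])
  · exact hF S h

/-- Differentiation in a direction: on a state of total momentum `K = ∑ k_a` the derivative acts as
multiplication by the component of `K`, up to a factor `i`. -/
def der (k : Fin n → ℂ) (F : FieldAlg sp) : FieldAlg sp := fun S => (∑ a ∈ S, k a) * F S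

theorem der_apply (k : Fin n → ℂ) (F : FieldAlg sp) (S : Finset (Fin n)) :
    der k F S = (∑ a ∈ S, k a) * F S := rfl

theorem der_mul (k : Fin n → ℂ) (F G : FieldAlg sp) :
    der k (F * G) = der k F * G + F * der k G := by
  ext S
  simp only [der_apply, add_apply, mul_apply, Finset.mul_sum (a := ∑ a ∈ S, k a)]
  rw [← Finset.sum_add_distrib]
  refine Finset.sum_congr rfl fun T hT => ?_
  rw [← Finset.sum_sdiff (Finset.mem_powerset.1 hT)]
  ring

theorem der_one (k : Fin n → ℂ) : der k (1 : FieldAlg sp) = 0 := by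
  ext S
  rw [der_apply, one_apply, zero_apply]
  split_ifs with h
  · simp [h]
  · simp

theorem der_smul (k : Fin n → ℂ) (c : ℂ) (F : FieldAlg sp) : der k (c • F) = c • der k F := by
  ext S
  simp only [der_apply, smul_apply]
  ring

theorem der_pow_succ (k : Fin n → ℂ) {F : FieldAlg sp} (hF : IsEven F) (m : ℕ) :
    der k (F ^ (m + 1)) = ((m : ℂ) + 1) • (F ^ m * der k F) := by
  induction m with
  | zero => simp
  | succ m ih =>
    rw [pow_succ, der_mul, ih, smul_mul, mul_assoc, ← (hF.commute (der k F)).eq, ← mul_assoc,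
      ← pow_succ]
    push_cast
    rw [add_smul ((m : ℂ) + 1), one_smul]

/-- The chain rule for the exponential of a bosonic element. -/
theorem der_exp (k : Fin n → ℂ) {F : FieldAlg sp} (hF : IsEven F) (h0 : F ∅ = 0) :
    der k (IsNilpotent.exp F) = IsNilpotent.exp F * der k F := by
  have hs : ∀ K, F ^ K = 0 → IsNilpotent.exp F =
      ∑ m ∈ Finset.range K, (m.factorial : ℂ)⁻¹ • F ^ m := by
    intro K hK
    rw [IsNilpotent.exp_eq_sum hK]
    refine Finset.sum_congr rfl fun m _ => ?_
    ext S
    rw [rat_smul_apply, smul_apply]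
    push_cast
    rfl
  have hder : ∀ (s : Finset ℕ) (G : ℕ → FieldAlg sp),
      der k (∑ m ∈ s, G m) = ∑ m ∈ s, der k (G m) := by
    intro s G
    ext S
    simp only [der_apply, sum_apply, Finset.mul_sum]
  conv_lhs => rw [hs (n + 1 + 1) (by rw [pow_succ, pow_eq_zero h0, zero_mul])]
  rw [hs (n + 1) (pow_eq_zero h0), hder, Finset.sum_range_succ', Finset.sum_mul]
  simp only [der_smul, pow_zero, der_one, smul_zero, add_zero, der_pow_succ k hF, smul_smul,
    smul_mul]
  refine Finset.sum_congr rfl fun m _ => ?_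
  congr 1
  rw [Nat.factorial_succ]
  push_cast
  have h1 : (m.factorial : ℂ) ≠ 0 := by exact_mod_cast m.factorial_ne_zero
  have h2 : (m : ℂ) + 1 ≠ 0 := by exact_mod_cast m.succ_ne_zero
  field_simp

/-- Conservation of the fermion numbers: `F` only creates states with fermion numbers `φ`. -/
def HasFlavor (F : FieldAlg sp) (φ : Fin N → ℤ) : Prop :=
  ∀ S, F S ≠ 0 → ∀ f, ∑ a ∈ S, (sp a).flavorNumber f = φ f

theorem HasFlavor.mul {F G : FieldAlg sp} {φ ψ : Fin N → ℤ} (hF : HasFlavor F φ)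
    (hG : HasFlavor G ψ) : HasFlavor (F * G) (φ + ψ) := by
  intro S hS f
  obtain ⟨T, hT, h⟩ := Finset.exists_ne_zero_of_sum_ne_zero hS
  have h1 := hF T (fun h0 => h (by simp [h0])) f
  have h2 := hG (S \ T) (fun h0 => h (by simp [h0])) f
  rw [← Finset.sum_sdiff (Finset.mem_powerset.1 hT), h1, h2, Pi.add_apply, add_comm]

theorem HasFlavor.one : HasFlavor (1 : FieldAlg sp) 0 := by
  intro S hS f
  rw [one_apply] at hS
  have : S = ∅ := by by_contra h; simp [h] at hS
  simp [this]

theorem HasFlavor.pow {F : FieldAlg sp} (hF : HasFlavor F 0) (m : ℕ) : HasFlavor (F ^ m) 0 := by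
  induction m with
  | zero => simpa using HasFlavor.one
  | succ m ih => rw [pow_succ]; simpa using ih.mul hF

theorem HasFlavor.exp {F : FieldAlg sp} (hF : HasFlavor F 0) (h0 : F ∅ = 0) :
    HasFlavor (IsNilpotent.exp F) 0 := by
  intro S hS
  rw [exp_eq h0] at hS
  obtain ⟨m, _, h⟩ := Finset.exists_ne_zero_of_sum_ne_zero hS
  exact hF.pow m S (right_ne_zero_of_mul h)

theorem _root_.TreeQED.Species.charge_eq_sum_flavorNumber (s : Species N) :
    s.charge = ∑ f, s.flavorNumber f := by
  cases s <;> simp [Species.charge, Species.flavorNumber]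

/-- A flavor-neutral state contains an even number of fermions. -/
theorem HasFlavor.isEven {F : FieldAlg sp} (hF : HasFlavor F 0) : IsEven F := by
  intro S hS
  have h1 : ∑ a ∈ S, (sp a).charge = 0 := by
    simp only [Species.charge_eq_sum_flavorNumber]
    rw [Finset.sum_comm]
    exact Finset.sum_eq_zero fun f _ => hF S hS f
  have h2 : ∀ s : Species N, (s.charge : ZMod 2) = if s.charge ≠ 0 then 1 else 0 := by
    intro s
    cases s <;> simp [Species.charge]
  have h3 : ((chargedPart sp S).card : ZMod 2) = 0 := by
    unfold chargedPart
    rw [Finset.card_filter]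
    push_cast
    rw [← Finset.sum_congr rfl fun a _ => h2 (sp a), ← Int.cast_sum, h1, Int.cast_zero]
  exact (ZMod.natCast_eq_zero_iff_even).1 h3

theorem HasFlavor.smul {F : FieldAlg sp} {φ : Fin N → ℤ} (hF : HasFlavor F φ) (c : ℂ) :
    HasFlavor (c • F) φ := fun S hS => hF S (right_ne_zero_of_mul (a := c) hS)

end FieldAlg

/-! ### Bispinors and the Dirac algebra -/

/-- The bispinor `V_μ σ^μ` of a four-vector. -/
noncomputable def bispinor (V : Vec) : Matrix (Fin 2) (Fin 2) ℂ := ∑ μ, (metric μ * V μ) • sig μ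

theorem bispinor_eq (V : Vec) : bispinor V =
    !![V 0 - V 3, -V 1 + Complex.I * V 2; -V 1 - Complex.I * V 2, V 0 + V 3] := by
  ext i j
  fin_cases i <;> fin_cases j <;>
    simp [bispinor, Fin.sum_univ_four, sig, metric] <;> ring

/-- In the chiral basis `slash V` maps between the two Weyl components, by the bispinor of `V` and
its adjugate. -/
theorem slash_eq (V : Vec) :
    slash V = fromBlocks 0 (bispinor V) (adjugate (bispinor V)) 0 := by
  have h : adjugate (bispinor V) = ∑ μ, (metric μ * V μ) • sigBar μ := by
    rw [bispinor_eq, adjugate_fin_two_of]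
    ext i j
    fin_cases i <;> fin_cases j <;>
      simp [Fin.sum_univ_four, sig, sigBar, metric] <;> ring
  rw [h]
  ext (i | i) (j | j) <;> simp [slash, gam, bispinor, Matrix.sum_apply]

theorem bispinor_add (V W : Vec) : bispinor (V + W) = bispinor V + bispinor W := by
  simp [bispinor, mul_add, add_smul, Finset.sum_add_distrib]

theorem bispinor_smul (c : ℂ) (V : Vec) : bispinor (c • V) = c • bispinor V := by
  simp only [bispinor, Finset.smul_sum, smul_smul, Pi.smul_apply, smul_eq_mul]
  exact Finset.sum_congr rfl fun _ _ => by ring_nf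

theorem slash_add (V W : Vec) : slash (V + W) = slash V + slash W := by
  simp [slash, mul_add, add_smul, Finset.sum_add_distrib]

theorem slash_smul (c : ℂ) (V : Vec) : slash (c • V) = c • slash V := by
  simp only [slash, Finset.smul_sum, smul_smul, Pi.smul_apply, smul_eq_mul]
  exact Finset.sum_congr rfl fun _ _ => by ring_nf

theorem slash_zero : slash 0 = 0 := by simp [slash]

theorem bispinor_zero : bispinor 0 = 0 := by simp [bispinor]

theorem slash_sum {ι : Type*} (s : Finset ι) (V : ι → Vec) :
    slash (∑ a ∈ s, V a) = ∑ a ∈ s, slash (V a) := by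
  classical
  induction s using Finset.induction_on with
  | empty => simp [slash_zero]
  | insert a s ha ih => rw [Finset.sum_insert ha, Finset.sum_insert ha, slash_add, ih]

theorem bispinor_sum {ι : Type*} (s : Finset ι) (V : ι → Vec) :
    bispinor (∑ a ∈ s, V a) = ∑ a ∈ s, bispinor (V a) := by
  classical
  induction s using Finset.induction_on with
  | empty => simp [bispinor_zero]
  | insert a s ha ih => rw [Finset.sum_insert ha, Finset.sum_insert ha, bispinor_add, ih]

theorem bispinor_bivec (a b : Weyl) (i j : Fin 2) :
    bispinor (bivec a b) i j = a i * star (b j) := by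
  rw [bispinor_eq]
  fin_cases i <;> fin_cases j <;>
    simp [bivec, sigBar, sig, metric, Fin.sum_univ_two] <;> ring_nf <;>
    simp only [Complex.I_sq] <;> ring

theorem bispinor_momentum (a : Weyl) (i j : Fin 2) :
    bispinor (momentum a) i j = a i * star (a j) := bispinor_bivec a a i j

theorem det_bispinor (V : Vec) : (bispinor V).det = mdot V V := by
  rw [bispinor_eq, det_fin_two_of]
  simp only [mdot, Fin.sum_univ_four, metric]
  simp
  linear_combination (V 2 ^ 2) * Complex.I_mul_I

theorem slash_mul_slash_self (V : Vec) : slash V * slash V = mdot V V • 1 := by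
  rw [slash_eq, fromBlocks_multiply]
  simp only [zero_mul, mul_zero, add_zero, zero_add, mul_adjugate, adjugate_mul, det_bispinor]
  ext (i | i) (j | j) <;> simp [Matrix.one_apply]

theorem mdot_comm (V W : Vec) : mdot V W = mdot W V :=
  Finset.sum_congr rfl fun _ _ => by ring

theorem mdot_add_right (V W W' : Vec) : mdot V (W + W') = mdot V W + mdot V W' := by
  simp [mdot, mul_add, Finset.sum_add_distrib]

theorem mdot_smul_right (c : ℂ) (V W : Vec) : mdot V (c • W) = c * mdot V W := by
  simp only [mdot, Finset.mul_sum, Pi.smul_apply, smul_eq_mul]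
  exact Finset.sum_congr rfl fun _ _ => by ring

theorem mdot_zero_right (V : Vec) : mdot V 0 = 0 := by simp [mdot]

theorem mdot_sum_right {ι : Type*} (V : Vec) (s : Finset ι) (W : ι → Vec) :
    mdot V (∑ a ∈ s, W a) = ∑ a ∈ s, mdot V (W a) := by
  classical
  induction s using Finset.induction_on with
  | empty => simp [mdot_zero_right]
  | insert a s ha ih => rw [Finset.sum_insert ha, Finset.sum_insert ha, mdot_add_right, ih]

theorem mdot_add_left (V W W' : Vec) : mdot (W + W') V = mdot W V + mdot W' V := by
  rw [mdot_comm, mdot_add_right, mdot_comm V, mdot_comm V]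

theorem mdot_smul_left (c : ℂ) (V W : Vec) : mdot (c • V) W = c * mdot V W := by
  rw [mdot_comm, mdot_smul_right, mdot_comm]

theorem mdot_sum_left {ι : Type*} (V : Vec) (s : Finset ι) (W : ι → Vec) :
    mdot (∑ a ∈ s, W a) V = ∑ a ∈ s, mdot (W a) V := by
  simp only [mdot_comm _ V, mdot_sum_right]

/-- `2 V · p = ⟨p| V |p]` for a lightlike momentum `p`: contraction with the orthogonal spinor. -/
theorem mdot_momentum_left (a : Weyl) (V : Vec) : mdot (momentum a) V =
    (1 / 2) * (a 1 * bispinor V 0 0 * star (a 1) - a 1 * bispinor V 0 1 * star (a 0)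
      - a 0 * bispinor V 1 0 * star (a 1) + a 0 * bispinor V 1 1 * star (a 0)) := by
  rw [bispinor_eq]
  simp only [mdot, Fin.sum_univ_four, metric, momentum, bivec, Fin.sum_univ_two, sigBar, sig]
  simp
  ring

theorem mdot_momentum_momentum (a b : Weyl) :
    mdot (momentum a) (momentum b) = (1 / 2) * ((‖angle a b‖ ^ 2 : ℝ) : ℂ) := by
  rw [mdot_momentum_left]
  have h : ((‖angle a b‖ ^ 2 : ℝ) : ℂ) = angle a b * star (angle a b) := by
    rw [Complex.star_def, Complex.mul_conj, Complex.normSq_eq_norm_sq]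
  rw [h]
  simp only [bispinor_momentum, angle, star_sub, star_mul']
  ring

theorem angle_self (a : Weyl) : angle a a = 0 := by simp [angle, mul_comm]

theorem angle_swap (a b : Weyl) : angle a b = -angle b a := by simp [angle]; ring

theorem mdot_momentum_self (a : Weyl) : mdot (momentum a) (momentum a) = 0 := by
  simp [mdot_momentum_momentum, angle_self]

/-- The invariant mass is the sum over pairs of particles. -/
theorem mdot_totalMomentum (χ : Fin n → Weyl) (S : Finset (Fin n)) :
    mdot (totalMomentum χ S) (totalMomentum χ S) =
      (((1 / 2) * ∑ a ∈ S, ∑ b ∈ S, ‖angle (χ a) (χ b)‖ ^ 2 : ℝ) : ℂ) := by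
  unfold totalMomentum
  rw [mdot_sum_left]
  simp only [mdot_sum_right, mdot_momentum_momentum]
  push_cast
  simp only [Finset.mul_sum]

theorem uBar_vecMul_slash (c : Bool) (p : Weyl) : uBar c p ᵥ* slash (momentum p) = 0 := by
  ext j
  rw [slash_eq]
  cases c <;> rcases j with j | j <;> fin_cases j <;>
    simp [uBar, uSpinor, Matrix.vecMul, dotProduct, gam, sigBar, metric, sig,
      bispinor_momentum, adjugate_fin_two, Fin.sum_univ_two] <;> ring

theorem slash_mulVec_uSpinor (c : Bool) (p : Weyl) : slash (momentum p) *ᵥ uSpinor c p = 0 := by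
  ext j
  rw [slash_eq]
  cases c <;> rcases j with j | j <;> fin_cases j <;>
    simp [uSpinor, Matrix.mulVec, dotProduct,
      bispinor_momentum, adjugate_fin_two, Fin.sum_univ_two] <;> ring

/-! ### The equations of motion and gauge transformations -/

/-- Gauge covariance of a first-order linear equation, for a field that the gauge parameter acts on
from the right. -/
theorem FieldAlg.gauge_covariant_right {ι : Type*} [Fintype ι] {sp : Fin n → Species N}
    (k : ι → Fin n → ℂ) (B A : ι → FieldAlg sp) (c : ℂ) {L : FieldAlg sp} (hL : L.IsEven)
    (h0 : L ∅ = 0) (h : ∑ i, FieldAlg.der (k i) (B i) = c • ∑ i, B i * A i) :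
    ∑ i, FieldAlg.der (k i) (B i * IsNilpotent.exp (c • L)) =
      c • ∑ i, (B i * IsNilpotent.exp (c • L)) * (A i + FieldAlg.der (k i) L) := by
  have h0' : (c • L) ∅ = 0 := by rw [FieldAlg.smul_apply, h0, mul_zero]
  have hE : (IsNilpotent.exp (c • L)).IsEven := (hL.smul c).exp h0'
  simp only [FieldAlg.der_mul, FieldAlg.der_exp _ (hL.smul c) h0', FieldAlg.der_smul]
  rw [Finset.sum_add_distrib, ← Finset.sum_mul, h, smul_mul_assoc, Finset.sum_mul, Finset.smul_sum,
    Finset.smul_sum, ← Finset.sum_add_distrib]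
  refine Finset.sum_congr rfl fun i _ => ?_
  rw [mul_add, smul_add, mul_smul_comm, mul_smul_comm, mul_assoc, mul_assoc, mul_assoc,
    (hE.commute (A i)).eq]

/-- See `FieldAlg.gauge_covariant_right`. -/
theorem FieldAlg.gauge_covariant_left {ι : Type*} [Fintype ι] {sp : Fin n → Species N}
    (k : ι → Fin n → ℂ) (B A : ι → FieldAlg sp) (c : ℂ) {L : FieldAlg sp} (hL : L.IsEven)
    (h0 : L ∅ = 0) (h : ∑ i, FieldAlg.der (k i) (B i) = c • ∑ i, A i * B i) :
    ∑ i, FieldAlg.der (k i) (IsNilpotent.exp (c • L) * B i) =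
      c • ∑ i, (A i + FieldAlg.der (k i) L) * (IsNilpotent.exp (c • L) * B i) := by
  have h0' : (c • L) ∅ = 0 := by rw [FieldAlg.smul_apply, h0, mul_zero]
  have hE : (IsNilpotent.exp (c • L)).IsEven := (hL.smul c).exp h0'
  simp only [FieldAlg.der_mul, FieldAlg.der_exp _ (hL.smul c) h0', FieldAlg.der_smul]
  rw [Finset.sum_add_distrib, ← Finset.mul_sum, h, mul_smul_comm, Finset.mul_sum, Finset.smul_sum,
    Finset.smul_sum, ← Finset.sum_add_distrib]
  refine Finset.sum_congr rfl fun i _ => ?_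
  rw [add_mul, smul_add, mul_smul_comm, smul_mul_assoc, ← mul_assoc, ← mul_assoc, ← mul_assoc,
    (hE.commute (A i)).eq, (hE.commute (FieldAlg.der (k i) L)).eq, add_comm]

theorem powerset_singleton' (a : Fin n) : ({a} : Finset (Fin n)).powerset = {∅, {a}} := by
  ext T; simp [Finset.subset_singleton_iff]

section Tree

variable (g : ℝ) (sp : Fin n → Species N) (χ ρ : Fin n → Weyl)

theorem tree_empty : tree g sp χ ρ ∅ = ⟨0, 0, 0⟩ := by
  rw [tree]; simp

theorem tree_singleton (a : Fin n) :
    tree g sp χ ρ {a} = externalLeg (sp a) (χ a) (ρ a) := by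
  rw [tree]; simp

/-- Sums over proper splittings extend to all subsets when the extreme terms vanish. -/
theorem sum_splits {M : Type*} [AddCommMonoid M] (S : Finset (Fin n)) (f : Finset (Fin n) → M)
    (h0 : f ∅ = 0) (h1 : f S = 0) :
    ∑ T ∈ (S.ssubsets.filter Finset.Nonempty).attach, f T.1 = ∑ T ∈ S.powerset, f T := by
  rw [Finset.sum_attach _ f]
  refine Finset.sum_subset (fun T hT => ?_) fun T hT hT' => ?_
  · rw [Finset.mem_filter, Finset.mem_ssubsets] at hT
    exact Finset.mem_powerset.2 hT.1.subset
  · rw [Finset.mem_filter, Finset.mem_ssubsets, Finset.ssubset_iff_subset_ne] at hT'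
    by_cases hS : T = S
    · rw [hS, h1]
    · have : T = ∅ := by
        by_contra hne
        exact hT' ⟨⟨Finset.mem_powerset.1 hT, hS⟩, Finset.nonempty_iff_ne_empty.2 hne⟩
      rw [this, h0]

theorem tree_bar {S : Finset (Fin n)} (hS : 2 ≤ S.card) (f : Fin N) :
    (tree g sp χ ρ S).bar f = (-(g : ℂ) / mdot (totalMomentum χ S) (totalMomentum χ S)) •
      ∑ T ∈ S.powerset, fermiSign sp T (S \ T) • (((tree g sp χ ρ T).bar f ᵥ*
        slash (tree g sp χ ρ (S \ T)).pho) ᵥ* slash (totalMomentum χ S)) := by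
  rw [tree, if_neg (by omega)]
  dsimp only
  rw [sum_splits S (fun T => fermiSign sp T (S \ T) • (((tree g sp χ ρ T).bar f ᵥ*
        slash (tree g sp χ ρ (S \ T)).pho) ᵥ* slash (totalMomentum χ S)))]
  · simp [tree_empty]
  · simp [tree_empty, slash_zero]

theorem tree_psi {S : Finset (Fin n)} (hS : 2 ≤ S.card) (f : Fin N) :
    (tree g sp χ ρ S).psi f = ((g : ℂ) / mdot (totalMomentum χ S) (totalMomentum χ S)) •
      ∑ T ∈ S.powerset, fermiSign sp T (S \ T) • (slash (totalMomentum χ S) *ᵥ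
        (slash (tree g sp χ ρ T).pho *ᵥ (tree g sp χ ρ (S \ T)).psi f)) := by
  rw [tree, if_neg (by omega)]
  dsimp only
  rw [sum_splits S (fun T => fermiSign sp T (S \ T) • (slash (totalMomentum χ S) *ᵥ
        (slash (tree g sp χ ρ T).pho *ᵥ (tree g sp χ ρ (S \ T)).psi f)))]
  · simp [tree_empty, slash_zero]
  · simp [tree_empty]

theorem tree_pho {S : Finset (Fin n)} (hS : 2 ≤ S.card) (μ : Fin 4) :
    (tree g sp χ ρ S).pho μ = ((g : ℂ) / mdot (totalMomentum χ S) (totalMomentum χ S)) *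
      ∑ T ∈ S.powerset, fermiSign sp T (S \ T) *
        ∑ f, ((tree g sp χ ρ T).bar f ᵥ* gam μ) ⬝ᵥ (tree g sp χ ρ (S \ T)).psi f := by
  rw [tree, if_neg (by omega)]
  dsimp only
  rw [sum_splits S (fun T => fermiSign sp T (S \ T) *
        ∑ f, ((tree g sp χ ρ T).bar f ᵥ* gam μ) ⬝ᵥ (tree g sp χ ρ (S \ T)).psi f)]
  · simp [tree_empty]
  · simp [tree_empty]

/-- The elementary fields as elements of the algebra of matrix elements. -/
noncomputable def barEl (f : Fin N) (i : DIdx) : FieldAlg sp := fun S => (tree g sp χ ρ S).bar f i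

/-- See `barEl`. -/
noncomputable def psiEl (f : Fin N) (i : DIdx) : FieldAlg sp := fun S => (tree g sp χ ρ S).psi f i

/-- Fermion number conservation for all three fields. -/
theorem tree_flavor (S : Finset (Fin n)) :
    (∀ f i, (tree g sp χ ρ S).bar f i ≠ 0 →
      ∀ f', ∑ a ∈ S, (sp a).flavorNumber f' = if f' = f then 1 else 0) ∧
    (∀ f i, (tree g sp χ ρ S).psi f i ≠ 0 →
      ∀ f', ∑ a ∈ S, (sp a).flavorNumber f' = if f' = f then -1 else 0) ∧
    (∀ μ, (tree g sp χ ρ S).pho μ ≠ 0 → ∀ f', ∑ a ∈ S, (sp a).flavorNumber f' = 0) := by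
  induction S using Finset.strongInduction with
  | H S ih =>
  rcases Nat.lt_or_ge S.card 2 with h | h
  · interval_cases hc : S.card
    · rw [Finset.card_eq_zero] at hc
      subst hc
      simp [tree_empty]
    · obtain ⟨a, rfl⟩ := Finset.card_eq_one.1 hc
      rw [tree_singleton]
      cases hs : sp a with
      | photon => simp [externalLeg, Species.flavorNumber, hs]
      | fermion f c =>
        simp only [externalLeg, Pi.zero_apply, ne_eq, not_true_eq_false, false_imp_iff,
          implies_true, and_true, Finset.sum_singleton, hs, Species.flavorNumber]
        intro f' i hi f''
        split_ifs at hi with h1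
        · subst h1; simp only [eq_comm]
        · simp at hi
      | antifermion f c =>
        simp only [externalLeg, Pi.zero_apply, ne_eq, not_true_eq_false, false_imp_iff,
          implies_true, and_true, true_and, Finset.sum_singleton, hs, Species.flavorNumber]
        intro f' i hi f''
        split_ifs at hi with h1
        · subst h1; simp only [eq_comm]
        · simp at hi
  · have hsplit : ∀ T ∈ S.powerset, ∀ f',
        ∑ a ∈ S, (sp a).flavorNumber f' = ∑ a ∈ T, (sp a).flavorNumber f' +
          ∑ a ∈ S \ T, (sp a).flavorNumber f' := fun T hT f' => by
      rw [add_comm, Finset.sum_sdiff (Finset.mem_powerset.1 hT)]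
    -- the two branches of a splitting with nonvanishing contribution are proper subsets
    have hss : ∀ T ∈ S.powerset, T ≠ ∅ → S \ T ≠ ∅ → T ⊂ S ∧ S \ T ⊂ S := by
      intro T hT h1 h2
      rw [Finset.mem_powerset] at hT
      refine ⟨Finset.ssubset_iff_subset_ne.2 ⟨hT, fun h => h2 (by simp [h])⟩, ?_⟩
      exact Finset.sdiff_ssubset hT (Finset.nonempty_iff_ne_empty.2 h1)
    refine ⟨fun f i hi f' => ?_, fun f i hi f' => ?_, fun μ hμ f' => ?_⟩
    · rw [tree_bar g sp χ ρ h, Pi.smul_apply, smul_eq_mul] at hi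
      have hi := right_ne_zero_of_mul hi
      rw [Finset.sum_apply] at hi
      obtain ⟨T, hT, h1⟩ := Finset.exists_ne_zero_of_sum_ne_zero hi
      have hb : (tree g sp χ ρ T).bar f ≠ 0 := fun h0 => h1 (by simp [h0])
      have hp : (tree g sp χ ρ (S \ T)).pho ≠ 0 := fun h0 => h1 (by simp [h0, slash_zero])
      obtain ⟨i', hb'⟩ := Function.ne_iff.1 hb
      obtain ⟨μ, hp'⟩ := Function.ne_iff.1 hp
      obtain ⟨s1, s2⟩ := hss T hT (fun h0 => hb (by rw [h0, tree_empty]; rfl))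
        (fun h0 => hp (by rw [h0, tree_empty]))
      rw [hsplit T hT, (ih T s1).1 f i' hb' f', (ih _ s2).2.2 μ hp' f', add_zero]
    · rw [tree_psi g sp χ ρ h, Pi.smul_apply, smul_eq_mul] at hi
      have hi := right_ne_zero_of_mul hi
      rw [Finset.sum_apply] at hi
      obtain ⟨T, hT, h1⟩ := Finset.exists_ne_zero_of_sum_ne_zero hi
      have hb : (tree g sp χ ρ (S \ T)).psi f ≠ 0 := fun h0 => h1 (by simp [h0])
      have hp : (tree g sp χ ρ T).pho ≠ 0 := fun h0 => h1 (by simp [h0, slash_zero])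
      obtain ⟨i', hb'⟩ := Function.ne_iff.1 hb
      obtain ⟨μ, hp'⟩ := Function.ne_iff.1 hp
      obtain ⟨s1, s2⟩ := hss T hT (fun h0 => hp (by rw [h0, tree_empty]))
        (fun h0 => hb (by rw [h0, tree_empty]; rfl))
      rw [hsplit T hT, (ih T s1).2.2 μ hp' f', (ih _ s2).2.1 f i' hb' f', zero_add]
    · rw [tree_pho g sp χ ρ h] at hμ
      obtain ⟨T, hT, h1⟩ := Finset.exists_ne_zero_of_sum_ne_zero (right_ne_zero_of_mul hμ)
      obtain ⟨f, _, h2⟩ := Finset.exists_ne_zero_of_sum_ne_zero (right_ne_zero_of_mul h1)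
      have hb : (tree g sp χ ρ T).bar f ≠ 0 := fun h0 => h2 (by simp [h0])
      have hp : (tree g sp χ ρ (S \ T)).psi f ≠ 0 := fun h0 => h2 (by simp [h0])
      obtain ⟨i, hb'⟩ := Function.ne_iff.1 hb
      obtain ⟨i', hp'⟩ := Function.ne_iff.1 hp
      obtain ⟨s1, s2⟩ := hss T hT (fun h0 => hb (by rw [h0, tree_empty]; rfl))
        (fun h0 => hp (by rw [h0, tree_empty]; rfl))
      rw [hsplit T hT, (ih T s1).1 f i hb' f', (ih _ s2).2.1 f i' hp' f']
      split_ifs <;> simp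

theorem barEl_hasFlavor (f : Fin N) (i : DIdx) :
    (barEl g sp χ ρ f i).HasFlavor (Pi.single f 1) := fun S hS f' => by
  rw [(tree_flavor g sp χ ρ S).1 f i hS f', Pi.single_apply]

theorem psiEl_hasFlavor (f : Fin N) (i : DIdx) :
    (psiEl g sp χ ρ f i).HasFlavor (Pi.single f (-1)) := fun S hS f' => by
  rw [(tree_flavor g sp χ ρ S).2.1 f i hS f', Pi.single_apply]

/-- All propagators are off shell. -/
def OffShell (χ : Fin n → Weyl) : Prop :=
  ∀ S : Finset (Fin n), 2 ≤ S.card → mdot (totalMomentum χ S) (totalMomentum χ S) ≠ 0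

theorem slash_totalMomentum_apply (S : Finset (Fin n)) (i j : DIdx) :
    slash (totalMomentum χ S) i j = ∑ a ∈ S, slash (momentum (χ a)) i j := by
  rw [totalMomentum, slash_sum, Matrix.sum_apply]

/-- The equation of motion of `ψbar`. It holds also for a single particle, where both sides vanish
by the massless Dirac equation. -/
theorem eom_bar_tree (hχ : OffShell χ) (S : Finset (Fin n)) (f : Fin N) :
    (tree g sp χ ρ S).bar f ᵥ* slash (totalMomentum χ S) = -(g : ℂ) •
      ∑ T ∈ S.powerset, fermiSign sp T (S \ T) •
        ((tree g sp χ ρ T).bar f ᵥ* slash (tree g sp χ ρ (S \ T)).pho) := by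
  rcases Nat.lt_or_ge S.card 2 with h | h
  · interval_cases hc : S.card
    · rw [Finset.card_eq_zero] at hc
      subst hc
      simp [tree_empty]
    · obtain ⟨a, rfl⟩ := Finset.card_eq_one.1 hc
      rw [powerset_singleton', Finset.sum_pair (Finset.singleton_ne_empty a).symm,
        Finset.sdiff_self]
      simp only [tree_empty, Pi.zero_apply, zero_vecMul, smul_zero, slash_zero, vecMul_zero,
        add_zero, tree_singleton, totalMomentum, Finset.sum_singleton]
      cases sp a with
      | photon => simp [externalLeg]
      | antifermion => simp [externalLeg]
      | fermion f' c =>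
        simp only [externalLeg]
        split_ifs
        · exact uBar_vecMul_slash c (χ a)
        · simp
  · have hK := hχ S h
    conv_lhs => rw [tree_bar g sp χ ρ h]
    simp only [smul_vecMul, Matrix.sum_vecMul]
    simp only [vecMul_vecMul _ (slash (totalMomentum χ S)) (slash (totalMomentum χ S)),
      slash_mul_slash_self, vecMul_smul, vecMul_one]
    simp only [smul_comm _ (mdot (totalMomentum χ S) (totalMomentum χ S)), ← Finset.smul_sum]
    rw [smul_smul, mul_div_cancel₀ _ hK]

theorem eom_psi_tree (hχ : OffShell χ) (S : Finset (Fin n)) (f : Fin N) :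
    slash (totalMomentum χ S) *ᵥ (tree g sp χ ρ S).psi f = (g : ℂ) •
      ∑ T ∈ S.powerset, fermiSign sp T (S \ T) •
        (slash (tree g sp χ ρ T).pho *ᵥ (tree g sp χ ρ (S \ T)).psi f) := by
  rcases Nat.lt_or_ge S.card 2 with h | h
  · interval_cases hc : S.card
    · rw [Finset.card_eq_zero] at hc
      subst hc
      simp [tree_empty]
    · obtain ⟨a, rfl⟩ := Finset.card_eq_one.1 hc
      rw [powerset_singleton', Finset.sum_pair (Finset.singleton_ne_empty a).symm,
        Finset.sdiff_self]
      simp only [tree_empty, Pi.zero_apply, zero_mulVec, smul_zero, slash_zero, mulVec_zero,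
        add_zero, tree_singleton, totalMomentum, Finset.sum_singleton]
      cases sp a with
      | photon => simp [externalLeg]
      | fermion => simp [externalLeg]
      | antifermion f' c =>
        simp only [externalLeg]
        split_ifs
        · exact slash_mulVec_uSpinor c (χ a)
        · simp
  · have hK := hχ S h
    conv_lhs => rw [tree_psi g sp χ ρ h]
    simp only [mulVec_smul, Matrix.mulVec_sum]
    simp only [mulVec_mulVec _ (slash (totalMomentum χ S)) (slash (totalMomentum χ S)),
      slash_mul_slash_self, smul_mulVec, one_mulVec]
    simp only [smul_comm _ (mdot (totalMomentum χ S) (totalMomentum χ S)), ← Finset.smul_sum]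
    rw [smul_smul, mul_div_cancel₀ _ hK]

variable (Λ : FieldAlg sp)

/-- The field `ψbar_f` after the gauge transformation `A_μ → A_μ + Λ K_μ`. The gauge parameter is
an arbitrary, not necessarily on-shell, field `Λ`, given by its matrix elements. -/
noncomputable def gaugeBar (f : Fin N) (i : DIdx) : FieldAlg sp :=
  barEl g sp χ ρ f i * IsNilpotent.exp (-(g : ℂ) • Λ)

/-- The field `ψ_f` after the gauge transformation `A_μ → A_μ + Λ K_μ`. -/
noncomputable def gaugePsi (f : Fin N) (i : DIdx) : FieldAlg sp :=
  IsNilpotent.exp ((g : ℂ) • Λ) * psiEl g sp χ ρ f i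

/-- The photon field after the gauge transformation `A_μ → A_μ + Λ K_μ`. -/
noncomputable def gaugePho (S : Finset (Fin n)) : Vec :=
  (tree g sp χ ρ S).pho + Λ S • totalMomentum χ S

variable {Λ}

theorem smul_apply_empty (h0 : Λ ∅ = 0) (c : ℂ) : (c • Λ) ∅ = 0 := by
  rw [FieldAlg.smul_apply, h0, mul_zero]

theorem gaugeBar_empty (f : Fin N) (i : DIdx) : gaugeBar g sp χ ρ Λ f i ∅ = 0 := by
  simp [gaugeBar, FieldAlg.mul_apply, barEl, tree_empty]

theorem gaugePsi_empty (f : Fin N) (i : DIdx) : gaugePsi g sp χ ρ Λ f i ∅ = 0 := by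
  simp [gaugePsi, FieldAlg.mul_apply, psiEl, tree_empty]

theorem gaugePho_empty : gaugePho g sp χ ρ Λ ∅ = 0 := by
  simp [gaugePho, tree_empty, totalMomentum]

theorem gaugeBar_singleton (h0 : Λ ∅ = 0) (f : Fin N) (a : Fin n) :
    (fun i => gaugeBar g sp χ ρ Λ f i {a}) = (externalLeg (sp a) (χ a) (ρ a)).bar f := by
  ext i
  rw [gaugeBar, FieldAlg.mul_apply, powerset_singleton',
    Finset.sum_pair (Finset.singleton_ne_empty a).symm]
  simp only [Finset.sdiff_self, FieldAlg.exp_apply_empty (smul_apply_empty sp h0 _)]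
  simp [barEl, tree_empty, tree_singleton]

theorem gaugePsi_singleton (h0 : Λ ∅ = 0) (f : Fin N) (a : Fin n) :
    (fun i => gaugePsi g sp χ ρ Λ f i {a}) = (externalLeg (sp a) (χ a) (ρ a)).psi f := by
  ext i
  rw [gaugePsi, FieldAlg.mul_apply, powerset_singleton',
    Finset.sum_pair (Finset.singleton_ne_empty a).symm]
  simp only [Finset.sdiff_self, FieldAlg.exp_apply_empty (smul_apply_empty sp h0 _)]
  simp [psiEl, tree_empty, tree_singleton]

theorem slash_gaugePho_apply (S : Finset (Fin n)) (i j : DIdx) :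
    slash (gaugePho g sp χ ρ Λ S) i j = slash (tree g sp χ ρ S).pho i j +
      FieldAlg.der (fun a => slash (momentum (χ a)) i j) Λ S := by
  rw [gaugePho, slash_add, slash_smul, Matrix.add_apply, Matrix.smul_apply, smul_eq_mul,
    slash_totalMomentum_apply, FieldAlg.der_apply, mul_comm]

/-- The entries of `A̸` as elements of the algebra of matrix elements. -/
noncomputable def slashEl (i j : DIdx) : FieldAlg sp := fun S => slash (tree g sp χ ρ S).pho i j

/-- Gauge covariance: the gauge-transformed fields obey the Dirac equation. -/
theorem eom_gaugeBar (hχ : OffShell χ) (hΛ : Λ.IsEven) (h0 : Λ ∅ = 0) (S : Finset (Fin n))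
    (f : Fin N) :
    (fun i => gaugeBar g sp χ ρ Λ f i S) ᵥ* slash (totalMomentum χ S) = -(g : ℂ) •
      ∑ T ∈ S.powerset, fermiSign sp T (S \ T) •
        ((fun i => gaugeBar g sp χ ρ Λ f i T) ᵥ* slash (gaugePho g sp χ ρ Λ (S \ T))) := by
  ext j
  have h1 : ∑ i, FieldAlg.der (fun a => slash (momentum (χ a)) i j) (barEl g sp χ ρ f i) =
      -(g : ℂ) • ∑ i, barEl g sp χ ρ f i * slashEl g sp χ ρ i j := by
    ext U
    have h2 := congrFun (eom_bar_tree g sp χ ρ hχ U f) j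
    simp only [vecMul, dotProduct, Pi.smul_apply, Finset.sum_apply, smul_eq_mul,
      slash_totalMomentum_apply, Finset.mul_sum (s := Finset.univ)] at h2
    rw [Finset.sum_comm] at h2
    simp only [FieldAlg.sum_apply, FieldAlg.der_apply, FieldAlg.smul_apply, FieldAlg.mul_apply,
      mul_assoc, mul_comm (∑ a ∈ U, slash (momentum (χ a)) _ j)]
    exact h2
  have h4 := congrArg (fun F : FieldAlg sp => F S)
    (FieldAlg.gauge_covariant_right _ _ _ _ hΛ h0 h1)
  simp only [FieldAlg.sum_apply, FieldAlg.der_apply, FieldAlg.smul_apply,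
    FieldAlg.mul_apply (_ * _) (_ + _), FieldAlg.add_apply] at h4
  simp only [mul_assoc (fermiSign _ _ _), mul_comm (∑ a ∈ S, slash (momentum (χ a)) _ j)] at h4
  simp only [vecMul, dotProduct, Pi.smul_apply, Finset.sum_apply, smul_eq_mul,
    slash_gaugePho_apply, slash_totalMomentum_apply, Finset.mul_sum (s := Finset.univ)]
  rw [Finset.sum_comm]
  exact h4

theorem eom_gaugePsi (hχ : OffShell χ) (hΛ : Λ.IsEven) (h0 : Λ ∅ = 0) (S : Finset (Fin n))
    (f : Fin N) :
    slash (totalMomentum χ S) *ᵥ (fun i => gaugePsi g sp χ ρ Λ f i S) = (g : ℂ) •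
      ∑ T ∈ S.powerset, fermiSign sp T (S \ T) •
        (slash (gaugePho g sp χ ρ Λ T) *ᵥ (fun i => gaugePsi g sp χ ρ Λ f i (S \ T))) := by
  ext j
  have h1 : ∑ i, FieldAlg.der (fun a => slash (momentum (χ a)) j i) (psiEl g sp χ ρ f i) =
      (g : ℂ) • ∑ i, slashEl g sp χ ρ j i * psiEl g sp χ ρ f i := by
    ext U
    have h2 := congrFun (eom_psi_tree g sp χ ρ hχ U f) j
    simp only [mulVec, dotProduct, Pi.smul_apply, Finset.sum_apply, smul_eq_mul,
      slash_totalMomentum_apply, Finset.mul_sum (s := Finset.univ)] at h2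
    rw [Finset.sum_comm] at h2
    simp only [FieldAlg.sum_apply, FieldAlg.der_apply, FieldAlg.smul_apply, FieldAlg.mul_apply,
      mul_assoc]
    exact h2
  have h4 := congrArg (fun F : FieldAlg sp => F S)
    (FieldAlg.gauge_covariant_left _ _ _ _ hΛ h0 h1)
  simp only [FieldAlg.sum_apply, FieldAlg.der_apply, FieldAlg.smul_apply,
    FieldAlg.mul_apply (_ + _) (_ * _), FieldAlg.add_apply, mul_assoc] at h4
  simp only [mulVec, dotProduct, Pi.smul_apply, Finset.sum_apply, smul_eq_mul,
    slash_gaugePho_apply, slash_totalMomentum_apply, Finset.mul_sum (s := Finset.univ)]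
  rw [Finset.sum_comm]
  exact h4

/-- The tree recursion for `ψbar` in an arbitrary gauge. -/
theorem gaugeBar_recursion (hχ : OffShell χ) (hΛ : Λ.IsEven) (h0 : Λ ∅ = 0)
    {S : Finset (Fin n)} (hS : 2 ≤ S.card) (f : Fin N) :
    (fun i => gaugeBar g sp χ ρ Λ f i S) =
      (-(g : ℂ) / mdot (totalMomentum χ S) (totalMomentum χ S)) •
      ∑ T ∈ S.powerset, fermiSign sp T (S \ T) • (((fun i => gaugeBar g sp χ ρ Λ f i T) ᵥ*
        slash (gaugePho g sp χ ρ Λ (S \ T))) ᵥ* slash (totalMomentum χ S)) := by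
  have hK := hχ S hS
  have h1 := congrArg (· ᵥ* slash (totalMomentum χ S)) (eom_gaugeBar g sp χ ρ hχ hΛ h0 S f)
  simp only [vecMul_vecMul _ (slash (totalMomentum χ S)) (slash (totalMomentum χ S)),
    slash_mul_slash_self, vecMul_smul, vecMul_one, smul_vecMul, Matrix.sum_vecMul] at h1
  rw [← inv_smul_smul₀ hK (fun i => gaugeBar g sp χ ρ Λ f i S), h1, smul_smul, div_eq_inv_mul]

/-- The tree recursion for `ψ` in an arbitrary gauge. -/
theorem gaugePsi_recursion (hχ : OffShell χ) (hΛ : Λ.IsEven) (h0 : Λ ∅ = 0)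
    {S : Finset (Fin n)} (hS : 2 ≤ S.card) (f : Fin N) :
    (fun i => gaugePsi g sp χ ρ Λ f i S) =
      ((g : ℂ) / mdot (totalMomentum χ S) (totalMomentum χ S)) •
      ∑ T ∈ S.powerset, fermiSign sp T (S \ T) • (slash (totalMomentum χ S) *ᵥ
        (slash (gaugePho g sp χ ρ Λ T) *ᵥ (fun i => gaugePsi g sp χ ρ Λ f i (S \ T)))) := by
  have hK := hχ S hS
  have h1 := congrArg (slash (totalMomentum χ S) *ᵥ ·) (eom_gaugePsi g sp χ ρ hχ hΛ h0 S f)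
  simp only [mulVec_mulVec _ (slash (totalMomentum χ S)) (slash (totalMomentum χ S)),
    slash_mul_slash_self, smul_mulVec, one_mulVec, mulVec_smul, Matrix.mulVec_sum] at h1
  rw [← inv_smul_smul₀ hK (fun i => gaugePsi g sp χ ρ Λ f i S), h1, smul_smul, div_eq_inv_mul]

/-- The current, hence the photon field of at least two particles in Feynman gauge, is gauge
invariant. -/
theorem tree_pho_eq_gauge (h0 : Λ ∅ = 0)
    {S : Finset (Fin n)} (hS : 2 ≤ S.card) (μ : Fin 4) :
    (tree g sp χ ρ S).pho μ = ((g : ℂ) / mdot (totalMomentum χ S) (totalMomentum χ S)) *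
      ∑ T ∈ S.powerset, fermiSign sp T (S \ T) *
        ∑ f, ((fun i => gaugeBar g sp χ ρ Λ f i T) ᵥ* gam μ) ⬝ᵥ
          (fun i => gaugePsi g sp χ ρ Λ f i (S \ T)) := by
  have hinv : ∀ f i j, gaugeBar g sp χ ρ Λ f i * gaugePsi g sp χ ρ Λ f j =
      barEl g sp χ ρ f i * psiEl g sp χ ρ f j := by
    intro f i j
    have hnil : IsNilpotent ((g : ℂ) • Λ : FieldAlg sp) :=
      FieldAlg.isNilpotent (smul_apply_empty sp h0 _)
    have h := IsNilpotent.exp_neg_mul_exp_self hnil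
    rw [gaugeBar, gaugePsi, mul_assoc, ← mul_assoc _ _ (psiEl g sp χ ρ f j), neg_smul, h, one_mul]
  have hsum : ∀ (B P : Fin N → DIdx → FieldAlg sp),
      ∑ T ∈ S.powerset, fermiSign sp T (S \ T) *
        ∑ f, ((fun i => B f i T) ᵥ* gam μ) ⬝ᵥ (fun i => P f i (S \ T)) =
      ∑ f, ∑ j, ∑ i, gam μ i j * (B f i * P f j) S := by
    intro B P
    simp only [FieldAlg.mul_apply, dotProduct, vecMul, Finset.mul_sum, Finset.sum_mul]
    rw [Finset.sum_comm]
    refine Finset.sum_congr rfl fun f _ => ?_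
    rw [Finset.sum_comm]
    refine Finset.sum_congr rfl fun j _ => ?_
    rw [Finset.sum_comm]
    refine Finset.sum_congr rfl fun i _ => Finset.sum_congr rfl fun T _ => ?_
    ring
  rw [tree_pho g sp χ ρ hS]
  congr 1
  rw [hsum]
  simp only [hinv]
  exact hsum (fun f i => barEl g sp χ ρ f i) (fun f i => psiEl g sp χ ρ f i)

end Tree

/-! ### Power counting in `λ` -/

/-- `F = O(λ^z)` as `λ → 0⁺`. -/
def OrderGE (F : ℝ → ℂ) (z : ℤ) : Prop := F =O[𝓝[>] 0] fun l : ℝ => l ^ z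

theorem eventually_pos : ∀ᶠ l : ℝ in 𝓝[>] 0, 0 < l := self_mem_nhdsWithin

theorem zpow_isBigO {y z : ℤ} (h : y ≤ z) :
    (fun l : ℝ => l ^ z) =O[𝓝[>] 0] fun l : ℝ => l ^ y := by
  refine IsBigO.of_bound 1 ?_
  filter_upwards [Ioo_mem_nhdsGT (zero_lt_one (α := ℝ))] with l hl
  rw [one_mul, Real.norm_of_nonneg (zpow_nonneg hl.1.le _),
    Real.norm_of_nonneg (zpow_nonneg hl.1.le _)]
  exact zpow_le_zpow_right_of_le_one₀ hl.1 hl.2.le h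

namespace OrderGE

variable {F G : ℝ → ℂ} {y z : ℤ}

theorem mono (h : OrderGE F z) (hyz : y ≤ z) : OrderGE F y := IsBigO.trans h (zpow_isBigO hyz)

theorem add (hF : OrderGE F z) (hG : OrderGE G z) : OrderGE (fun l => F l + G l) z :=
  IsBigO.add hF hG

theorem sub (hF : OrderGE F z) (hG : OrderGE G z) : OrderGE (fun l => F l - G l) z :=
  IsBigO.sub hF hG

theorem neg (hF : OrderGE F z) : OrderGE (fun l => -F l) z := IsBigO.neg_left hF

theorem mul (hF : OrderGE F y) (hG : OrderGE G z) : OrderGE (fun l => F l * G l) (y + z) := by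
  refine IsBigO.trans (IsBigO.mul hF hG) (EventuallyEq.isBigO ?_)
  filter_upwards [eventually_pos] with l hl
  rw [zpow_add₀ hl.ne']

theorem sum {ι : Type*} {s : Finset ι} {F : ι → ℝ → ℂ} (h : ∀ i ∈ s, OrderGE (F i) z) :
    OrderGE (fun l => ∑ i ∈ s, F i l) z := IsBigO.fun_sum h

theorem const (c : ℂ) : OrderGE (fun _ => c) 0 := by
  simpa [OrderGE] using isBigO_const_const c (one_ne_zero (α := ℝ)) (𝓝[>] (0 : ℝ))

theorem const_mul (c : ℂ) (hF : OrderGE F z) : OrderGE (fun l => c * F l) z :=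
  IsBigO.const_mul_left hF c

theorem mul_const (c : ℂ) (hF : OrderGE F z) : OrderGE (fun l => F l * c) z := by
  simpa only [mul_comm] using hF.const_mul c

theorem zero : OrderGE (fun _ => 0) z := isBigO_zero _ _

theorem star (hF : OrderGE F z) : OrderGE (fun l => star (F l)) z := by
  refine IsBigO.trans (IsBigO.of_norm_left (g := fun l : ℝ => l ^ z) ?_) (isBigO_refl _ _)
  simpa only [norm_star] using IsBigO.norm_left hF

theorem congr' (hF : OrderGE F z) (h : ∀ᶠ l in 𝓝[>] (0 : ℝ), G l = F l) : OrderGE G z :=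
  IsBigO.trans (EventuallyEq.isBigO h) hF

theorem ofReal_zpow (z : ℤ) : OrderGE (fun l => ((l ^ z : ℝ) : ℂ)) z :=
  IsBigO.of_bound 1 (Eventually.of_forall fun l => by rw [Complex.norm_real, one_mul])

theorem vecMul {ι κ : Type*} [Fintype ι] {v : ℝ → ι → ℂ} {W : ℝ → Matrix ι κ ℂ}
    (hv : ∀ i, OrderGE (fun l => v l i) y) (hW : ∀ i j, OrderGE (fun l => W l i j) z) (j : κ) :
    OrderGE (fun l => (v l ᵥ* W l) j) (y + z) :=
  OrderGE.sum fun i _ => (hv i).mul (hW i j)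

theorem mulVec {ι κ : Type*} [Fintype ι] {v : ℝ → ι → ℂ} {W : ℝ → Matrix κ ι ℂ}
    (hW : ∀ i j, OrderGE (fun l => W l i j) y) (hv : ∀ i, OrderGE (fun l => v l i) z) (j : κ) :
    OrderGE (fun l => (W l *ᵥ v l) j) (y + z) :=
  OrderGE.sum fun i _ => (hW j i).mul (hv i)

theorem adjugate {W : ℝ → Matrix (Fin 2) (Fin 2) ℂ} (hW : ∀ i j, OrderGE (fun l => W l i j) z)
    (i j : Fin 2) : OrderGE (fun l => (W l).adjugate i j) z := by
  simp only [adjugate_fin_two]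
  fin_cases i <;> fin_cases j
  · exact hW 1 1
  · exact (hW 0 1).neg
  · exact (hW 1 0).neg
  · exact hW 0 0

theorem conjTranspose {ι κ : Type*} {W : ℝ → Matrix ι κ ℂ}
    (hW : ∀ i j, OrderGE (fun l => W l i j) z) (i : κ) (j : ι) :
    OrderGE (fun l => (W l)ᴴ i j) z := (hW j i).star

theorem prod {ι : Type*} {s : Finset ι} {F : ι → ℝ → ℂ} {w : ι → ℤ}
    (h : ∀ i ∈ s, OrderGE (F i) (w i)) : OrderGE (fun l => ∏ i ∈ s, F i l) (∑ i ∈ s, w i) := by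
  classical
  induction s using Finset.induction_on with
  | empty => simpa using OrderGE.const 1
  | insert a s ha ih =>
    simp only [Finset.prod_insert ha, Finset.sum_insert ha]
    exact (h a (Finset.mem_insert_self a s)).mul
      (ih fun i hi => h i (Finset.mem_insert_of_mem hi))

end OrderGE

/-! ### Frames

A complex `2 × 2` matrix `M` acts on Weyl spinors, and on vectors by `V ↦ M V M†`. If its determinant
is positive, this is a Lorentz transformation combined with a dilatation. The tree recursion is
covariant, so that the power counting of a sector can be done in a frame in which all its momenta
are generic. -/

/-- The action of a frame on the spinor index of `ψbar`, from the right. -/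
noncomputable def frameR (M : Matrix (Fin 2) (Fin 2) ℂ) : Matrix DIdx DIdx ℂ :=
  fromBlocks (adjugate M) 0 0 Mᴴ

/-- The action of a frame on the spinor index of `ψ`, from the left. -/
noncomputable def frameL (M : Matrix (Fin 2) (Fin 2) ℂ) : Matrix DIdx DIdx ℂ :=
  fromBlocks M 0 0 (adjugate Mᴴ)

theorem frameR_mul_frameL {M : Matrix (Fin 2) (Fin 2) ℂ} {s : ℝ} (h : M.det = s) :
    frameR M * frameL M = (s : ℂ) • 1 := by
  rw [frameR, frameL, fromBlocks_multiply]
  simp only [zero_mul, mul_zero, add_zero, zero_add, mul_adjugate, adjugate_mul,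
    det_conjTranspose, h]
  ext (i | i) (j | j) <;> simp [Matrix.one_apply]

theorem adjugate_frame (M X : Matrix (Fin 2) (Fin 2) ℂ) :
    adjugate (M * X * Mᴴ) = adjugate Mᴴ * adjugate X * adjugate M := by
  rw [adjugate_mul_distrib, adjugate_mul_distrib, Matrix.mul_assoc]

theorem frame_slash (M : Matrix (Fin 2) (Fin 2) ℂ) (V : Vec) :
    frameL M * slash V * frameR M = fromBlocks 0 (M * bispinor V * Mᴴ)
      (adjugate (M * bispinor V * Mᴴ)) 0 := by
  rw [slash_eq, frameR, frameL, fromBlocks_multiply, fromBlocks_multiply, adjugate_frame]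
  simp

/-- The vector `b γ^μ p`. -/
noncomputable def current (b p : Dirac) : Vec := fun μ => (b ᵥ* gam μ) ⬝ᵥ p

/-- Fierz identity. -/
theorem bispinor_current (b p : Dirac) : bispinor (current b p) =
    !![2 * (p (.inl 0) * b (.inr 0) + p (.inr 1) * b (.inl 1)),
       2 * (p (.inl 0) * b (.inr 1) - p (.inr 0) * b (.inl 1));
       2 * (p (.inl 1) * b (.inr 0) - p (.inr 1) * b (.inl 0)),
       2 * (p (.inl 1) * b (.inr 1) + p (.inr 0) * b (.inl 0))] := by
  have hI := Complex.I_mul_I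
  rw [bispinor_eq]
  ext i j
  fin_cases i <;> fin_cases j <;>
    simp [current, gam, vecMul, dotProduct, sig, sigBar, metric, Fin.sum_univ_two] <;> ring_nf <;>
    simp only [Complex.I_sq] <;> ring

theorem frame_current (M : Matrix (Fin 2) (Fin 2) ℂ) (b p : Dirac) :
    M * bispinor (current b p) * Mᴴ = bispinor (current (b ᵥ* frameR M) (frameL M *ᵥ p)) := by
  rw [bispinor_current, bispinor_current]
  ext i j
  fin_cases i <;> fin_cases j <;>
    simp [frameR, frameL, vecMul, mulVec, dotProduct, adjugate_fin_two, Matrix.mul_apply,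
      Fin.sum_univ_two] <;> ring

theorem frame_bar {M : Matrix (Fin 2) (Fin 2) ℂ} {s : ℝ} (h : M.det = s) (hs : s ≠ 0)
    (b : Dirac) (A K : Vec) :
    ((b ᵥ* slash A) ᵥ* slash K) ᵥ* frameR M = ((s : ℂ)⁻¹ ^ 2) •
      (((b ᵥ* frameR M) ᵥ* (frameL M * slash A * frameR M)) ᵥ*
        (frameL M * slash K * frameR M)) := by
  have hs' : (s : ℂ) ≠ 0 := by exact_mod_cast hs
  have e : frameR M * (frameL M * slash A * frameR M) * (frameL M * slash K * frameR M) =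
      ((s : ℂ) ^ 2) • (slash A * slash K * frameR M) := by
    calc _ = (frameR M * frameL M) * slash A * (frameR M * frameL M) * slash K * frameR M := by
          simp only [Matrix.mul_assoc]
      _ = _ := by
          rw [frameR_mul_frameL h]
          simp only [Matrix.smul_mul, Matrix.mul_smul, Matrix.one_mul, Matrix.mul_one, smul_smul,
            sq]
  simp only [vecMul_vecMul]
  rw [e, vecMul_smul, smul_smul, ← mul_pow, inv_mul_cancel₀ hs', one_pow, one_smul]

theorem frame_psi {M : Matrix (Fin 2) (Fin 2) ℂ} {s : ℝ} (h : M.det = s) (hs : s ≠ 0)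
    (p : Dirac) (A K : Vec) :
    frameL M *ᵥ (slash K *ᵥ (slash A *ᵥ p)) = ((s : ℂ)⁻¹ ^ 2) •
      ((frameL M * slash K * frameR M) *ᵥ ((frameL M * slash A * frameR M) *ᵥ
        (frameL M *ᵥ p))) := by
  have hs' : (s : ℂ) ≠ 0 := by exact_mod_cast hs
  have e : (frameL M * slash K * frameR M) * (frameL M * slash A * frameR M) * frameL M =
      ((s : ℂ) ^ 2) • (frameL M * slash K * slash A) := by
    calc _ = frameL M * slash K * (frameR M * frameL M) * slash A * (frameR M * frameL M) := by
          simp only [Matrix.mul_assoc]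
      _ = _ := by
          rw [frameR_mul_frameL h]
          simp only [Matrix.smul_mul, Matrix.mul_smul, Matrix.mul_one, smul_smul,
            sq]
  simp only [mulVec_mulVec, ← Matrix.mul_assoc]
  rw [← Matrix.mul_assoc, ← Matrix.mul_assoc] at e
  rw [e, smul_mulVec, smul_smul, ← mul_pow, inv_mul_cancel₀ hs', one_pow, one_smul]

theorem frame_momentum (M : Matrix (Fin 2) (Fin 2) ℂ) (a : Weyl) :
    M * bispinor (momentum a) * Mᴴ = bispinor (momentum (M *ᵥ a)) := by
  ext i j
  rw [bispinor_momentum]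
  have h : bispinor (momentum a) = vecMulVec a (star a) := by
    ext i j; rw [bispinor_momentum]; rfl
  rw [h, mul_vecMulVec, vecMulVec_mul, vecMul_conjTranspose, star_star]
  rfl

theorem frame_totalMomentum (M : Matrix (Fin 2) (Fin 2) ℂ) (χ : Fin n → Weyl)
    (S : Finset (Fin n)) : M * bispinor (totalMomentum χ S) * Mᴴ =
      ∑ a ∈ S, bispinor (momentum (M *ᵥ χ a)) := by
  rw [totalMomentum, bispinor_sum, Matrix.mul_sum, Matrix.sum_mul]
  exact Finset.sum_congr rfl fun a _ => frame_momentum M (χ a)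

theorem OrderGE.slash_frame {M : ℝ → Matrix (Fin 2) (Fin 2) ℂ} {V : ℝ → Vec} {z : ℤ}
    (h : ∀ i j, OrderGE (fun l => (M l * bispinor (V l) * (M l)ᴴ) i j) z) (i j : DIdx) :
    OrderGE (fun l => (frameL (M l) * slash (V l) * frameR (M l)) i j) z := by
  simp only [frame_slash]
  rcases i with i | i <;> rcases j with j | j
  · simpa using OrderGE.zero
  · simpa using h i j
  · simpa using OrderGE.adjugate h i j
  · simpa using OrderGE.zero

theorem OrderGE.bispinor_current {b p : ℝ → Dirac} {y z : ℤ}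
    (hb : ∀ i, OrderGE (fun l => b l i) y) (hp : ∀ i, OrderGE (fun l => p l i) z) (i j : Fin 2) :
    OrderGE (fun l => bispinor (current (b l) (p l)) i j) (z + y) := by
  simp only [TreeQED.bispinor_current]
  fin_cases i <;> fin_cases j
  · exact (((hp _).mul (hb _)).add ((hp _).mul (hb _))).const_mul 2
  · exact (((hp _).mul (hb _)).sub ((hp _).mul (hb _))).const_mul 2
  · exact (((hp _).mul (hb _)).sub ((hp _).mul (hb _))).const_mul 2
  · exact (((hp _).mul (hb _)).add ((hp _).mul (hb _))).const_mul 2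

/-! ### Power counting for the tree recursion -/

section Counting

variable (g : ℝ) (sp : Fin n → Species N) (χ ρ : ℝ → Fin n → Weyl) (Λ : ℝ → FieldAlg sp)

/-- In the frame `M` and the gauge `Λ`, all fields with the set `S` of leaves are `O(λ^z)`. -/
structure FieldBound (M : ℝ → Matrix (Fin 2) (Fin 2) ℂ) (S : Finset (Fin n)) (z : ℤ) : Prop where
  bar : ∀ f i, OrderGE (fun l =>
    ((fun i => gaugeBar g sp (χ l) (ρ l) (Λ l) f i S) ᵥ* frameR (M l)) i) z
  psi : ∀ f i, OrderGE (fun l =>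
    (frameL (M l) *ᵥ (fun i => gaugePsi g sp (χ l) (ρ l) (Λ l) f i S)) i) z
  pho : ∀ i j, OrderGE (fun l =>
    (M l * bispinor (gaugePho g sp (χ l) (ρ l) (Λ l) S) * (M l)ᴴ) i j) z

/-- In the frame `M` the particles of `S` have spinors of order `λ^σ`, and `1 / K_S²` has the
generic size. -/
structure FrameScaling (M : ℝ → Matrix (Fin 2) (Fin 2) ℂ) (σ : ℤ) (S : Finset (Fin n)) :
    Prop where
  det : ∀ᶠ l : ℝ in 𝓝[>] 0, (M l).det = ((l ^ σ : ℝ) : ℂ)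
  mom : ∀ a ∈ S, ∀ i, OrderGE (fun l => (M l *ᵥ χ l a) i) σ
  prop : OrderGE (fun l => (mdot (totalMomentum (χ l) S) (totalMomentum (χ l) S))⁻¹) (-(2 * σ))

/-- Admissible families of gauge parameters on nondegenerate kinematics. -/
structure GaugeFamily : Prop where
  offShell : ∀ᶠ l in 𝓝[>] (0 : ℝ), OffShell (χ l)
  even : ∀ l, (Λ l).IsEven
  empty : ∀ l, Λ l ∅ = 0

variable {g sp χ ρ Λ}
variable {M : ℝ → Matrix (Fin 2) (Fin 2) ℂ} {σ : ℤ} {S : Finset (Fin n)}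

theorem OrderGE.bispinor_momentum {a : ℝ → Weyl} {z : ℤ} (h : ∀ i, OrderGE (fun l => a l i) z)
    (i j : Fin 2) : OrderGE (fun l => bispinor (momentum (a l)) i j) (2 * z) := by
  simp only [TreeQED.bispinor_momentum]
  rw [two_mul]
  exact (h i).mul (h j).star

theorem FrameScaling.totalMomentum (h : FrameScaling χ M σ S) (i j : Fin 2) :
    OrderGE (fun l => (M l * bispinor (totalMomentum (χ l) S) * (M l)ᴴ) i j) (2 * σ) := by
  simp only [frame_totalMomentum, Matrix.sum_apply]
  exact OrderGE.sum fun a ha => OrderGE.bispinor_momentum (h.mom a ha) i j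

theorem OrderGE.inv_scale (σ : ℤ) : OrderGE (fun l : ℝ => (((l ^ σ : ℝ) : ℂ)⁻¹) ^ 2) (-(2 * σ)) := by
  refine (OrderGE.ofReal_zpow (-(2 * σ))).congr' (Eventually.of_forall fun l => ?_)
  push_cast
  rw [_root_.zpow_neg, inv_pow, ← zpow_natCast, ← _root_.zpow_mul, mul_comm 2 σ]
  rfl

theorem ssubset_of_mem_powerset {S T : Finset (Fin n)} (hT : T ∈ S.powerset) (h1 : T ≠ ∅)
    (h2 : T ≠ S) : T ⊂ S ∧ T.Nonempty ∧ S \ T ⊂ S ∧ (S \ T).Nonempty := by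
  rw [Finset.mem_powerset] at hT
  have hne := Finset.nonempty_iff_ne_empty.2 h1
  exact ⟨Finset.ssubset_iff_subset_ne.2 ⟨hT, h2⟩, hne, Finset.sdiff_ssubset hT hne,
    Finset.sdiff_nonempty.2 fun h => h2 (Finset.Subset.antisymm hT h)⟩

variable {β : Finset (Fin n) → ℤ}

/-- The order of `ψbar` in one step of the recursion: the vertex gives the orders of the two
subtrees, the numerator `λ^(2σ)` and the propagator `λ^(-2σ)`. Each of the two identities `frameR M
* frameL M = λ^σ` inserted between the factors costs `λ^(-σ)`. -/
theorem bar_step (hΛ : GaugeFamily sp χ Λ) (hM : FrameScaling χ M σ S) (hS : 2 ≤ S.card)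
    (ih : ∀ T, T ⊂ S → T.Nonempty → FieldBound g sp χ ρ Λ M T (β T))
    (hβ : ∀ T, T ⊂ S → T.Nonempty → β S + 2 * σ ≤ β T + β (S \ T)) (f : Fin N) (i : DIdx) :
    OrderGE (fun l =>
      ((fun i => gaugeBar g sp (χ l) (ρ l) (Λ l) f i S) ᵥ* frameR (M l)) i) (β S) := by
  have hmain : OrderGE (fun l => -(g : ℂ) *
      ((mdot (totalMomentum (χ l) S) (totalMomentum (χ l) S))⁻¹ *
      ((((l ^ σ : ℝ) : ℂ)⁻¹) ^ 2 * ∑ T ∈ S.powerset, fermiSign sp T (S \ T) *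
        (((((fun i => gaugeBar g sp (χ l) (ρ l) (Λ l) f i T) ᵥ* frameR (M l)) ᵥ*
          (frameL (M l) * slash (gaugePho g sp (χ l) (ρ l) (Λ l) (S \ T)) * frameR (M l))) ᵥ*
        (frameL (M l) * slash (totalMomentum (χ l) S) * frameR (M l))) i)))) (β S) := by
    refine OrderGE.const_mul _ ?_
    refine OrderGE.mono (hM.prop.mul ((OrderGE.inv_scale σ).mul (z := β S + 4 * σ) ?_)) (by omega)
    refine OrderGE.sum fun T hT => OrderGE.const_mul _ ?_
    by_cases h1 : T = ∅
    · subst h1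
      refine OrderGE.zero.congr' (Eventually.of_forall fun l => ?_)
      have : (fun i => gaugeBar g sp (χ l) (ρ l) (Λ l) f i ∅) = 0 :=
        funext fun i => gaugeBar_empty g sp (χ l) (ρ l) f i
      simp [this]
    by_cases h2 : T = S
    · subst h2
      refine OrderGE.zero.congr' (Eventually.of_forall fun l => ?_)
      simp [gaugePho_empty, slash_zero]
    obtain ⟨s1, n1, s2, n2⟩ := ssubset_of_mem_powerset hT h1 h2
    refine OrderGE.mono (OrderGE.vecMul (OrderGE.vecMul ((ih T s1 n1).bar f)
      (OrderGE.slash_frame (ih _ s2 n2).pho)) (OrderGE.slash_frame hM.totalMomentum) i) ?_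
    have := hβ T s1 n1
    omega
  refine hmain.congr' ?_
  filter_upwards [hM.det, hΛ.offShell, eventually_pos] with l hdet hoff hl
  rw [gaugeBar_recursion g sp (χ l) (ρ l) hoff (hΛ.even l) (hΛ.empty l) hS f]
  simp only [smul_vecMul, Matrix.sum_vecMul, frame_bar hdet (zpow_pos hl σ).ne', Pi.smul_apply,
    Finset.sum_apply, smul_eq_mul, Finset.mul_sum]
  refine Finset.sum_congr rfl fun T _ => ?_
  ring

/-- The order of `ψ` in one step of the recursion, with the same counting as for `ψbar`. -/
theorem psi_step (hΛ : GaugeFamily sp χ Λ) (hM : FrameScaling χ M σ S) (hS : 2 ≤ S.card)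
    (ih : ∀ T, T ⊂ S → T.Nonempty → FieldBound g sp χ ρ Λ M T (β T))
    (hβ : ∀ T, T ⊂ S → T.Nonempty → β S + 2 * σ ≤ β T + β (S \ T)) (f : Fin N) (i : DIdx) :
    OrderGE (fun l =>
      (frameL (M l) *ᵥ (fun i => gaugePsi g sp (χ l) (ρ l) (Λ l) f i S)) i) (β S) := by
  have hmain : OrderGE (fun l => (g : ℂ) *
      ((mdot (totalMomentum (χ l) S) (totalMomentum (χ l) S))⁻¹ *
      ((((l ^ σ : ℝ) : ℂ)⁻¹) ^ 2 * ∑ T ∈ S.powerset, fermiSign sp T (S \ T) *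
        (((frameL (M l) * slash (totalMomentum (χ l) S) * frameR (M l)) *ᵥ
          ((frameL (M l) * slash (gaugePho g sp (χ l) (ρ l) (Λ l) T) * frameR (M l)) *ᵥ
          (frameL (M l) *ᵥ (fun i => gaugePsi g sp (χ l) (ρ l) (Λ l) f i (S \ T))))) i))))
      (β S) := by
    refine OrderGE.const_mul _ ?_
    refine OrderGE.mono (hM.prop.mul ((OrderGE.inv_scale σ).mul (z := β S + 4 * σ) ?_)) (by omega)
    refine OrderGE.sum fun T hT => OrderGE.const_mul _ ?_
    by_cases h1 : T = ∅
    · subst h1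
      refine OrderGE.zero.congr' (Eventually.of_forall fun l => ?_)
      simp [gaugePho_empty, slash_zero]
    by_cases h2 : T = S
    · subst h2
      refine OrderGE.zero.congr' (Eventually.of_forall fun l => ?_)
      have : (fun i => gaugePsi g sp (χ l) (ρ l) (Λ l) f i ∅) = 0 :=
        funext fun i => gaugePsi_empty g sp (χ l) (ρ l) f i
      simp [this]
    obtain ⟨s1, n1, s2, n2⟩ := ssubset_of_mem_powerset hT h1 h2
    refine OrderGE.mono (OrderGE.mulVec (OrderGE.slash_frame hM.totalMomentum)
      (OrderGE.mulVec (OrderGE.slash_frame (ih T s1 n1).pho) ((ih _ s2 n2).psi f)) i) ?_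
    have := hβ T s1 n1
    omega
  refine hmain.congr' ?_
  filter_upwards [hM.det, hΛ.offShell, eventually_pos] with l hdet hoff hl
  rw [gaugePsi_recursion g sp (χ l) (ρ l) hoff (hΛ.even l) (hΛ.empty l) hS f]
  simp only [mulVec_smul, Matrix.mulVec_sum, frame_psi hdet (zpow_pos hl σ).ne', Pi.smul_apply,
    Finset.sum_apply, smul_eq_mul, Finset.mul_sum]
  refine Finset.sum_congr rfl fun T _ => ?_
  ring

/-- The order of the photon field in one step of the recursion, before it is gauge transformed at
`S` itself: the current is covariant, and the propagator gives `λ^(-2σ)`. -/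
theorem pho_step (hΛ : GaugeFamily sp χ Λ) (hM : FrameScaling χ M σ S) (hS : 2 ≤ S.card)
    (ih : ∀ T, T ⊂ S → T.Nonempty → FieldBound g sp χ ρ Λ M T (β T))
    (hβ : ∀ T, T ⊂ S → T.Nonempty → β S + 2 * σ ≤ β T + β (S \ T)) (i j : Fin 2) :
    OrderGE (fun l => (M l * bispinor (tree g sp (χ l) (ρ l) S).pho * (M l)ᴴ) i j) (β S) := by
  have hmain : OrderGE (fun l => (g : ℂ) *
      ((mdot (totalMomentum (χ l) S) (totalMomentum (χ l) S))⁻¹ *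
      (∑ T ∈ S.powerset, fermiSign sp T (S \ T) * ∑ f,
        bispinor (current ((fun i => gaugeBar g sp (χ l) (ρ l) (Λ l) f i T) ᵥ* frameR (M l))
          (frameL (M l) *ᵥ (fun i => gaugePsi g sp (χ l) (ρ l) (Λ l) f i (S \ T)))) i j)))
      (β S) := by
    refine OrderGE.const_mul _ ?_
    refine OrderGE.mono (hM.prop.mul (z := β S + 2 * σ) ?_) (by omega)
    refine OrderGE.sum fun T hT => OrderGE.const_mul _ (OrderGE.sum fun f _ => ?_)
    by_cases h1 : T = ∅
    · subst h1
      refine OrderGE.zero.congr' (Eventually.of_forall fun l => ?_)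
      have : (fun i => gaugeBar g sp (χ l) (ρ l) (Λ l) f i ∅) = 0 :=
        funext fun i => gaugeBar_empty g sp (χ l) (ρ l) f i
      simp [this, current, bispinor]
    by_cases h2 : T = S
    · subst h2
      refine OrderGE.zero.congr' (Eventually.of_forall fun l => ?_)
      have : (fun i => gaugePsi g sp (χ l) (ρ l) (Λ l) f i ∅) = 0 :=
        funext fun i => gaugePsi_empty g sp (χ l) (ρ l) f i
      simp [this, current, bispinor]
    obtain ⟨s1, n1, s2, n2⟩ := ssubset_of_mem_powerset hT h1 h2
    refine OrderGE.mono (OrderGE.bispinor_current ((ih T s1 n1).bar f) ((ih _ s2 n2).psi f) i j) ?_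
    have := hβ T s1 n1
    omega
  refine hmain.congr' (Eventually.of_forall fun l => ?_)
  have hcur : (tree g sp (χ l) (ρ l) S).pho =
      ((g : ℂ) / mdot (totalMomentum (χ l) S) (totalMomentum (χ l) S)) •
      ∑ T ∈ S.powerset, fermiSign sp T (S \ T) •
        ∑ f, current (fun i => gaugeBar g sp (χ l) (ρ l) (Λ l) f i T)
          (fun i => gaugePsi g sp (χ l) (ρ l) (Λ l) f i (S \ T)) := by
    ext μ
    rw [tree_pho_eq_gauge g sp (χ l) (ρ l) (hΛ.empty l) hS μ]
    simp [Finset.sum_apply, current]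
  simp only [← frame_current]
  rw [hcur]
  simp only [bispinor_smul, bispinor_sum, Matrix.mul_smul, Matrix.smul_mul, Matrix.mul_sum,
    Matrix.sum_mul, Matrix.smul_apply, Matrix.sum_apply, smul_eq_mul]
  ring

/-- One step of the power counting, with the gauge parameter at `S` bounded separately. -/
theorem fieldBound_step (hΛ : GaugeFamily sp χ Λ) (hM : FrameScaling χ M σ S) (hS : 2 ≤ S.card)
    (ih : ∀ T, T ⊂ S → T.Nonempty → FieldBound g sp χ ρ Λ M T (β T))
    (hβ : ∀ T, T ⊂ S → T.Nonempty → β S + 2 * σ ≤ β T + β (S \ T))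
    (hS' : OrderGE (fun l => Λ l S) (β S - 2 * σ)) : FieldBound g sp χ ρ Λ M S (β S) := by
  refine ⟨bar_step hΛ hM hS ih hβ, psi_step hΛ hM hS ih hβ, fun i j => ?_⟩
  have h1 := pho_step hΛ hM hS ih hβ i j
  have h2 := hS'.mul (hM.totalMomentum i j)
  rw [sub_add_cancel] at h2
  refine (h1.add h2).congr' (Eventually.of_forall fun l => ?_)
  rw [gaugePho, bispinor_add, bispinor_smul, Matrix.mul_add, Matrix.add_mul, Matrix.add_apply,
    Matrix.mul_smul, Matrix.smul_mul, Matrix.smul_apply, smul_eq_mul]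

end Counting

/-! ### Kinematics of jets and soft particles -/

theorem OrderGE.inv_of_norm_le {F G : ℝ → ℂ} {z : ℤ} (h : OrderGE (fun l => (F l)⁻¹) z)
    (h0 : ∀ᶠ l in 𝓝[>] (0 : ℝ), F l ≠ 0) (hle : ∀ᶠ l in 𝓝[>] (0 : ℝ), ‖F l‖ ≤ ‖G l‖) :
    OrderGE (fun l => (G l)⁻¹) z := by
  refine IsBigO.trans (IsBigO.of_bound 1 ?_) h
  filter_upwards [h0, hle] with l h1 h2
  rw [one_mul, norm_inv, norm_inv]
  exact inv_anti₀ (norm_pos_iff.2 h1) h2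

theorem OrderGE.of_norm_le {F G : ℝ → ℂ} {z : ℤ} (h : OrderGE F z)
    (hle : ∀ᶠ l in 𝓝[>] (0 : ℝ), ‖G l‖ ≤ ‖F l‖) : OrderGE G z := by
  refine IsBigO.trans (IsBigO.of_bound 1 ?_) h
  filter_upwards [hle] with l h2
  rwa [one_mul]

theorem OrderGE.of_sq {F : ℝ → ℂ} {z : ℤ} (h : OrderGE (fun l => F l ^ 2) (2 * z)) :
    OrderGE F z := by
  refine IsBigO.of_pow (n := 2) two_ne_zero ?_
  refine IsBigO.trans h (EventuallyEq.isBigO (Eventually.of_forall fun l => ?_))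
  change l ^ (2 * z) = (l ^ z) ^ 2
  rw [mul_comm, _root_.zpow_mul]
  rfl

/-- `|F|` is of the exact order `λ^z`. -/
structure ExactOrder (F : ℝ → ℂ) (z : ℤ) : Prop where
  le : OrderGE F z
  inv : OrderGE (fun l => (F l)⁻¹) (-z)
  ne : ∀ᶠ l in 𝓝[>] (0 : ℝ), F l ≠ 0

theorem ExactOrder.of_isTheta {F : ℝ → ℂ} {z : ℤ}
    (h : F =Θ[𝓝[>] 0] fun l : ℝ => l ^ z) : ExactOrder F z := by
  have h0 : ∀ᶠ l : ℝ in 𝓝[>] 0, l ^ z = 0 → F l = 0 := by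
    filter_upwards [eventually_pos] with l hl h
    exact absurd h (zpow_pos hl z).ne'
  refine ⟨h.1, ?_, ?_⟩
  · refine IsBigO.trans (h.2.inv_rev h0) (EventuallyEq.isBigO (Eventually.of_forall fun l => ?_))
    simp only [_root_.zpow_neg]
  · filter_upwards [h.2.eq_zero_imp, eventually_pos] with l h1 hl h2
    exact (zpow_pos hl z).ne' (h1 h2)

theorem ExactOrder.angle_of_isTheta {a b : ℝ → Weyl} {z : ℤ}
    (h : (fun l => mdot (momentum (a l)) (momentum (b l))) =Θ[𝓝[>] 0] fun l : ℝ => l ^ (2 * z)) :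
    ExactOrder (fun l => angle (a l) (b l)) z := by
  obtain ⟨h1, h2, h3⟩ := ExactOrder.of_isTheta h
  have hn : ∀ l, ‖mdot (momentum (a l)) (momentum (b l))‖ = 1 / 2 * ‖angle (a l) (b l)‖ ^ 2 := by
    intro l
    rw [mdot_momentum_momentum, norm_mul, Complex.norm_real, Real.norm_of_nonneg (sq_nonneg _)]
    norm_num
  refine ⟨OrderGE.of_sq ?_, OrderGE.of_sq ?_, ?_⟩
  · refine (h1.const_mul 2).of_norm_le (Eventually.of_forall fun l => ?_)
    rw [norm_mul, hn, norm_pow, Complex.norm_ofNat]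
    linarith
  · rw [mul_neg]
    refine (h2.const_mul 2).of_norm_le (Eventually.of_forall fun l => ?_)
    rw [norm_mul, norm_inv, hn, norm_pow, norm_inv, Complex.norm_ofNat, mul_inv, inv_pow]
    have := inv_nonneg.2 (sq_nonneg ‖angle (a l) (b l)‖)
    norm_num
    linarith
  · filter_upwards [h3] with l h4 h5
    rw [← norm_ne_zero_iff, hn, h5] at h4
    simp at h4

theorem momentum_zero (a : Weyl) :
    momentum a 0 = (((1 / 2) * (‖a 0‖ ^ 2 + ‖a 1‖ ^ 2) : ℝ) : ℂ) := by
  have h : ∀ z : ℂ, ((‖z‖ : ℂ)) ^ 2 = star z * z := fun z => by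
    rw [Complex.star_def, Complex.conj_mul']
  push_cast
  rw [h, h]
  simp [momentum, bivec, Fin.sum_univ_two, sigBar, sig, metric]

/-- A spinor is at most of the order of the square root of the energy. -/
theorem OrderGE.spinor_of_energy {a : ℝ → Weyl} {z : ℤ}
    (h : OrderGE (fun l => momentum (a l) 0) (2 * z)) (i : Fin 2) :
    OrderGE (fun l => a l i) z := by
  refine OrderGE.of_sq ((h.const_mul 2).of_norm_le (Eventually.of_forall fun l => ?_))
  rw [norm_mul, momentum_zero, Complex.norm_real, Real.norm_of_nonneg (by positivity), norm_pow,
    Complex.norm_ofNat]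
  fin_cases i
  · have := sq_nonneg ‖a l 1‖; simp only [Fin.zero_eta]; linarith
  · have := sq_nonneg ‖a l 0‖; simp only [Fin.mk_one]; linarith

/-- The mass of a set of particles is at least that of any pair. -/
theorem OrderGE.inv_mass {χ : ℝ → Fin n → Weyl} {S : Finset (Fin n)} {a b : Fin n} (ha : a ∈ S)
    (hb : b ∈ S) (hab : a ≠ b) {z : ℤ} (h : ExactOrder (fun l => angle (χ l a) (χ l b)) z) :
    OrderGE (fun l => (mdot (totalMomentum (χ l) S) (totalMomentum (χ l) S))⁻¹) (-(2 * z)) := by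
  have h2 : OrderGE (fun l => (angle (χ l a) (χ l b) ^ 2)⁻¹) (-(2 * z)) := by
    refine ((h.inv.mul h.inv).mono (by omega)).congr' (Eventually.of_forall fun l => ?_)
    rw [sq, mul_inv]
  refine h2.inv_of_norm_le (h.ne.mono fun l hl => pow_ne_zero 2 hl)
    (Eventually.of_forall fun l => ?_)
  rw [mdot_totalMomentum, Complex.norm_real, norm_pow]
  have hnn : ∀ x ∈ S, ∀ y ∈ S, 0 ≤ ‖angle (χ l x) (χ l y)‖ ^ 2 := fun _ _ _ _ => sq_nonneg _
  have h3 : ∀ x ∈ S, ∀ y ∈ S, ‖angle (χ l x) (χ l y)‖ ^ 2 ≤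
      ∑ y ∈ S, ‖angle (χ l x) (χ l y)‖ ^ 2 := fun x hx y hy =>
    Finset.single_le_sum (f := fun y => ‖angle (χ l x) (χ l y)‖ ^ 2) (hnn x hx) hy
  have h4 : ∑ y ∈ S, ‖angle (χ l a) (χ l y)‖ ^ 2 + ∑ y ∈ S, ‖angle (χ l b) (χ l y)‖ ^ 2 ≤
      ∑ x ∈ S, ∑ y ∈ S, ‖angle (χ l x) (χ l y)‖ ^ 2 := by
    rw [← Finset.sum_pair (f := fun x => ∑ y ∈ S, ‖angle (χ l x) (χ l y)‖ ^ 2) hab]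
    refine Finset.sum_le_sum_of_subset_of_nonneg ?_ fun x hx _ => Finset.sum_nonneg (hnn x hx)
    intro x hx
    rcases Finset.mem_insert.1 hx with rfl | hx
    · exact ha
    · rw [Finset.mem_singleton.1 hx]; exact hb
  have h5 := h3 a ha b hb
  have h6 := h3 b hb a ha
  rw [angle_swap, norm_neg] at h6
  refine le_trans ?_ (le_abs_self _)
  linarith

theorem OrderGE.bispinor {V : ℝ → Vec} {z : ℤ} (h : ∀ μ, OrderGE (fun l => V l μ) z)
    (i j : Fin 2) : OrderGE (fun l => bispinor (V l) i j) z := by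
  simp only [bispinor_eq]
  fin_cases i <;> fin_cases j
  · exact (h 0).sub (h 3)
  · exact (h 1).neg.add ((h 2).const_mul Complex.I)
  · exact (h 1).neg.sub ((h 2).const_mul Complex.I)
  · exact (h 0).add (h 3)

/-- The components of a vector in terms of its bispinor. -/
theorem vec_eq_of_bispinor (V : Vec) : V = ![(bispinor V 0 0 + bispinor V 1 1) / 2,
    -(bispinor V 0 1 + bispinor V 1 0) / 2,
    -Complex.I * (bispinor V 0 1 - bispinor V 1 0) / 2,
    (bispinor V 1 1 - bispinor V 0 0) / 2] := by
  have hI := Complex.I_sq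
  rw [bispinor_eq]
  ext μ
  fin_cases μ
  · simp
  · simp
  · simp; ring_nf; rw [hI]; ring
  · simp

theorem bispinor_injective : Function.Injective bispinor := fun V W h => by
  rw [vec_eq_of_bispinor V, vec_eq_of_bispinor W, h]

theorem OrderGE.of_bispinor {V : ℝ → Vec} {z : ℤ}
    (h : ∀ i j, OrderGE (fun l => TreeQED.bispinor (V l) i j) z) (μ : Fin 4) :
    OrderGE (fun l => V l μ) z := by
  have e : ∀ l, V l μ = _ := fun l => congrFun (vec_eq_of_bispinor (V l)) μ
  simp only [e]
  fin_cases μ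
  · exact (((h 0 0).add (h 1 1)).mul_const (2⁻¹))
  · exact (((h 0 1).add (h 1 0)).neg.mul_const (2⁻¹))
  · exact ((((h 0 1).sub (h 1 0)).const_mul (-Complex.I)).mul_const (2⁻¹))
  · exact (((h 1 1).sub (h 0 0)).mul_const (2⁻¹))

theorem OrderGE.mdot {V W : ℝ → Vec} {y z : ℤ} (hV : ∀ μ, OrderGE (fun l => V l μ) y)
    (hW : ∀ μ, OrderGE (fun l => W l μ) z) : OrderGE (fun l => mdot (V l) (W l)) (y + z) :=
  OrderGE.sum fun μ _ => ((hV μ).const_mul _).mul (hW μ)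

theorem OrderGE.angle {a b : ℝ → Weyl} {y z : ℤ} (ha : ∀ i, OrderGE (fun l => a l i) y)
    (hb : ∀ i, OrderGE (fun l => b l i) z) : OrderGE (fun l => angle (a l) (b l)) (y + z) :=
  ((ha 0).mul (hb 1)).sub ((ha 1).mul (hb 0))

theorem OrderGE.momentum {a : ℝ → Weyl} {z : ℤ} (ha : ∀ i, OrderGE (fun l => a l i) z)
    (μ : Fin 4) : OrderGE (fun l => momentum (a l) μ) (2 * z) :=
  OrderGE.of_bispinor (fun i j => OrderGE.bispinor_momentum ha i j) μ

/-- Changing the reference vector of a photon is a gauge transformation. -/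
theorem pol_eq_add_momentum (h : Bool) {q r r' : Weyl} (hr : angle r q ≠ 0)
    (hr' : angle r' q ≠ 0) : ∃ c : ℂ, pol h q r' = pol h q r + c • momentum q := by
  have hr1 : star (angle r q) ≠ 0 := star_ne_zero.2 hr
  have hr1' : star (angle r' q) ≠ 0 := star_ne_zero.2 hr'
  cases h with
  | true =>
    refine ⟨(Real.sqrt 2 : ℂ) * angle r r' / (angle r q * angle r' q), bispinor_injective ?_⟩
    ext i j
    simp only [pol, if_true, bispinor_add, bispinor_smul, Matrix.add_apply, Matrix.smul_apply,
      bispinor_bivec, bispinor_momentum, smul_eq_mul]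
    field_simp
    fin_cases i <;> simp only [angle] <;> simp <;> ring
  | false =>
    refine ⟨(Real.sqrt 2 : ℂ) * star (angle r r') / (star (angle r q) * star (angle r' q)),
      bispinor_injective ?_⟩
    ext i j
    simp only [pol, bispinor_add, bispinor_smul, Matrix.add_apply, Matrix.smul_apply,
      bispinor_bivec, bispinor_momentum, smul_eq_mul, square, Bool.false_eq_true, if_false]
    field_simp
    fin_cases j <;> simp only [angle] <;> simp <;> ring

theorem uBar_frame (M : Matrix (Fin 2) (Fin 2) ℂ) (c : Bool) (p : Weyl) :
    uBar c p ᵥ* frameR M = uBar c (M *ᵥ p) := by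
  ext i
  cases c <;> rcases i with i | i <;> fin_cases i <;>
    simp [uBar, uSpinor, frameR, vecMul, mulVec, dotProduct, gam, sig, sigBar, metric,
      adjugate_fin_two, Fin.sum_univ_two] <;> ring

theorem uSpinor_frame (M : Matrix (Fin 2) (Fin 2) ℂ) (c : Bool) (p : Weyl) :
    frameL M *ᵥ uSpinor c p = uSpinor c (M *ᵥ p) := by
  ext i
  cases c <;> rcases i with i | i <;> fin_cases i <;>
    simp [uSpinor, frameL, mulVec, dotProduct,
      adjugate_fin_two, Fin.sum_univ_two] <;> ring

theorem OrderGE.uSpinor {p : ℝ → Weyl} {z : ℤ} (c : Bool) (h : ∀ i, OrderGE (fun l => p l i) z)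
    (i : DIdx) : OrderGE (fun l => uSpinor c (p l) i) z := by
  cases c <;> rcases i with i | i
  · exact h i
  · exact OrderGE.zero
  · exact OrderGE.zero
  · fin_cases i
    · exact (h 1).star
    · exact (h 0).star.neg

theorem OrderGE.uBar {p : ℝ → Weyl} {z : ℤ} (c : Bool) (h : ∀ i, OrderGE (fun l => p l i) z)
    (i : DIdx) : OrderGE (fun l => uBar c (p l) i) z := by
  have := OrderGE.vecMul (v := fun l => Star.star (TreeQED.uSpinor c (p l))) (W := fun _ => gam 0)
    (fun i => (OrderGE.uSpinor c h i).star) (fun i j => OrderGE.const _) i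
  rwa [add_zero] at this

theorem frame_bivec (M : Matrix (Fin 2) (Fin 2) ℂ) (a b : Weyl) :
    M * TreeQED.bispinor (bivec a b) * Mᴴ = TreeQED.bispinor (bivec (M *ᵥ a) (M *ᵥ b)) := by
  ext i j
  rw [bispinor_bivec]
  have h : TreeQED.bispinor (bivec a b) = vecMulVec a (star b) := by
    ext i j; rw [bispinor_bivec]; rfl
  rw [h, mul_vecMulVec, vecMulVec_mul, vecMul_conjTranspose, star_star]
  rfl

/-- No cancellations occur in a sum of nonnegative terms. -/
theorem ExactOrder.inv_sum {ι : Type*} {f : ι → ℝ → ℝ} (hf : ∀ a l, 0 ≤ f a l) {S : Finset ι}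
    {a : ι} (ha : a ∈ S) {z : ℤ} (h : ExactOrder (fun l => (f a l : ℂ)) z) :
    OrderGE (fun l => (∑ b ∈ S, (f b l : ℂ))⁻¹) (-z) ∧
      ∀ᶠ l in 𝓝[>] (0 : ℝ), ∑ b ∈ S, (f b l : ℂ) ≠ 0 := by
  have hle : ∀ l, ‖(f a l : ℂ)‖ ≤ ‖∑ b ∈ S, (f b l : ℂ)‖ := by
    intro l
    rw [← Complex.ofReal_sum, Complex.norm_real, Complex.norm_real, Real.norm_of_nonneg (hf a l),
      Real.norm_of_nonneg (Finset.sum_nonneg fun b _ => hf b l)]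
    exact Finset.single_le_sum (f := fun b => f b l) (fun b _ => hf b l) ha
  refine ⟨h.inv.inv_of_norm_le h.ne (Eventually.of_forall hle), h.ne.mono fun l hl h0 => hl ?_⟩
  have := hle l
  rw [h0, norm_zero] at this
  exact norm_le_zero_iff.1 this

theorem ExactOrder.mdot_momentum {a b : ℝ → Weyl} {z : ℤ}
    (h : ExactOrder (fun l => angle (a l) (b l)) z) :
    ExactOrder (fun l => (((1 / 2) * ‖angle (a l) (b l)‖ ^ 2 : ℝ) : ℂ)) (2 * z) := by
  refine ⟨((h.le.mul h.le).mono (by omega)).of_norm_le (Eventually.of_forall fun l => ?_),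
    (((h.inv.mul h.inv).const_mul 2).mono (by omega)).of_norm_le (Eventually.of_forall fun l => ?_),
    h.ne.mono fun l hl => ?_⟩
  · rw [Complex.norm_real, Real.norm_of_nonneg (by positivity), norm_mul]
    nlinarith [sq_nonneg ‖angle (a l) (b l)‖]
  · rw [norm_inv, Complex.norm_real, Real.norm_of_nonneg (by positivity), norm_mul, norm_mul,
      norm_inv, Complex.norm_ofNat, mul_inv, sq, mul_inv]
    norm_num
  · have : ‖angle (a l) (b l)‖ ≠ 0 := norm_ne_zero_iff.2 hl
    exact_mod_cast (by positivity : (1 / 2) * ‖angle (a l) (b l)‖ ^ 2 ≠ 0)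

theorem mdot_momentum_totalMomentum (p : Weyl) (χ : Fin n → Weyl) (S : Finset (Fin n)) :
    mdot (momentum p) (totalMomentum χ S) =
      ∑ b ∈ S, (((1 / 2) * ‖angle p (χ b)‖ ^ 2 : ℝ) : ℂ) := by
  rw [totalMomentum, mdot_sum_right]
  refine Finset.sum_congr rfl fun b _ => ?_
  rw [mdot_momentum_momentum]
  push_cast
  rfl

/-- A lightlike direction has an invertible product with the momentum of a set of particles as soon
as it has one with a particle of the set. -/
theorem OrderGE.inv_mdot_totalMomentum {p : ℝ → Weyl} {χ : ℝ → Fin n → Weyl}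
    {S : Finset (Fin n)} {a : Fin n} (ha : a ∈ S) {z : ℤ}
    (h : ExactOrder (fun l => TreeQED.angle (p l) (χ l a)) z) :
    OrderGE (fun l => (TreeQED.mdot (TreeQED.momentum (p l)) (totalMomentum (χ l) S))⁻¹)
      (-(2 * z)) ∧ ∀ᶠ l in 𝓝[>] (0 : ℝ),
        TreeQED.mdot (TreeQED.momentum (p l)) (totalMomentum (χ l) S) ≠ 0 := by
  simp only [mdot_momentum_totalMomentum]
  exact ExactOrder.inv_sum (f := fun b l => (1 / 2) * ‖TreeQED.angle (p l) (χ l b)‖ ^ 2)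
    (fun b l => by positivity) ha h.mdot_momentum

theorem ExactOrder.angle_swap {a b : ℝ → Weyl} {z : ℤ}
    (h : ExactOrder (fun l => angle (a l) (b l)) z) :
    ExactOrder (fun l => angle (b l) (a l)) z := by
  simp only [TreeQED.angle_swap (b _) (a _)]
  refine ⟨h.le.neg, ?_, h.ne.mono fun l hl => neg_ne_zero.2 hl⟩
  simp only [inv_neg]
  exact h.inv.neg

section Scaling

variable {sector : Fin n → WithTop (Fin N)} {χ : ℝ → Fin n → Weyl} {τ : ℝ → Fin N → Weyl}

theorem JetScaling.angle_same (hs : JetScaling sector χ) {a b : Fin n} {j : Fin N} (hab : a ≠ b)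
    (ha : sector a = j) (hb : sector b = j) : ExactOrder (fun l => angle (χ l a) (χ l b)) 1 :=
  ExactOrder.angle_of_isTheta (by simpa using! hs.same_jet a b j hab ha hb)

theorem JetScaling.angle_diff (hs : JetScaling sector χ) {a b : Fin n} {i j : Fin N} (hij : i ≠ j)
    (ha : sector a = i) (hb : sector b = j) : ExactOrder (fun l => angle (χ l a) (χ l b)) 0 :=
  ExactOrder.angle_of_isTheta (by simpa using! hs.diff_jet a b i j hij ha hb)

theorem JetScaling.angle_soft_jet (hs : JetScaling sector χ) {a b : Fin n} {j : Fin N}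
    (ha : sector a = ⊤) (hb : sector b = j) : ExactOrder (fun l => angle (χ l a) (χ l b)) 1 :=
  ExactOrder.angle_of_isTheta (by simpa using! hs.soft_jet a b j ha hb)

theorem JetScaling.angle_soft_soft (hs : JetScaling sector χ) {a b : Fin n} (hab : a ≠ b)
    (ha : sector a = ⊤) (hb : sector b = ⊤) : ExactOrder (fun l => angle (χ l a) (χ l b)) 2 :=
  ExactOrder.angle_of_isTheta (by simpa using! hs.soft_soft a b hab ha hb)

theorem JetScaling.spinor_coll (hs : JetScaling sector χ) {a : Fin n} {j : Fin N}
    (ha : sector a = j) (i : Fin 2) : OrderGE (fun l => χ l a i) 0 :=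
  OrderGE.spinor_of_energy (by simpa [OrderGE] using (hs.energy_coll a j ha).1) i

theorem JetScaling.spinor_soft (hs : JetScaling sector χ) {a : Fin n}
    (ha : sector a = ⊤) (i : Fin 2) : OrderGE (fun l => χ l a i) 1 :=
  OrderGE.spinor_of_energy (by
    have := (hs.energy_soft a ha).1
    rw [OrderGE]
    exact_mod_cast this) i

theorem WilsonDirections.angle (ht : WilsonDirections sector χ τ) {a : Fin n} {j : Fin N}
    (ha : sector a = j) : ExactOrder (fun l => angle (τ l j) (χ l a)) 0 :=
  ExactOrder.angle_of_isTheta (by simpa using! ht.not_collinear a j ha)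

theorem WilsonDirections.spinor (ht : WilsonDirections sector χ τ) (j : Fin N) (i : Fin 2) :
    OrderGE (fun l => τ l j i) 0 :=
  OrderGE.spinor_of_energy (by simpa [OrderGE] using (ht.energy j).1) i

/-- Any two different particles have a product of momenta of definite order. -/
theorem JetScaling.exists_angle (hs : JetScaling sector χ) {a b : Fin n} (hab : a ≠ b) :
    ∃ z, ExactOrder (fun l => angle (χ l a) (χ l b)) z := by
  cases ha : sector a with
  | top =>
    cases hb : sector b with
    | top => exact ⟨2, hs.angle_soft_soft hab ha hb⟩
    | coe j => exact ⟨1, hs.angle_soft_jet ha hb⟩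
  | coe i =>
    cases hb : sector b with
    | top => exact ⟨1, (hs.angle_soft_jet hb ha).angle_swap⟩
    | coe j =>
      by_cases hij : i = j
      · subst hij; exact ⟨1, hs.angle_same hab ha hb⟩
      · exact ⟨0, hs.angle_diff hij ha hb⟩

/-- Spinor products of distinct particles do not vanish for small `λ`. Since `K_S²` is a sum of their
squared absolute values, no internal line is then on shell. -/
theorem JetScaling.offShell (hs : JetScaling sector χ) :
    ∀ᶠ l in 𝓝[>] (0 : ℝ), OffShell (χ l) := by
  have h : ∀ᶠ l in 𝓝[>] (0 : ℝ), ∀ a b, a ≠ b → angle (χ l a) (χ l b) ≠ 0 := by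
    rw [eventually_all]
    intro a
    rw [eventually_all]
    intro b
    by_cases hab : a = b
    · exact Eventually.of_forall fun l h => absurd hab h
    · obtain ⟨z, hz⟩ := hs.exists_angle hab
      exact hz.ne.mono fun l hl _ => hl
  filter_upwards [h] with l hl S hS h0
  obtain ⟨a, ha, b, hb, hab⟩ := Finset.one_lt_card.1 hS
  rw [mdot_totalMomentum, Complex.ofReal_eq_zero] at h0
  have h1 : ∑ a ∈ S, ∑ b ∈ S, ‖angle (χ l a) (χ l b)‖ ^ 2 = 0 := by linarith
  rw [Finset.sum_eq_zero_iff_of_nonneg fun a _ => Finset.sum_nonneg fun b _ => sq_nonneg _] at h1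
  have h2 := h1 a ha
  rw [Finset.sum_eq_zero_iff_of_nonneg fun b _ => sq_nonneg _] at h2
  have h3 := h2 b hb
  exact hl a b hab (by simpa using h3)

/-- The frame in which the soft sector is generic: the dilatation by `λ²`. -/
theorem JetScaling.frame_soft (hs : JetScaling sector χ) {S : Finset (Fin n)} (hS : 2 ≤ S.card)
    (hsoft : ∀ a ∈ S, sector a = ⊤) :
    FrameScaling χ (fun l => (l : ℂ) • 1) 2 S := by
  obtain ⟨a, ha, b, hb, hab⟩ := Finset.one_lt_card.1 hS
  refine ⟨Eventually.of_forall fun l => ?_, fun a ha i => ?_, OrderGE.inv_mass ha hb hab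
    (hs.angle_soft_soft hab (hsoft a ha) (hsoft b hb))⟩
  · simp
  · have h := (OrderGE.ofReal_zpow 1).mul (hs.spinor_soft (hsoft a ha) i)
    simpa [smul_mulVec] using h

/-- For particles from several jets no transformation is needed. -/
theorem JetScaling.frame_hard (hs : JetScaling sector χ) {S : Finset (Fin n)} {a b : Fin n}
    {i j : Fin N} (ha : a ∈ S) (hb : b ∈ S) (hij : i ≠ j) (hai : sector a = i)
    (hbj : sector b = j) : FrameScaling χ (fun _ => 1) 0 S := by
  refine ⟨Eventually.of_forall fun l => by simp, fun c hc k => ?_, OrderGE.inv_mass ha hb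
    (fun h => hij ?_) (hs.angle_diff hij hai hbj)⟩
  · simp only [one_mulVec]
    cases hsc : sector c with
    | top => exact (hs.spinor_soft hsc k).mono (by norm_num)
    | coe m => exact hs.spinor_coll hsc k
  · subst h
    exact WithTop.coe_injective (hai.symm.trans hbj)

end Scaling

/-- The Lorentz boost and dilatation that multiplies the spinor `η` by `l` and leaves `τ` fixed. -/
noncomputable def jetFrame (l : ℝ) (η τ : Weyl) : Matrix (Fin 2) (Fin 2) ℂ :=
  (angle τ η)⁻¹ • !![l * η 0 * -τ 1 + τ 0 * η 1, l * η 0 * τ 0 - τ 0 * η 0;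
    l * η 1 * -τ 1 + τ 1 * η 1, l * η 1 * τ 0 - τ 1 * η 0]

theorem jetFrame_mulVec (l : ℝ) (η τ v : Weyl) (i : Fin 2) : (jetFrame l η τ *ᵥ v) i =
    (angle τ η)⁻¹ * (l * η i * angle τ v + τ i * angle v η) := by
  fin_cases i <;>
    simp [jetFrame, mulVec, dotProduct, Fin.sum_univ_two, angle] <;> ring

theorem det_jetFrame {l : ℝ} {η τ : Weyl} (h : angle τ η ≠ 0) : (jetFrame l η τ).det = l := by
  have h' : τ 0 * η 1 - τ 1 * η 0 ≠ 0 := h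
  simp only [jetFrame, det_smul, det_fin_two_of, Fintype.card_fin, angle]
  field_simp
  ring

/-! ### Light-cone gauges adapted to the sectors -/

theorem OrderGE.of_mul_pow {F : ℝ → ℂ} {z : ℤ} (k : ℕ)
    (h : OrderGE (fun l => (l : ℂ) ^ k * F l) z) : OrderGE F (z - k) := by
  have h1 := (OrderGE.ofReal_zpow (-(k : ℤ))).mul h
  refine (h1.mono (by omega)).congr' ?_
  filter_upwards [eventually_pos] with l hl
  have : (l : ℂ) ≠ 0 := by exact_mod_cast hl.ne'
  push_cast
  rw [_root_.zpow_neg, zpow_natCast, inv_mul_cancel_left₀ (pow_ne_zero _ this)]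

/-- The gauge vector of each sector: `t_j` for the `j`-th jet, and `m` for the soft sector. -/
noncomputable def sectorDir (m : Vec) (τ : Fin N → Weyl) (s : WithTop (Fin N)) : Vec :=
  WithTop.recTopCoe m (fun j => momentum (τ j)) s

@[simp] theorem sectorDir_top (m : Vec) (τ : Fin N → Weyl) : sectorDir m τ ⊤ = m := rfl

@[simp] theorem sectorDir_coe (m : Vec) (τ : Fin N → Weyl) (j : Fin N) :
    sectorDir m τ j = momentum (τ j) := rfl

/-- The gauge parameter `Λ_S = - v·A_S / v·K_S` that imposes `v·A = 0` on the photon field whose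
leaves all lie in one sector, with the gauge vector `v` of the sector. Photon fields that connect
different sectors are not transformed. -/
noncomputable def gaugeParam (g : ℝ) (sp : Fin n → Species N) (χ ρ : Fin n → Weyl)
    (sector : Fin n → WithTop (Fin N)) (v : WithTop (Fin N) → Vec) : FieldAlg sp :=
  fun S => -∑ s, if S ⊆ sectorSet sector s then
    mdot (v s) (tree g sp χ ρ S).pho / mdot (v s) (totalMomentum χ S) else 0

theorem subset_sectorSet {sector : Fin n → WithTop (Fin N)} {s : WithTop (Fin N)}
    {S : Finset (Fin n)} : S ⊆ sectorSet sector s ↔ ∀ a ∈ S, sector a = s := by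
  simp [sectorSet, Finset.subset_iff]

section GaugeParam

variable (g : ℝ) (sp : Fin n → Species N) (χ ρ : Fin n → Weyl)
  (sector : Fin n → WithTop (Fin N)) (v : WithTop (Fin N) → Vec)

theorem gaugeParam_empty : gaugeParam g sp χ ρ sector v ∅ = 0 := by
  simp [gaugeParam, tree_empty, mdot_zero_right]

variable {sector} in
theorem gaugeParam_of_subset {S : Finset (Fin n)} (hS : S.Nonempty) {s : WithTop (Fin N)}
    (h : ∀ a ∈ S, sector a = s) : gaugeParam g sp χ ρ sector v S =
      -(mdot (v s) (tree g sp χ ρ S).pho / mdot (v s) (totalMomentum χ S)) := by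
  unfold gaugeParam
  rw [Finset.sum_eq_single s]
  · rw [if_pos (subset_sectorSet.2 h)]
  · intro s' _ hs'
    refine if_neg fun h' => hs' ?_
    obtain ⟨a, ha⟩ := hS
    rw [← subset_sectorSet.1 h' a ha, h a ha]
  · simp

variable {sector} in
/-- The gauge parameter has no matrix elements that connect two sectors. -/
theorem gaugeParam_of_ne {S : Finset (Fin n)} {a b : Fin n} (ha : a ∈ S) (hb : b ∈ S)
    (h : sector a ≠ sector b) : gaugeParam g sp χ ρ sector v S = 0 := by
  unfold gaugeParam
  rw [Finset.sum_eq_zero, neg_zero]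
  intro s _
  refine if_neg fun h' => h ?_
  rw [subset_sectorSet.1 h' a ha, subset_sectorSet.1 h' b hb]

theorem gaugeParam_hasFlavor : (gaugeParam g sp χ ρ sector v).HasFlavor 0 := by
  intro S hS
  have : (tree g sp χ ρ S).pho ≠ 0 := fun h0 => hS (by
    simp [gaugeParam, h0, mdot_zero_right])
  obtain ⟨μ, hμ⟩ := Function.ne_iff.1 this
  exact (tree_flavor g sp χ ρ S).2.2 μ hμ

variable {g sp χ ρ sector v}

theorem gaugePho_of_subset {S : Finset (Fin n)} (hS : S.Nonempty) {s : WithTop (Fin N)}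
    (h : ∀ a ∈ S, sector a = s) : gaugePho g sp χ ρ (gaugeParam g sp χ ρ sector v) S =
      (tree g sp χ ρ S).pho + (-(mdot (v s) (tree g sp χ ρ S).pho /
        mdot (v s) (totalMomentum χ S))) • totalMomentum χ S := by
  rw [gaugePho, gaugeParam_of_subset g sp χ ρ v hS h]

theorem mdot_gaugePho {S : Finset (Fin n)} (hS : S.Nonempty) {s : WithTop (Fin N)}
    (h : ∀ a ∈ S, sector a = s) (hK : mdot (v s) (totalMomentum χ S) ≠ 0) :
    mdot (v s) (gaugePho g sp χ ρ (gaugeParam g sp χ ρ sector v) S) = 0 := by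
  rw [gaugePho_of_subset hS h, mdot_add_right, mdot_smul_right]
  field_simp
  ring

/-- The photon wave function in the gauge `v·A = 0`, in terms of any other reference vector. -/
theorem gaugePho_singleton {a : Fin n} {h : Bool} (hsp : sp a = .photon h)
    (hρ : AdmissibleRef sp χ ρ) {r : Weyl} (hr : angle r (χ a) ≠ 0)
    (hK : mdot (v (sector a)) (momentum (χ a)) ≠ 0) :
    gaugePho g sp χ ρ (gaugeParam g sp χ ρ sector v) {a} = pol h (χ a) r +
      (-(mdot (v (sector a)) (pol h (χ a) r) / mdot (v (sector a)) (momentum (χ a)))) •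
        momentum (χ a) := by
  obtain ⟨c, hc⟩ := pol_eq_add_momentum h hr (hρ a (by rw [hsp]; rfl))
  rw [gaugePho_of_subset (Finset.singleton_nonempty a) (s := sector a) (by simp)]
  have e1 : (tree g sp χ ρ {a}).pho = pol h (χ a) (ρ a) := by
    rw [tree_singleton, hsp]; rfl
  have e2 : totalMomentum χ {a} = momentum (χ a) := by simp [totalMomentum]
  rw [e1, e2, hc, mdot_add_right, mdot_smul_right, add_div, mul_div_assoc, div_self hK]
  module

theorem gaugePho_singleton_of_charged {a : Fin n} (hsp : (sp a).charge ≠ 0) :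
    gaugePho g sp χ ρ (gaugeParam g sp χ ρ sector v) {a} = 0 := by
  have e1 : (tree g sp χ ρ {a}).pho = 0 := by
    rw [tree_singleton]
    cases h : sp a with
    | photon => rw [h] at hsp; exact absurd rfl hsp
    | fermion => rfl
    | antifermion => rfl
  rw [gaugePho_of_subset (Finset.singleton_nonempty a) (s := sector a) (by simp), e1]
  simp [mdot_zero_right]

end GaugeParam

theorem gaugeFamily_gaugeParam {g : ℝ} {sp : Fin n → Species N} {χ ρ : ℝ → Fin n → Weyl}
    {sector : Fin n → WithTop (Fin N)} (hs : JetScaling sector χ)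
    (v : ℝ → WithTop (Fin N) → Vec) :
    GaugeFamily sp χ (fun l => gaugeParam g sp (χ l) (ρ l) sector (v l)) :=
  ⟨hs.offShell, fun _ => (gaugeParam_hasFlavor _ _ _ _ _ _).isEven,
    fun _ => gaugeParam_empty _ _ _ _ _ _⟩

section Single

variable {g : ℝ} {sp : Fin n → Species N} {χ ρ : ℝ → Fin n → Weyl} {Λ : ℝ → FieldAlg sp}
  {M : ℝ → Matrix (Fin 2) (Fin 2) ℂ} {z : ℤ} {a : Fin n}

theorem bar_single (h0 : ∀ l, Λ l ∅ = 0) (h : ∀ i, OrderGE (fun l => (M l *ᵥ χ l a) i) z)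
    (f : Fin N) (i : DIdx) : OrderGE (fun l =>
      ((fun i => gaugeBar g sp (χ l) (ρ l) (Λ l) f i {a}) ᵥ* frameR (M l)) i) z := by
  simp only [gaugeBar_singleton g sp _ _ (h0 _)]
  cases sp a with
  | photon => simpa [externalLeg] using OrderGE.zero
  | antifermion => simpa [externalLeg] using OrderGE.zero
  | fermion f' c =>
    simp only [externalLeg]
    split_ifs
    · simp only [uBar_frame]
      exact OrderGE.uBar c h i
    · simpa using OrderGE.zero

theorem psi_single (h0 : ∀ l, Λ l ∅ = 0) (h : ∀ i, OrderGE (fun l => (M l *ᵥ χ l a) i) z)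
    (f : Fin N) (i : DIdx) : OrderGE (fun l =>
      (frameL (M l) *ᵥ (fun i => gaugePsi g sp (χ l) (ρ l) (Λ l) f i {a})) i) z := by
  simp only [gaugePsi_singleton g sp _ _ (h0 _)]
  cases sp a with
  | photon => simpa [externalLeg] using OrderGE.zero
  | fermion => simpa [externalLeg] using OrderGE.zero
  | antifermion f' c =>
    simp only [externalLeg]
    split_ifs
    · simp only [uSpinor_frame]
      exact OrderGE.uSpinor c h i
    · simpa using OrderGE.zero

end Single

/-! ### The soft sector -/

/-- A gauge vector for the soft sector: `m·k ∼ λ²` for soft momenta. -/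
structure SoftDirection (sector : Fin n → WithTop (Fin N)) (χ : ℝ → Fin n → Weyl)
    (m : ℝ → Vec) : Prop where
  le : ∀ μ, OrderGE (fun l => m l μ) 0
  inv : ∀ S : Finset (Fin n), S.Nonempty → (∀ a ∈ S, sector a = ⊤) →
    OrderGE (fun l => (mdot (m l) (totalMomentum (χ l) S))⁻¹) (-2)
  ne : ∀ S : Finset (Fin n), S.Nonempty → (∀ a ∈ S, sector a = ⊤) →
    ∀ᶠ l in 𝓝[>] (0 : ℝ), mdot (m l) (totalMomentum (χ l) S) ≠ 0

/-- The polarization vectors in Coulomb gauge: the reference spinor is orthogonal to `q`. -/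
def coulombRef (q : Weyl) : Weyl := ![-star (q 1), star (q 0)]

theorem angle_coulombRef (q : Weyl) :
    angle (coulombRef q) q = ((-(‖q 0‖ ^ 2 + ‖q 1‖ ^ 2) : ℝ) : ℂ) := by
  push_cast
  rw [← Complex.conj_mul', ← Complex.conj_mul']
  simp [angle, coulombRef]
  ring

theorem OrderGE.pol_coulombRef {q : ℝ → Weyl} (h : Bool) (μ : Fin 4) :
    OrderGE (fun l => pol h (q l) (coulombRef (q l)) μ) 0 := by
  refine OrderGE.of_bispinor (fun i j => ?_) μ
  refine (OrderGE.const (Real.sqrt 2 : ℂ)).of_norm_le (Eventually.of_forall fun l => ?_)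
  have key : ∀ i j : Fin 2, ‖coulombRef (q l) i‖ * ‖q l j‖ ≤ ‖q l 0‖ ^ 2 + ‖q l 1‖ ^ 2 := by
    intro i j
    have h0 := norm_nonneg (q l 0)
    have h1 := norm_nonneg (q l 1)
    fin_cases i <;> fin_cases j <;> simp [coulombRef] <;>
      nlinarith [sq_nonneg (‖q l 0‖ - ‖q l 1‖)]
  have hn : ‖TreeQED.angle (coulombRef (q l)) (q l)‖ = ‖q l 0‖ ^ 2 + ‖q l 1‖ ^ 2 := by
    rw [angle_coulombRef, Complex.norm_real, norm_neg, Real.norm_of_nonneg (by positivity)]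
  have hs2 : ‖(Real.sqrt 2 : ℂ)‖ = Real.sqrt 2 := by
    rw [Complex.norm_real, Real.norm_of_nonneg (Real.sqrt_nonneg 2)]
  have hfrac : ∀ x : ℝ, x ≤ ‖q l 0‖ ^ 2 + ‖q l 1‖ ^ 2 →
      Real.sqrt 2 / (‖q l 0‖ ^ 2 + ‖q l 1‖ ^ 2) * x ≤ Real.sqrt 2 := by
    intro x hx
    have h0 : 0 ≤ ‖q l 0‖ ^ 2 + ‖q l 1‖ ^ 2 := by positivity
    rw [div_mul_eq_mul_div, mul_div_assoc]
    exact mul_le_of_le_one_right (Real.sqrt_nonneg 2) (div_le_one_of_le₀ hx h0)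
  cases h
  · simp only [pol, Bool.false_eq_true, if_false, bispinor_smul, Matrix.smul_apply, smul_eq_mul,
      bispinor_bivec, norm_mul, norm_div, square, norm_star, hn, hs2]
    exact hfrac _ (by rw [mul_comm]; exact key j i)
  · simp only [pol, if_true, bispinor_smul, Matrix.smul_apply, smul_eq_mul,
      bispinor_bivec, norm_mul, norm_div, norm_star, hn, hs2]
    exact hfrac _ (key i j)

theorem frame_smul_one (l : ℝ) (X : Matrix (Fin 2) (Fin 2) ℂ) :
    ((l : ℂ) • (1 : Matrix (Fin 2) (Fin 2) ℂ)) * X * ((l : ℂ) • (1 : Matrix (Fin 2) (Fin 2) ℂ))ᴴ =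
      (l : ℂ) ^ 2 • X := by
  rw [conjTranspose_smul, conjTranspose_one, Complex.star_def, Complex.conj_ofReal,
    Matrix.smul_mul, Matrix.one_mul, Matrix.mul_smul, Matrix.mul_one, smul_smul, sq]

section Soft

variable {g : ℝ} {sp : Fin n → Species N} {χ ρ : ℝ → Fin n → Weyl} {m : ℝ → Vec}
  {τ : ℝ → Fin N → Weyl} {sector : Fin n → WithTop (Fin N)}

theorem pho_soft_single (hs : JetScaling sector χ) (hm : SoftDirection sector χ m)
    (hρ : ∀ᶠ l in 𝓝[>] (0 : ℝ), AdmissibleRef sp (χ l) (ρ l)) {a : Fin n}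
    (ha : sector a = ⊤) (μ : Fin 4) : OrderGE (fun l => gaugePho g sp (χ l) (ρ l)
      (gaugeParam g sp (χ l) (ρ l) sector (sectorDir (m l) (τ l))) {a} μ) 0 := by
  by_cases hc : (sp a).charge = 0
  swap
  · simp only [gaugePho_singleton_of_charged hc]
    exact OrderGE.zero
  obtain ⟨h, hsp⟩ : ∃ h, sp a = .photon h := by
    cases hsp : sp a <;> simp_all [Species.charge]
  have htot : ∀ l, totalMomentum (χ l) {a} = momentum (χ l a) := fun l => by simp [totalMomentum]
  have hinv := hm.inv {a} (Finset.singleton_nonempty a) (by simpa using ha)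
  have hne := hm.ne {a} (Finset.singleton_nonempty a) (by simpa using ha)
  simp only [htot] at hinv hne
  have hmain : OrderGE (fun l => pol h (χ l a) (coulombRef (χ l a)) μ +
      -(mdot (m l) (pol h (χ l a) (coulombRef (χ l a))) * (mdot (m l) (momentum (χ l a)))⁻¹) *
        momentum (χ l a) μ) 0 := by
    refine (OrderGE.pol_coulombRef h μ).add ?_
    refine OrderGE.mono ((((OrderGE.mdot hm.le (OrderGE.pol_coulombRef h)).mul hinv).neg.mul
      (OrderGE.momentum (hs.spinor_soft ha) μ))) (by norm_num)
  refine hmain.congr' ?_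
  filter_upwards [hρ, hne] with l h1 h2
  have hr : angle (coulombRef (χ l a)) (χ l a) ≠ 0 := by
    intro h0
    rw [angle_coulombRef, Complex.ofReal_eq_zero] at h0
    have e0 : χ l a = 0 := by
      have h3 := sq_nonneg ‖χ l a 0‖
      have h4 := sq_nonneg ‖χ l a 1‖
      ext i
      fin_cases i
      · have : ‖χ l a 0‖ ^ 2 = 0 := by linarith
        simpa using this
      · have : ‖χ l a 1‖ ^ 2 = 0 := by linarith
        simpa using this
    refine h2 ?_
    have : momentum (χ l a) = 0 := by rw [e0]; ext μ; simp [momentum, bivec]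
    rw [this, mdot_zero_right]
  rw [gaugePho_singleton hsp h1 hr (by rw [ha]; exact h2), ha]
  simp [div_eq_mul_inv]

/-- Power counting of the soft sector. In the dilated frame `M = λ` soft spinors are of order `λ²`
and `1 / K²` of order `λ⁻⁴`, so that each particle after the first counts `λ⁻²`. -/
theorem soft_fieldBound (hs : JetScaling sector χ) (hm : SoftDirection sector χ m)
    (hρ : ∀ᶠ l in 𝓝[>] (0 : ℝ), AdmissibleRef sp (χ l) (ρ l)) (S : Finset (Fin n))
    (hne : S.Nonempty) (hS : ∀ a ∈ S, sector a = ⊤) :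
    FieldBound g sp χ ρ (fun l => gaugeParam g sp (χ l) (ρ l) sector (sectorDir (m l) (τ l)))
      (fun l => (l : ℂ) • 1) S (4 - 2 * S.card) := by
  induction S using Finset.strongInduction with
  | H S ih =>
  have hΛ := gaugeFamily_gaugeParam (g := g) (sp := sp) (ρ := ρ) hs
    (fun l => sectorDir (m l) (τ l))
  rcases Nat.lt_or_ge S.card 2 with h | h
  · obtain ⟨a, rfl⟩ := Finset.card_eq_one.1 (by have := hne.card_pos; omega : S.card = 1)
    have ha := hS a (Finset.mem_singleton_self a)
    have hspin : ∀ i, OrderGE (fun l => (((l : ℂ) • (1 : Matrix (Fin 2) (Fin 2) ℂ)) *ᵥ χ l a) i)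
        2 := fun i => by
      have h := (OrderGE.ofReal_zpow 1).mul (hs.spinor_soft ha i)
      simpa [smul_mulVec] using h
    refine ⟨bar_single hΛ.empty hspin, psi_single hΛ.empty hspin, fun i j => ?_⟩
    simp only [frame_smul_one, Matrix.smul_apply, smul_eq_mul]
    have := (OrderGE.ofReal_zpow 2).mul
      (OrderGE.bispinor (pho_soft_single (g := g) (τ := τ) hs hm hρ ha) i j)
    refine (this.mono (by simp)).congr' (Eventually.of_forall fun l => ?_)
    push_cast
    rfl
  · have hM := hs.frame_soft h hS
    have ih' : ∀ T, T ⊂ S → T.Nonempty → FieldBound g sp χ ρ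
        (fun l => gaugeParam g sp (χ l) (ρ l) sector (sectorDir (m l) (τ l)))
        (fun l => (l : ℂ) • 1) T ((fun T : Finset (Fin n) => 4 - 2 * (T.card : ℤ)) T) :=
      fun T hT hTn => ih T hT hTn fun a ha => hS a (hT.subset ha)
    have hβ : ∀ T, T ⊂ S → T.Nonempty → (fun T : Finset (Fin n) => 4 - 2 * (T.card : ℤ)) S + 2 * 2 ≤
        (fun T : Finset (Fin n) => 4 - 2 * (T.card : ℤ)) T +
          (fun T : Finset (Fin n) => 4 - 2 * (T.card : ℤ)) (S \ T) := by
      intro T hT _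
      have := Finset.card_sdiff_add_card_eq_card hT.subset
      simp only
      omega
    refine fieldBound_step hΛ hM h ih' hβ ?_
    have hA : ∀ μ, OrderGE (fun l => (tree g sp (χ l) (ρ l) S).pho μ)
        (4 - 2 * (S.card : ℤ) - 2) := fun μ => by
      refine OrderGE.of_bispinor (fun i j => OrderGE.of_mul_pow 2 ?_) μ
      refine (pho_step hΛ hM h ih' hβ i j).congr' (Eventually.of_forall fun l => ?_)
      rw [frame_smul_one, Matrix.smul_apply, smul_eq_mul]
    have h1 := ((OrderGE.mdot hm.le hA).mul (hm.inv S hne hS)).neg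
    refine (h1.mono (by omega)).congr' (Eventually.of_forall fun l => ?_)
    rw [gaugeParam_of_subset g sp _ _ _ hne hS, sectorDir_top, div_eq_mul_inv]

end Soft

/-! ### The direction of a jet -/

/-- The energy direction `(1, 0, 0, 0)`. -/
def timeDir : Vec := Pi.single 0 1

theorem mdot_timeDir (V : Vec) : mdot timeDir V = V 0 := by
  simp [mdot, timeDir, Fin.sum_univ_four, metric]

theorem momentum_real (a : Weyl) (μ : Fin 4) : star (momentum a μ) = momentum a μ := by
  rw [vec_eq_of_bispinor (momentum a)]
  simp only [bispinor_momentum]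
  fin_cases μ <;> simp <;> ring

theorem totalMomentum_real (χ : Fin n → Weyl) (S : Finset (Fin n)) (μ : Fin 4) :
    star (totalMomentum χ S μ) = totalMomentum χ S μ := by
  simp only [totalMomentum, Finset.sum_apply, star_sum, momentum_real]

theorem totalMomentum_zero (χ : Fin n → Weyl) (S : Finset (Fin n)) :
    totalMomentum χ S 0 = ∑ a ∈ S, (((1 / 2) * (‖χ a 0‖ ^ 2 + ‖χ a 1‖ ^ 2) : ℝ) : ℂ) := by
  simp only [totalMomentum, Finset.sum_apply, momentum_zero]

/-- The length of the spatial part. -/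
noncomputable def spatialNorm (P : Vec) : ℝ := Real.sqrt (‖P 1‖ ^ 2 + ‖P 2‖ ^ 2 + ‖P 3‖ ^ 2)

theorem lightDirection_le (P : Vec) (μ : Fin 4) : ‖lightDirection P μ‖ ≤ 1 := by
  unfold lightDirection
  split_ifs with h
  · simp
  · rw [norm_div, Complex.norm_real, Real.norm_of_nonneg (Real.sqrt_nonneg _)]
    refine div_le_one_of_le₀ (Real.le_sqrt_of_sq_le ?_) (Real.sqrt_nonneg _)
    have h1 := sq_nonneg ‖P 1‖
    have h2 := sq_nonneg ‖P 2‖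
    have h3 := sq_nonneg ‖P 3‖
    fin_cases μ
    · simp at h
    · simp only [Fin.mk_one]; linarith
    · simp only [Fin.reduceFinMk]; linarith
    · simp only [Fin.reduceFinMk]; linarith

/-- A momentum is its direction times its length, up to the difference of energy and length. -/
theorem smul_lightDirection (P : Vec) : (spatialNorm P : ℂ) • lightDirection P =
    P + (-(P 0 - spatialNorm P)) • timeDir := by
  ext μ
  simp only [Pi.smul_apply, lightDirection, smul_eq_mul, Pi.add_apply, timeDir, Pi.single_apply]
  split_ifs with h
  · subst h; ring
  · simp only [mul_zero, add_zero]
    by_cases h0 : spatialNorm P = 0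
    · have hnn : ∀ ν : Fin 4, ν ≠ 0 → P ν = 0 := by
        intro ν hν
        have h1 : ‖P 1‖ ^ 2 + ‖P 2‖ ^ 2 + ‖P 3‖ ^ 2 = 0 := by
          rw [spatialNorm, Real.sqrt_eq_zero (by positivity)] at h0
          exact h0
        have h2 := sq_nonneg ‖P 1‖
        have h3 := sq_nonneg ‖P 2‖
        have h4 := sq_nonneg ‖P 3‖
        have : ‖P ν‖ ^ 2 = 0 := by
          fin_cases ν
          · simp at hν
          · simp only [Fin.mk_one]; linarith
          · simp only [Fin.reduceFinMk]; linarith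
          · simp only [Fin.reduceFinMk]; linarith
        simpa using this
      rw [h0, hnn μ h]
      simp
    · have : (spatialNorm P : ℂ) ≠ 0 := by exact_mod_cast h0
      exact mul_div_cancel₀ _ this

/-- Energy minus length, in terms of the mass. -/
theorem energy_sub_spatialNorm {P : Vec} (hP : ∀ μ, star (P μ) = P μ) :
    (P 0 - spatialNorm P) * (P 0 + spatialNorm P) = mdot P P := by
  have h : ∀ μ, ((‖P μ‖ : ℝ) : ℂ) ^ 2 = P μ ^ 2 := fun μ => by
    rw [← Complex.conj_mul', ← Complex.star_def, hP, sq]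
  have h2 : (spatialNorm P : ℂ) ^ 2 = P 1 ^ 2 + P 2 ^ 2 + P 3 ^ 2 := by
    rw [← h, ← h, ← h, ← Complex.ofReal_pow, spatialNorm, Real.sq_sqrt (by positivity)]
    push_cast
    rfl
  simp only [mdot, Fin.sum_univ_four, metric]
  simp
  linear_combination -h2

section JetDirection

variable {sector : Fin n → WithTop (Fin N)} {χ : ℝ → Fin n → Weyl} {τ : ℝ → Fin N → Weyl}

theorem SoftDirection.timeDir (hs : JetScaling sector χ) :
    SoftDirection sector χ (fun _ => timeDir) := by
  have hex : ∀ a, sector a = ⊤ → ExactOrder (fun l =>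
      (((1 / 2) * (‖χ l a 0‖ ^ 2 + ‖χ l a 1‖ ^ 2) : ℝ) : ℂ)) 2 := by
    intro a ha
    have := hs.energy_soft a ha
    simp only [momentum_zero] at this
    exact ExactOrder.of_isTheta (by exact_mod_cast this)
  have key : ∀ S : Finset (Fin n), S.Nonempty → (∀ a ∈ S, sector a = ⊤) → _ :=
    fun S ⟨a, ha⟩ hS => ExactOrder.inv_sum
      (f := fun a l => (1 / 2) * (‖χ l a 0‖ ^ 2 + ‖χ l a 1‖ ^ 2))
      (fun a l => by positivity) ha (hex a (hS a ha))
  refine ⟨fun μ => OrderGE.const _, fun S h1 h2 => ?_, fun S h1 h2 => ?_⟩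
  · simp only [mdot_timeDir, totalMomentum_zero]
    exact (key S h1 h2).1
  · simp only [mdot_timeDir, totalMomentum_zero]
    exact (key S h1 h2).2

/-- A jet is massless up to `O(λ²)`. -/
theorem JetScaling.jet_mass (hs : JetScaling sector χ) {S : Finset (Fin n)} {i : Fin N}
    (hS : ∀ a ∈ S, sector a = i) :
    OrderGE (fun l => mdot (totalMomentum (χ l) S) (totalMomentum (χ l) S)) 2 := by
  simp only [totalMomentum, mdot_sum_left, mdot_sum_right]
  refine OrderGE.sum fun a ha => OrderGE.sum fun b hb => ?_
  by_cases hab : a = b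
  · subst hab
    simp only [mdot_momentum_self]
    exact OrderGE.zero
  · have := (hs.same_jet b a i (Ne.symm hab) (hS b hb) (hS a ha)).1
    rw [OrderGE]
    exact_mod_cast this

/-- The total momentum of a jet is nearly lightlike: `E - |P| = K² / (E + |P|)`, and `K²` is of
order `λ²`. -/
theorem JetScaling.jet_energy_defect (hs : JetScaling sector χ) {S : Finset (Fin n)} {i : Fin N}
    (hS : ∀ a ∈ S, sector a = i) (hne : S.Nonempty) :
    OrderGE (fun l => totalMomentum (χ l) S 0 - spatialNorm (totalMomentum (χ l) S)) 2 := by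
  obtain ⟨a, ha⟩ := hne
  have hex : ExactOrder (fun l => (((1 / 2) * (‖χ l a 0‖ ^ 2 + ‖χ l a 1‖ ^ 2) : ℝ) : ℂ)) 0 := by
    have := hs.energy_coll a i (hS a ha)
    simp only [momentum_zero] at this
    exact ExactOrder.of_isTheta (by simpa using this)
  obtain ⟨h1, h2⟩ := ExactOrder.inv_sum
      (f := fun a l => (1 / 2) * (‖χ l a 0‖ ^ 2 + ‖χ l a 1‖ ^ 2))
      (fun a l => by positivity) ha hex
  simp only [← totalMomentum_zero] at h1 h2
  have hle : ∀ l, ‖totalMomentum (χ l) S 0‖ ≤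
      ‖totalMomentum (χ l) S 0 + spatialNorm (totalMomentum (χ l) S)‖ := by
    intro l
    rw [totalMomentum_zero, ← Complex.ofReal_sum, ← Complex.ofReal_add, Complex.norm_real,
      Complex.norm_real]
    have h3 : 0 ≤ ∑ a ∈ S, (1 / 2) * (‖χ l a 0‖ ^ 2 + ‖χ l a 1‖ ^ 2) :=
      Finset.sum_nonneg fun a _ => by positivity
    have h4 : 0 ≤ spatialNorm (totalMomentum (χ l) S) := Real.sqrt_nonneg _
    rw [Real.norm_of_nonneg h3, Real.norm_of_nonneg (add_nonneg h3 h4)]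
    linarith
  have h5 := h1.inv_of_norm_le h2 (Eventually.of_forall hle)
  refine ((hs.jet_mass hS).mul h5).congr' ?_
  filter_upwards [h2] with l h6
  rw [← energy_sub_spatialNorm (totalMomentum_real (χ l) S), mul_assoc, mul_inv_cancel₀, mul_one]
  intro h0
  have := hle l
  rw [h0, norm_zero] at this
  exact h6 (norm_le_zero_iff.1 this)

theorem mem_sectorSet {s : WithTop (Fin N)} {a : Fin n} :
    a ∈ sectorSet sector s ↔ sector a = s := by simp [sectorSet]

theorem JetScaling.jet_momentum (hs : JetScaling sector χ) (i : Fin N) (μ : Fin 4) :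
    OrderGE (fun l => totalMomentum (χ l) (sectorSet sector i) μ) 0 := by
  simp only [totalMomentum, Finset.sum_apply]
  exact OrderGE.sum fun a ha => OrderGE.momentum (hs.spinor_coll (mem_sectorSet.1 ha)) μ

/-- The product with the jet direction, in terms of the jet momentum. -/
theorem mdot_jetDirection (χ : Fin n → Weyl) (i : Fin N) (V : Vec) :
    (spatialNorm (totalMomentum χ (sectorSet sector i)) : ℂ) * mdot (jetDirection sector χ i) V =
      mdot (totalMomentum χ (sectorSet sector i)) V - (totalMomentum χ (sectorSet sector i) 0 -
        spatialNorm (totalMomentum χ (sectorSet sector i))) * V 0 := by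
  rw [jetDirection, ← mdot_smul_left, smul_lightDirection, mdot_add_left, mdot_smul_left,
    mdot_timeDir]
  ring

theorem ExactOrder.isTheta {F : ℝ → ℂ} {z : ℤ} (h : ExactOrder F z) :
    F =Θ[𝓝[>] 0] fun l : ℝ => l ^ z := by
  refine ⟨h.le, ?_⟩
  have e : (fun l => (F l)⁻¹) =O[𝓝[>] 0] fun l : ℝ => l ^ (-z) := h.inv
  have e2 := e.inv_rev (h.ne.mono fun l h1 h2 => absurd (inv_eq_zero.1 h2) h1)
  simpa only [_root_.zpow_neg, inv_inv] using! e2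

theorem ExactOrder.sub {F G : ℝ → ℂ} {z : ℤ} (hF : ExactOrder F z) (hG : OrderGE G (z + 1)) :
    ExactOrder (fun l => F l - G l) z := by
  have h1 : G =o[𝓝[>] 0] F := by
    have e1 : (fun l : ℝ => l ^ (z + 1)) =o[𝓝[>] 0] fun l : ℝ => l ^ z := by
      have e2 : (fun l : ℝ => l) =o[𝓝[>] 0] fun _ => (1 : ℝ) := by
        rw [isLittleO_one_iff]
        exact tendsto_id.mono_left nhdsWithin_le_nhds
      refine ((isBigO_refl (fun l : ℝ => l ^ z) _).mul_isLittleO e2).congr' ?_ ?_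
      · filter_upwards [eventually_pos] with l hl
        rw [zpow_add_one₀ hl.ne']
      · exact Eventually.of_forall fun l => mul_one _
    exact (IsBigO.trans_isLittleO hG e1).trans_isBigO hF.isTheta.2
  refine ExactOrder.of_isTheta (IsTheta.trans ?_ hF.isTheta)
  exact ⟨(isBigO_refl F _).sub h1.isBigO, h1.right_isBigO_sub⟩

/-- The direction of a jet is a gauge vector for the soft sector. -/
theorem SoftDirection.jetDirection (hs : JetScaling sector χ) {i : Fin N} {e : Fin n}
    (he : sector e = i) : SoftDirection sector χ (fun l => jetDirection sector (χ l) i) := by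
  set J := sectorSet sector (i : WithTop (Fin N)) with hJ
  have heJ : e ∈ J := mem_sectorSet.2 he
  have hδ := hs.jet_energy_defect (S := J) (fun a ha => mem_sectorSet.1 ha) ⟨e, heJ⟩
  have hr : OrderGE (fun l => (spatialNorm (totalMomentum (χ l) J) : ℂ)) 0 := by
    refine ((hs.jet_momentum i 0).sub (hδ.mono (by norm_num))).congr'
      (Eventually.of_forall fun l => ?_)
    ring
  have key : ∀ S : Finset (Fin n), S.Nonempty → (∀ a ∈ S, sector a = ⊤) →
      ExactOrder (fun l => mdot (totalMomentum (χ l) J) (totalMomentum (χ l) S) -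
        (totalMomentum (χ l) J 0 - spatialNorm (totalMomentum (χ l) J)) *
          totalMomentum (χ l) S 0) 2 := by
    rintro S ⟨k, hk⟩ hS
    have hK : ∀ μ, OrderGE (fun l => totalMomentum (χ l) S μ) 2 := fun μ => by
      simp only [totalMomentum, Finset.sum_apply]
      exact OrderGE.sum fun a ha => OrderGE.momentum (hs.spinor_soft (hS a ha)) μ
    refine ExactOrder.sub ?_ ((hδ.mul (hK 0)).mono (by norm_num))
    have e1 : ∀ l, mdot (totalMomentum (χ l) J) (totalMomentum (χ l) S) =
        ∑ x ∈ J ×ˢ S, (((1 / 2) * ‖angle (χ l x.1) (χ l x.2)‖ ^ 2 : ℝ) : ℂ) := by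
      intro l
      conv_lhs => rw [totalMomentum, mdot_sum_left]
      simp only [mdot_momentum_totalMomentum]
      rw [Finset.sum_product]
    obtain ⟨h1, h2⟩ := ExactOrder.inv_sum
      (f := fun (x : Fin n × Fin n) l => (1 / 2) * ‖angle (χ l x.1) (χ l x.2)‖ ^ 2)
      (fun x l => by positivity) (Finset.mk_mem_product heJ hk)
      ((hs.angle_soft_jet (hS k hk) he).angle_swap.mdot_momentum)
    simp only [← e1] at h1 h2
    exact ⟨(OrderGE.mdot (hs.jet_momentum i) hK).mono (by norm_num), h1, h2⟩
  refine ⟨fun μ => ?_, fun S h1 h2 => ?_, fun S h1 h2 => ?_⟩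
  · refine (OrderGE.const 1).of_norm_le (Eventually.of_forall fun l => ?_)
    rw [norm_one]
    exact lightDirection_le _ _
  · obtain ⟨-, h4, h5⟩ := key S h1 h2
    refine (hr.mul h4).congr' (h5.mono fun l h6 => ?_)
    rw [← mdot_jetDirection] at h6 ⊢
    rw [mul_inv, mul_inv_cancel_left₀ (left_ne_zero_of_mul h6)]
  · refine (key S h1 h2).ne.mono fun l h6 => ?_
    rw [← mdot_jetDirection] at h6
    exact right_ne_zero_of_mul h6

/-- In the gauge `n_i·V = 0`, the product with any momentum of the jet is suppressed. -/
theorem JetScaling.mdot_jet_momentum (hs : JetScaling sector χ) (ht : WilsonDirections sector χ τ)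
    {i : Fin N} {e : Fin n} (he : sector e = i) {V : ℝ → Vec} {z : ℤ}
    (hV : ∀ μ, OrderGE (fun l => V l μ) z)
    (h0 : ∀ᶠ l in 𝓝[>] (0 : ℝ), mdot (jetDirection sector (χ l) i) (V l) = 0) :
    OrderGE (fun l => mdot (momentum (χ l e)) (V l)) (z + 1) := by
  set J := sectorSet sector (i : WithTop (Fin N)) with hJ
  have heJ : e ∈ J := mem_sectorSet.2 he
  have hδ := hs.jet_energy_defect (S := J) (fun a ha => mem_sectorSet.1 ha) ⟨e, heJ⟩
  obtain ⟨hP1, hP2⟩ := OrderGE.inv_mdot_totalMomentum heJ (ht.angle he)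
  -- all momenta of the jet are parallel up to `O(λ)`, by the Schouten identity
  have hpar : ∀ a ∈ J, ∀ μ, OrderGE (fun l => (mdot (momentum (τ l i)) (momentum (χ l a)) •
      momentum (χ l e) + (-mdot (momentum (τ l i)) (momentum (χ l e))) • momentum (χ l a)) μ) 1 := by
    intro a ha
    have hai := mem_sectorSet.1 ha
    have hτa := (ht.angle hai).le
    have hτe := (ht.angle he).le
    have hea : OrderGE (fun l => angle (χ l e) (χ l a)) 1 := by
      by_cases hae : e = a
      · subst hae
        simp only [angle_self]
        exact OrderGE.zero
      · exact (hs.angle_same hae he hai).le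
    have hx : ∀ j, OrderGE (fun l => angle (τ l i) (χ l a) * χ l e j) 0 := fun j =>
      hτa.mul (hs.spinor_coll he j)
    have hy : ∀ j, OrderGE (fun l => angle (τ l i) (χ l e) * χ l a j) 0 := fun j =>
      hτe.mul (hs.spinor_coll hai j)
    have hxy : ∀ j, OrderGE (fun l => angle (χ l e) (χ l a) * τ l i j) 1 := fun j =>
      hea.mul (ht.spinor i j)
    refine fun μ => OrderGE.of_bispinor (fun j k => ?_) μ
    have h1 := (((hxy j).mul (hx k).star).add ((hy j).mul (hxy k).star)).const_mul (1 / 2)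
    refine h1.congr' (Eventually.of_forall fun l => ?_)
    have hn : ∀ x : ℂ, ((‖x‖ ^ 2 : ℝ) : ℂ) = star x * x := fun x => by
      rw [Complex.star_def, Complex.conj_mul']; push_cast; rfl
    simp only [bispinor_add, bispinor_smul, Matrix.add_apply, Matrix.smul_apply, smul_eq_mul,
      bispinor_momentum, mdot_momentum_momentum, hn, star_mul']
    have sch : ∀ j : Fin 2, angle (χ l e) (χ l a) * τ l i j =
        angle (τ l i) (χ l a) * χ l e j - angle (τ l i) (χ l e) * χ l a j := by
      intro j
      fin_cases j <;> simp [angle] <;> ring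
    have sch' := congrArg star (sch k)
    simp only [star_sub, star_mul'] at sch'
    rw [sch j, sch']
    ring
  have hsum : ∀ μ, OrderGE (fun l => (mdot (momentum (τ l i)) (totalMomentum (χ l) J) •
      momentum (χ l e) + (-mdot (momentum (τ l i)) (momentum (χ l e))) •
        totalMomentum (χ l) J) μ) 1 := by
    intro μ
    refine (OrderGE.sum fun a ha => hpar a ha μ).congr' (Eventually.of_forall fun l => ?_)
    simp only [totalMomentum, mdot_sum_right, Pi.add_apply, Pi.smul_apply, Finset.sum_apply,
      smul_eq_mul, Finset.sum_mul, Finset.mul_sum, Finset.sum_add_distrib]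
  have h1 := OrderGE.mdot hsum hV
  have h2 := ((OrderGE.mdot (OrderGE.momentum (ht.spinor i))
    (OrderGE.momentum (hs.spinor_coll he))).mul (hδ.mul (hV 0)))
  refine ((hP1.mul (h1.add (h2.mono (by omega : 1 + z ≤ _)))).mono (by omega)).congr' ?_
  filter_upwards [hP2, h0] with l h3 h4
  have h5 := mdot_jetDirection (sector := sector) (χ l) i (V l)
  rw [h4, mul_zero] at h5
  have h6 : mdot (totalMomentum (χ l) J) (V l) = (totalMomentum (χ l) J 0 -
      spatialNorm (totalMomentum (χ l) J)) * V l 0 := (sub_eq_zero.1 h5.symm)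
  rw [mdot_add_left, mdot_smul_left, mdot_smul_left, h6, neg_mul, neg_add_cancel_right,
    inv_mul_cancel_left₀ h3]

end JetDirection

/-! ### Power counting in a jet -/

/-- Contraction of a bispinor with two spinors, `⟨u| X |v]`. -/
noncomputable def sandwich (u v : Weyl) (X : Matrix (Fin 2) (Fin 2) ℂ) : ℂ :=
  u 1 * X 0 0 * star (v 1) - u 1 * X 0 1 * star (v 0) - u 0 * X 1 0 * star (v 1) +
    u 0 * X 1 1 * star (v 0)

theorem mdot_momentum_eq_sandwich (a : Weyl) (V : Vec) :
    mdot (momentum a) V = (1 / 2) * sandwich a a (bispinor V) := mdot_momentum_left a V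

theorem OrderGE.sandwich {u v : ℝ → Weyl} {X : ℝ → Matrix (Fin 2) (Fin 2) ℂ} {z : ℤ}
    (hu : ∀ i, OrderGE (fun l => u l i) 0) (hv : ∀ i, OrderGE (fun l => v l i) 0)
    (hX : ∀ i j, OrderGE (fun l => X l i j) z) :
    OrderGE (fun l => sandwich (u l) (v l) (X l)) z := by
  have h : ∀ i j k m, OrderGE (fun l => u l i * X l j k * Star.star (v l m)) z := fun i j k m =>
    (((hu i).mul (hX j k)).mul (hv m).star).mono (by omega)
  exact (((h _ _ _ _).sub (h _ _ _ _)).sub (h _ _ _ _)).add (h _ _ _ _)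

/-- A boosted vector in the spinor basis `η`, `τ`. Only the component `⟨η|X|η]`, the contraction
with the jet momentum, is not suppressed by `l`. -/
theorem jetFrame_conj (l : ℝ) (η τ : Weyl) (X : Matrix (Fin 2) (Fin 2) ℂ) (i j : Fin 2) :
    (jetFrame l η τ * X * (jetFrame l η τ)ᴴ) i j = (angle τ η)⁻¹ * star (angle τ η)⁻¹ *
      (l * (l * (η i * star (η j)) * sandwich τ τ X - η i * star (τ j) * sandwich τ η X -
        τ i * star (η j) * sandwich η τ X) + τ i * star (τ j) * sandwich η η X) := by
  have hl : (starRingEnd ℂ) (l : ℂ) = l := Complex.conj_ofReal l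
  fin_cases i <;> fin_cases j <;>
    simp [jetFrame, Matrix.mul_apply, Matrix.vecMul, dotProduct, Fin.sum_univ_two, sandwich,
      hl] <;> ring

theorem jetFrame_apply_order {η τ : ℝ → Weyl} (hη : ∀ i, OrderGE (fun l => η l i) 0)
    (hτ : ∀ i, OrderGE (fun l => τ l i) 0) (hd : OrderGE (fun l => (angle (τ l) (η l))⁻¹) 0)
    (i j : Fin 2) : OrderGE (fun l => jetFrame l (η l) (τ l) i j) 0 := by
  have hl : OrderGE (fun l => (l : ℂ)) 0 := by
    simpa using (OrderGE.ofReal_zpow 1).mono (by norm_num : (0 : ℤ) ≤ 1)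
  have h1 : ∀ i j, OrderGE (fun l => (l : ℂ) * η l i * τ l j) 0 := fun i j =>
    (hl.mul (hη i)).mul (hτ j)
  have h2 : ∀ i j, OrderGE (fun l => τ l i * η l j) 0 := fun i j => (hτ i).mul (hη j)
  refine OrderGE.mul (y := 0) (z := 0) hd ?_
  fin_cases i <;> fin_cases j
  · exact (((hl.mul (hη 0)).mul (hτ 1).neg).add (h2 _ _))
  · exact (h1 _ _).sub (h2 _ _)
  · exact (((hl.mul (hη 1)).mul (hτ 1).neg).add (h2 _ _))
  · exact (h1 _ _).sub (h2 _ _)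

/-- The contraction with the momentum of the spinor `τ`, which the boost suppresses most. -/
theorem sandwich_jetFrame {l : ℝ} {η τ : Weyl} (h : angle τ η ≠ 0)
    (X : Matrix (Fin 2) (Fin 2) ℂ) :
    sandwich τ τ (jetFrame l η τ * X * (jetFrame l η τ)ᴴ) = (l : ℂ) ^ 2 * sandwich τ τ X := by
  have h' : star (angle τ η) ≠ 0 := star_ne_zero.2 h
  have h1 : ∀ u v w : Weyl, angle u v * star (angle u w) * ((angle τ η)⁻¹ * (star (angle τ η))⁻¹)
      * (angle τ η * star (angle τ η)) = angle u v * star (angle u w) := fun u v w => by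
    field_simp
  have h2 : sandwich τ τ (jetFrame l η τ * X * (jetFrame l η τ)ᴴ) =
      (angle τ η)⁻¹ * (star (angle τ η))⁻¹ * ((l : ℂ) ^ 2 * sandwich τ τ X) *
        (angle τ η * star (angle τ η)) := by
    conv_lhs => unfold sandwich
    simp only [jetFrame_conj, star_inv₀]
    simp only [angle, star_sub, star_mul']
    ring
  rw [h2]
  field_simp

/-- The boost suppresses all components but the one along `τ⟩[τ`. -/
theorem OrderGE.jetFrame_conj {η τ : ℝ → Weyl} {X : ℝ → Matrix (Fin 2) (Fin 2) ℂ} {z : ℤ}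
    (hη : ∀ i, OrderGE (fun l => η l i) 0) (hτ : ∀ i, OrderGE (fun l => τ l i) 0)
    (hd : OrderGE (fun l => (TreeQED.angle (τ l) (η l))⁻¹) 0)
    (hX : ∀ i j, OrderGE (fun l => X l i j) z)
    (h : OrderGE (fun l => TreeQED.sandwich (η l) (η l) (X l)) (z + 1)) (i j : Fin 2) :
    OrderGE (fun l => (jetFrame l (η l) (τ l) * X l * (jetFrame l (η l) (τ l))ᴴ) i j)
      (z + 1) := by
  simp only [TreeQED.jetFrame_conj]
  have hl : OrderGE (fun l => (l : ℂ)) 1 := by simpa using OrderGE.ofReal_zpow 1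
  have h1 := ((hη i).mul (hη j).star).mul (OrderGE.sandwich hτ hτ hX)
  have h2 := ((hη i).mul (hτ j).star).mul (OrderGE.sandwich hτ hη hX)
  have h3 := ((hτ i).mul (hη j).star).mul (OrderGE.sandwich hη hτ hX)
  have h4 := ((hτ i).mul (hτ j).star).mul h
  simp only [zero_add] at h1 h2 h3 h4
  have h5 : OrderGE (fun l => (l : ℂ) * (η l i * Star.star (η l j)) *
      TreeQED.sandwich (τ l) (τ l) (X l)) z := by
    refine ((hl.mul h1).mono (by omega)).congr' (Eventually.of_forall fun l => ?_)
    ring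
  refine ((hd.mul hd.star).mul ((hl.mul ((h5.sub h2).sub h3)).add
    (h4.mono (by omega : 1 + z ≤ z + 1)))).mono (by omega)

theorem adjugate_jetFrame (l : ℝ) (η τ : Weyl) :
    adjugate (jetFrame l η τ) = jetFrame l τ η := by
  have h : angle η τ = -angle τ η := angle_swap η τ
  unfold jetFrame
  rw [h, adjugate_smul, adjugate_fin_two_of, inv_neg]
  ext i j
  fin_cases i <;> fin_cases j <;> simp <;> ring

section Jet

variable {g : ℝ} {sp : Fin n → Species N} {χ ρ : ℝ → Fin n → Weyl}
  {τ : ℝ → Fin N → Weyl} {sector : Fin n → WithTop (Fin N)}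

/-- The number of inverse powers of `λ` that a particle counts: one if collinear, two if soft. -/
def weight (sector : Fin n → WithTop (Fin N)) (S : Finset (Fin n)) : ℤ :=
  ∑ a ∈ S, if sector a = ⊤ then 2 else 1

theorem frameR_smul_one (l : ℝ) : frameR ((l : ℂ) • 1) = (l : ℂ) • 1 := by
  rw [frameR, adjugate_smul, conjTranspose_smul, adjugate_one, conjTranspose_one, Complex.star_def,
    Complex.conj_ofReal, ← fromBlocks_one, fromBlocks_smul]
  simp

theorem frameL_smul_one (l : ℝ) : frameL ((l : ℂ) • 1) = (l : ℂ) • 1 := by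
  rw [frameL, conjTranspose_smul, conjTranspose_one, Complex.star_def,
    Complex.conj_ofReal, adjugate_smul, adjugate_one, ← fromBlocks_one, fromBlocks_smul]
  simp

theorem weight_sdiff_add (sector : Fin n → WithTop (Fin N)) {S T : Finset (Fin n)} (h : T ⊆ S) :
    weight sector (S \ T) + weight sector T = weight sector S := Finset.sum_sdiff h

theorem weight_soft {S : Finset (Fin n)} (h : ∀ a ∈ S, sector a = ⊤) :
    weight sector S = 2 * S.card := by
  unfold weight
  rw [Finset.sum_congr rfl fun a ha => if_pos (h a ha)]
  simp [mul_comm]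

open Classical in
/-- Indicator of sets with soft particles. -/
noncomputable def softInd (sector : Fin n → WithTop (Fin N)) (S : Finset (Fin n)) : ℤ :=
  if ∃ a ∈ S, sector a = ⊤ then 1 else 0

/-- If a tree with soft particles splits, one of its two parts has soft particles. -/
theorem softInd_le (sector : Fin n → WithTop (Fin N)) (S T : Finset (Fin n)) :
    softInd sector S ≤ softInd sector T + softInd sector (S \ T) := by
  unfold softInd
  by_cases h : ∃ a ∈ S, sector a = ⊤
  · obtain ⟨a, ha, has⟩ := h
    rw [if_pos ⟨a, ha, has⟩]
    by_cases haT : a ∈ T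
    · rw [if_pos ⟨a, haT, has⟩]; split_ifs <;> norm_num
    · rw [if_pos (⟨a, Finset.mem_sdiff.2 ⟨ha, haT⟩, has⟩ : ∃ a ∈ S \ T, sector a = ⊤)]
      split_ifs <;> norm_num
  · rw [if_neg h]; split_ifs <;> norm_num

theorem softInd_of_soft {S : Finset (Fin n)} {a : Fin n} (ha : a ∈ S) (h : sector a = ⊤) :
    softInd sector S = 1 := if_pos ⟨a, ha, h⟩

theorem softInd_of_coll {S : Finset (Fin n)} {i : Fin N} (h : ∀ a ∈ S, sector a = i) :
    softInd sector S = 0 :=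
  if_neg fun ⟨a, ha, h'⟩ => by rw [h a ha] at h'; exact WithTop.coe_ne_top h'

variable {i : Fin N} {e : Fin n}

/-- In the frame of a jet, the momenta of the jet and the soft momenta are all of order `λ²`, that
is their spinors are of order `λ`. -/
theorem jetFrame_spinor (hs : JetScaling sector χ) (ht : WilsonDirections sector χ τ)
    (he : sector e = i) {a : Fin n} (ha : sector a = i ∨ sector a = ⊤) (k : Fin 2) :
    OrderGE (fun l => (jetFrame l (χ l e) (τ l i) *ᵥ χ l a) k) 1 := by
  simp only [jetFrame_mulVec]
  have hl : OrderGE (fun l => (l : ℂ)) 1 := by simpa using OrderGE.ofReal_zpow 1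
  have h1 : OrderGE (fun l => angle (τ l i) (χ l a)) 0 := by
    rcases ha with ha | ha
    · exact (ht.angle ha).le
    · exact (OrderGE.angle (ht.spinor i) (hs.spinor_soft ha)).mono (by norm_num)
  have h2 : OrderGE (fun l => angle (χ l a) (χ l e)) 1 := by
    rcases ha with ha | ha
    · by_cases hae : a = e
      · subst hae; simp only [angle_self]; exact OrderGE.zero
      · exact (hs.angle_same hae ha he).le
    · exact (hs.angle_soft_jet ha he).le
  have hd := (ht.angle he).inv
  have h3 := (hl.mul (hs.spinor_coll he k)).mul h1
  have h4 := (ht.spinor i k).mul h2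
  exact (hd.mul ((h3.mono (by norm_num : (1 : ℤ) ≤ _)).add
    (h4.mono (by norm_num : (1 : ℤ) ≤ _)))).mono (by norm_num)

/-- A jet, with soft particles attached, has generic momenta in its boosted frame. -/
theorem frame_jet (hs : JetScaling sector χ) (ht : WilsonDirections sector χ τ)
    (he : sector e = i) {S : Finset (Fin n)} (hS : ∀ a ∈ S, sector a = i ∨ sector a = ⊤)
    {c : Fin n} (hc : c ∈ S) (hci : sector c = i) (hcard : 2 ≤ S.card) :
    FrameScaling χ (fun l => jetFrame l (χ l e) (τ l i)) 1 S := by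
  obtain ⟨b, hb, hbc⟩ := Finset.exists_mem_ne hcard c
  have hang : ExactOrder (fun l => angle (χ l b) (χ l c)) 1 := by
    rcases hS b hb with h | h
    · exact hs.angle_same hbc h hci
    · exact hs.angle_soft_jet h hci
  refine ⟨?_, fun a ha k => jetFrame_spinor hs ht he (hS a ha) k,
    OrderGE.inv_mass hb hc hbc hang⟩
  filter_upwards [(ht.angle he).ne] with l hl
  rw [det_jetFrame hl, zpow_one]

/-- The gauge used for the `i`-th jet: light-cone gauges `t_j·A = 0` in all jets, and `n_i·A = 0` for
the soft photons, which then decouple from the `i`-th jet. -/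
noncomputable def jetGauge (g : ℝ) (sp : Fin n → Species N) (χ ρ : ℝ → Fin n → Weyl)
    (sector : Fin n → WithTop (Fin N)) (τ : ℝ → Fin N → Weyl) (i : Fin N) (l : ℝ) : FieldAlg sp :=
  gaugeParam g sp (χ l) (ρ l) sector (sectorDir (jetDirection sector (χ l) i) (τ l))

/-- In light-cone gauge `t_i·A = 0` a collinear photon has the polarization vector with reference
spinor `τ i`. -/
theorem pho_jet_single (hs : JetScaling sector χ) (ht : WilsonDirections sector χ τ)
    (hρ : ∀ᶠ l in 𝓝[>] (0 : ℝ), AdmissibleRef sp (χ l) (ρ l))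
    (he : sector e = i) {a : Fin n} (ha : sector a = i) (j k : Fin 2) :
    OrderGE (fun l => (jetFrame l (χ l e) (τ l i) *
      bispinor (gaugePho g sp (χ l) (ρ l) (jetGauge g sp χ ρ sector τ i l) {a}) *
        (jetFrame l (χ l e) (τ l i))ᴴ) j k) 1 := by
  unfold jetGauge
  by_cases hc : (sp a).charge = 0
  swap
  · simp only [gaugePho_singleton_of_charged hc, bispinor_zero]
    simpa using OrderGE.zero
  obtain ⟨h, hsp⟩ : ∃ h, sp a = .photon h := by
    cases hsp : sp a <;> simp_all [Species.charge]
  have hMχ := jetFrame_spinor hs ht he (Or.inl ha)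
  have hMτ : ∀ j, OrderGE (fun l => (jetFrame l (χ l e) (τ l i) *ᵥ τ l i) j) 0 := fun j =>
    OrderGE.mulVec (jetFrame_apply_order (hs.spinor_coll he) (ht.spinor i) (ht.angle he).inv)
      (ht.spinor i) j
  have hd := (ht.angle ha).inv
  have hmain : OrderGE (fun l => (jetFrame l (χ l e) (τ l i) *
      bispinor (pol h (χ l a) (τ l i)) * (jetFrame l (χ l e) (τ l i))ᴴ) j k) 1 := by
    cases h
    · simp only [pol, Bool.false_eq_true, if_false, bispinor_smul, Matrix.mul_smul,
        Matrix.smul_mul, frame_bivec, Matrix.smul_apply, bispinor_bivec, smul_eq_mul, square,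
        div_eq_mul_inv, ← star_inv₀]
      exact (((hd.star.const_mul _).mul ((hMχ j).mul (hMτ k).star))).mono (by norm_num)
    · simp only [pol, if_true, bispinor_smul, Matrix.mul_smul,
        Matrix.smul_mul, frame_bivec, Matrix.smul_apply, bispinor_bivec, smul_eq_mul,
        div_eq_mul_inv]
      exact (((hd.const_mul _).mul ((hMτ j).mul (hMχ k).star))).mono (by norm_num)
  refine hmain.congr' ?_
  filter_upwards [hρ, (ht.angle ha).ne, (OrderGE.inv_mdot_totalMomentum
    (Finset.mem_singleton_self a) (ht.angle ha)).2] with l h1 h2 h3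
  have htot : totalMomentum (χ l) {a} = momentum (χ l a) := by simp [totalMomentum]
  rw [htot] at h3
  have h0 : mdot (momentum (τ l i)) (pol h (χ l a) (τ l i)) = 0 := by
    rw [mdot_momentum_eq_sandwich]
    cases h <;> simp only [pol, Bool.false_eq_true, if_false, if_true, bispinor_smul, sandwich,
      Matrix.smul_apply, bispinor_bivec, smul_eq_mul] <;> ring
  rw [gaugePho_singleton hsp h1 h2 (by rw [ha]; exact h3), ha, sectorDir_coe, h0]
  simp

/-- Soft fields in the frame of a jet, in the gauge in which they decouple from it. -/
theorem soft_in_jetFrame (hs : JetScaling sector χ) (ht : WilsonDirections sector χ τ)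
    (hρ : ∀ᶠ l in 𝓝[>] (0 : ℝ), AdmissibleRef sp (χ l) (ρ l))
    (he : sector e = i) {S : Finset (Fin n)} (hne : S.Nonempty) (hS : ∀ a ∈ S, sector a = ⊤) :
    FieldBound g sp χ ρ (jetGauge g sp χ ρ sector τ i)
      (fun l => jetFrame l (χ l e) (τ l i)) S (3 - weight sector S) := by
  have hm := SoftDirection.jetDirection hs he
  obtain ⟨hb, hp, hA⟩ := soft_fieldBound (g := g) (τ := τ) hs hm hρ S hne hS
  have hM := jetFrame_apply_order (hs.spinor_coll he) (ht.spinor i) (ht.angle he).inv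
  rw [weight_soft hS]
  unfold jetGauge
  refine ⟨fun f k => ?_, fun f k => ?_, fun j k => ?_⟩
  · have h1 : ∀ k, OrderGE (fun l => gaugeBar g sp (χ l) (ρ l) (gaugeParam g sp (χ l) (ρ l) sector
        (sectorDir (jetDirection sector (χ l) i) (τ l)))
        f k S) (4 - 2 * S.card - (1 : ℕ)) := fun k => by
      refine OrderGE.of_mul_pow 1 ((hb f k).congr' (Eventually.of_forall fun l => ?_))
      rw [frameR_smul_one, vecMul_smul, vecMul_one, pow_one]
      rfl
    refine (OrderGE.vecMul h1 (z := 0) (fun i j => ?_) k).mono (by push_cast; omega)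
    rcases i with i | i <;> rcases j with j | j
    · exact OrderGE.adjugate hM i j
    · exact OrderGE.zero
    · exact OrderGE.zero
    · exact OrderGE.conjTranspose hM i j
  · have h1 : ∀ k, OrderGE (fun l => gaugePsi g sp (χ l) (ρ l) (gaugeParam g sp (χ l) (ρ l) sector
        (sectorDir (jetDirection sector (χ l) i) (τ l)))
        f k S) (4 - 2 * S.card - (1 : ℕ)) := fun k => by
      refine OrderGE.of_mul_pow 1 ((hp f k).congr' (Eventually.of_forall fun l => ?_))
      rw [frameL_smul_one, smul_mulVec, one_mulVec, pow_one]
      rfl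
    refine (OrderGE.mulVec (y := 0) (fun i j => ?_) h1 k).mono (by push_cast; omega)
    rcases i with i | i <;> rcases j with j | j
    · exact hM i j
    · exact OrderGE.zero
    · exact OrderGE.zero
    · exact OrderGE.adjugate (OrderGE.conjTranspose hM) i j
  · have h1 : ∀ j k, OrderGE (fun l => bispinor (gaugePho g sp (χ l) (ρ l)
        (gaugeParam g sp (χ l) (ρ l) sector
        (sectorDir (jetDirection sector (χ l) i) (τ l))) S) j k)
        (4 - 2 * S.card - (2 : ℕ)) := fun j k => by
      refine OrderGE.of_mul_pow 2 ((hA j k).congr' (Eventually.of_forall fun l => ?_))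
      rw [frame_smul_one, Matrix.smul_apply, smul_eq_mul]
    -- `n_i·A = 0` makes the component of `A` along the jet smaller by one power, because `p_e` is
    -- parallel to `n_i` up to `λ`
    have h2 : OrderGE (fun l => sandwich (χ l e) (χ l e) (bispinor (gaugePho g sp (χ l) (ρ l)
        (gaugeParam g sp (χ l) (ρ l) sector (sectorDir (jetDirection sector (χ l) i) (τ l))) S)))
        (4 - 2 * S.card - (2 : ℕ) + 1) := by
      have h0 : ∀ᶠ l in 𝓝[>] (0 : ℝ), mdot (jetDirection sector (χ l) i) (gaugePho g sp (χ l) (ρ l)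
          (gaugeParam g sp (χ l) (ρ l) sector (sectorDir (jetDirection sector (χ l) i) (τ l))) S)
            = 0 := by
        filter_upwards [hm.ne S hne hS] with l hl
        exact mdot_gaugePho (v := sectorDir (jetDirection sector (χ l) i) (τ l)) (s := ⊤)
          hne hS hl
      have h3 := hs.mdot_jet_momentum ht he (OrderGE.of_bispinor h1) h0
      refine (h3.const_mul 2).congr' (Eventually.of_forall fun l => ?_)
      simp only [mdot_momentum_eq_sandwich]
      ring
    have h3 := OrderGE.jetFrame_conj (hs.spinor_coll he) (ht.spinor i) (ht.angle he).inv h1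
      h2 j k
    refine h3.mono ?_
    push_cast
    omega

/-- Power counting in a jet. In its frame and its gauge, each additional particle of the jet counts
`λ⁻¹` and each soft particle `λ⁻²`, but the first soft particle costs a factor `λ`: soft particles
decouple. -/
theorem jet_fieldBound (hs : JetScaling sector χ) (ht : WilsonDirections sector χ τ)
    (hρ : ∀ᶠ l in 𝓝[>] (0 : ℝ), AdmissibleRef sp (χ l) (ρ l))
    (he : sector e = i) (S : Finset (Fin n)) (hne : S.Nonempty)
    (hS : ∀ a ∈ S, sector a = i ∨ sector a = ⊤) :
    FieldBound g sp χ ρ (jetGauge g sp χ ρ sector τ i)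
      (fun l => jetFrame l (χ l e) (τ l i)) S (2 - weight sector S + softInd sector S) := by
  induction S using Finset.strongInduction with
  | H S ih =>
  by_cases hsoft : ∀ a ∈ S, sector a = ⊤
  · obtain ⟨a, ha⟩ := hne
    rw [softInd_of_soft ha (hsoft a ha)]
    convert soft_in_jetFrame hs ht hρ he ⟨a, ha⟩ hsoft using 1
    ring
  push Not at hsoft
  obtain ⟨c, hc, hc'⟩ := hsoft
  have hci := (hS c hc).resolve_right hc'
  have hΛ : GaugeFamily sp χ (jetGauge g sp χ ρ sector τ i) := gaugeFamily_gaugeParam hs _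
  rcases Nat.lt_or_ge S.card 2 with h | h
  · obtain ⟨a, rfl⟩ := Finset.card_eq_one.1 (by have := hne.card_pos; omega : S.card = 1)
    have hac := Finset.mem_singleton.1 hc
    subst hac
    have hw : 2 - weight sector {c} + softInd sector {c} = 1 := by
      rw [softInd_of_coll (by simpa using hci)]
      simp [weight, hci]
    rw [hw]
    exact ⟨bar_single hΛ.empty (jetFrame_spinor hs ht he (Or.inl hci)),
      psi_single hΛ.empty (jetFrame_spinor hs ht he (Or.inl hci)),
      pho_jet_single hs ht hρ he hci⟩
  · have hM := frame_jet hs ht he hS hc hci h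
    -- a tree with soft particles has a subtree with soft particles, so the factor `λ` they cost is
    -- never lost
    have hβ : ∀ T, T ⊂ S → T.Nonempty → (2 - weight sector S + softInd sector S) + 2 * 1 ≤
        (2 - weight sector T + softInd sector T) +
          (2 - weight sector (S \ T) + softInd sector (S \ T)) := by
      intro T hT _
      have h1 := weight_sdiff_add sector hT.subset
      have h2 := softInd_le sector S T
      omega
    have ih' := fun T (hT : T ⊂ S) hTn => ih T hT hTn fun a ha => hS a (hT.subset ha)
    refine fieldBound_step (β := fun T => 2 - weight sector T + softInd sector T) hΛ hM h ih' hβ ?_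
    by_cases hex : ∃ a ∈ S, sector a = ⊤
    · obtain ⟨a, ha, has⟩ := hex
      refine OrderGE.zero.congr' (Eventually.of_forall fun l => ?_)
      exact gaugeParam_of_ne g sp _ _ _ ha hc (by rw [has, hci]; exact WithTop.top_ne_coe)
    · have hcoll : ∀ a ∈ S, sector a = i := fun a ha =>
        (hS a ha).resolve_right fun h => hex ⟨a, ha, h⟩
      have h1 := pho_step (β := fun T => 2 - weight sector T + softInd sector T) hΛ hM h ih' hβ
      -- the boost suppresses `t_i·A` by `λ²`, so the original component may be larger by `λ⁻²`
      have h2 : OrderGE (fun l => mdot (momentum (τ l i)) (tree g sp (χ l) (ρ l) S).pho)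
          (2 - weight sector S + softInd sector S - (2 : ℕ)) := by
        refine OrderGE.of_mul_pow 2 (((OrderGE.sandwich (ht.spinor i) (ht.spinor i) h1).const_mul
          (1 / 2)).congr' ?_)
        filter_upwards [(ht.angle he).ne] with l hl
        rw [mdot_momentum_eq_sandwich, sandwich_jetFrame hl]
        ring
      have h3 := h2.mul (OrderGE.inv_mdot_totalMomentum hc (ht.angle hci)).1
      refine (h3.neg.mono ?_).congr' (Eventually.of_forall fun l => ?_)
      · simp
      · unfold jetGauge
        rw [gaugeParam_of_subset g sp _ _ _ ⟨c, hc⟩ hcoll, sectorDir_coe, div_eq_mul_inv]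

end Jet

/-! ### Power counting of all fields in one gauge -/

@[simp] theorem frameR_one : frameR 1 = 1 := by
  rw [frameR, adjugate_one, conjTranspose_one, fromBlocks_one]

@[simp] theorem frameL_one : frameL 1 = 1 := by
  rw [frameL, conjTranspose_one, adjugate_one, fromBlocks_one]

theorem OrderGE.frameL {M : ℝ → Matrix (Fin 2) (Fin 2) ℂ} {z : ℤ}
    (hM : ∀ i j, OrderGE (fun l => M l i j) z) (i j : DIdx) :
    OrderGE (fun l => TreeQED.frameL (M l) i j) z := by
  rcases i with i | i <;> rcases j with j | j
  · exact hM i j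
  · exact OrderGE.zero
  · exact OrderGE.zero
  · exact OrderGE.adjugate (OrderGE.conjTranspose hM) i j

theorem OrderGE.frameR {M : ℝ → Matrix (Fin 2) (Fin 2) ℂ} {z : ℤ}
    (hM : ∀ i j, OrderGE (fun l => M l i j) z) (i j : DIdx) :
    OrderGE (fun l => TreeQED.frameR (M l) i j) z := by
  rcases i with i | i <;> rcases j with j | j
  · exact OrderGE.adjugate hM i j
  · exact OrderGE.zero
  · exact OrderGE.zero
  · exact OrderGE.conjTranspose hM i j

/-- The adjugate of a frame undoes its action on vectors, up to the square of the determinant. -/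
theorem det_smul_conj (M X : Matrix (Fin 2) (Fin 2) ℂ) {s : ℝ} (h : M.det = s) :
    adjugate M * (M * X * Mᴴ) * (adjugate M)ᴴ = (s : ℂ) ^ 2 • X := by
  have h' : Mᴴ.det = s := by
    rw [det_conjTranspose, h, Complex.star_def, Complex.conj_ofReal]
  have e : (adjugate M)ᴴ = adjugate Mᴴ := by rw [adjugate_conjTranspose]
  rw [e, show adjugate M * (M * X * Mᴴ) * adjugate Mᴴ =
    (adjugate M * M) * X * (Mᴴ * adjugate Mᴴ) by simp only [Matrix.mul_assoc],
    Matrix.adjugate_mul, Matrix.mul_adjugate, h, h', Matrix.smul_mul, Matrix.one_mul,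
    Matrix.mul_smul, Matrix.mul_one, smul_smul, sq]

section Lab

variable {g : ℝ} {sp : Fin n → Species N} {χ ρ : ℝ → Fin n → Weyl}
  {τ : ℝ → Fin N → Weyl} {sector : Fin n → WithTop (Fin N)} {i : Fin N} {e : Fin n}

/-- Back in the original frame a spinor field has lost one power of `λ`, the determinant of the
boost. -/
theorem jet_bar (hs : JetScaling sector χ) (ht : WilsonDirections sector χ τ)
    (hρ : ∀ᶠ l in 𝓝[>] (0 : ℝ), AdmissibleRef sp (χ l) (ρ l))
    (he : sector e = i) (S : Finset (Fin n)) (hne : S.Nonempty)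
    (hS : ∀ a ∈ S, sector a = i ∨ sector a = ⊤) (f : Fin N) (k : DIdx) :
    OrderGE (fun l => gaugeBar g sp (χ l) (ρ l) (jetGauge g sp χ ρ sector τ i l) f k S)
      (1 - weight sector S + softInd sector S) := by
  have hM := jetFrame_apply_order (hs.spinor_coll he) (ht.spinor i) (ht.angle he).inv
  have h1 := OrderGE.vecMul ((jet_fieldBound (g := g) hs ht hρ he S hne hS).bar f)
    (OrderGE.frameL hM) k
  refine (OrderGE.of_mul_pow 1 (h1.congr' ?_)).mono (by push_cast; omega)
  filter_upwards [(ht.angle he).ne] with l hl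
  rw [vecMul_vecMul, frameR_mul_frameL (det_jetFrame hl), vecMul_smul, vecMul_one, pow_one]
  rfl

/-- The analogue of `jet_bar` for `ψ`. -/
theorem jet_psi (hs : JetScaling sector χ) (ht : WilsonDirections sector χ τ)
    (hρ : ∀ᶠ l in 𝓝[>] (0 : ℝ), AdmissibleRef sp (χ l) (ρ l))
    (he : sector e = i) (S : Finset (Fin n)) (hne : S.Nonempty)
    (hS : ∀ a ∈ S, sector a = i ∨ sector a = ⊤) (f : Fin N) (k : DIdx) :
    OrderGE (fun l => gaugePsi g sp (χ l) (ρ l) (jetGauge g sp χ ρ sector τ i l) f k S)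
      (1 - weight sector S + softInd sector S) := by
  have hM := jetFrame_apply_order (hs.spinor_coll he) (ht.spinor i) (ht.angle he).inv
  have h1 := OrderGE.mulVec (OrderGE.frameR hM)
    ((jet_fieldBound (g := g) hs ht hρ he S hne hS).psi f) k
  refine (OrderGE.of_mul_pow 1 (h1.congr' ?_)).mono (by push_cast; omega)
  filter_upwards [(ht.angle he).ne] with l hl
  rw [mulVec_mulVec, frameR_mul_frameL (det_jetFrame hl), smul_mulVec, one_mulVec, pow_one]
  rfl

theorem softInd_nonneg (sector : Fin n → WithTop (Fin N)) (S : Finset (Fin n)) :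
    0 ≤ softInd sector S := by
  unfold softInd; split_ifs <;> norm_num

/-- The boost back to the original frame enhances a field along the jet by `λ⁻²`; soft emission is
suppressed by one power and in purely collinear fields this component vanishes in light-cone
gauge, which leaves `λ⁻¹` in both cases. -/
theorem jet_pho (hs : JetScaling sector χ) (ht : WilsonDirections sector χ τ)
    (hρ : ∀ᶠ l in 𝓝[>] (0 : ℝ), AdmissibleRef sp (χ l) (ρ l))
    (he : sector e = i) (S : Finset (Fin n)) (heS : e ∈ S)
    (hS : ∀ a ∈ S, sector a = i ∨ sector a = ⊤) (j k : Fin 2) :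
    OrderGE (fun l => bispinor (gaugePho g sp (χ l) (ρ l) (jetGauge g sp χ ρ sector τ i l) S) j k)
      (1 - weight sector S) := by
  have hA := (jet_fieldBound (g := g) hs ht hρ he S ⟨e, heS⟩ hS).pho
  have hd : OrderGE (fun l => (angle (χ l e) (τ l i))⁻¹) 0 := (ht.angle he).angle_swap.inv
  have key : OrderGE (fun l => sandwich (τ l i) (τ l i) (jetFrame l (χ l e) (τ l i) *
      bispinor (gaugePho g sp (χ l) (ρ l) (jetGauge g sp χ ρ sector τ i l) S) *
        (jetFrame l (χ l e) (τ l i))ᴴ)) (2 - weight sector S + 1) := by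
    by_cases hex : ∃ a ∈ S, sector a = ⊤
    · obtain ⟨a, ha, has⟩ := hex
      have := OrderGE.sandwich (ht.spinor i) (ht.spinor i) hA
      rwa [softInd_of_soft ha has] at this
    · have hcoll : ∀ a ∈ S, sector a = i := fun a ha =>
        (hS a ha).resolve_right fun h => hex ⟨a, ha, h⟩
      refine OrderGE.zero.congr' ?_
      filter_upwards [(ht.angle he).ne,
        (OrderGE.inv_mdot_totalMomentum heS (ht.angle he)).2] with l hl hK
      have h0 : mdot (momentum (τ l i)) (gaugePho g sp (χ l) (ρ l)
          (jetGauge g sp χ ρ sector τ i l) S) = 0 := by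
        have := mdot_gaugePho (g := g) (sp := sp) (ρ := ρ l) (v := sectorDir
          (jetDirection sector (χ l) i) (τ l)) ⟨e, heS⟩ hcoll (by rwa [sectorDir_coe])
        rwa [sectorDir_coe] at this
      rw [mdot_momentum_eq_sandwich] at h0
      have h0' := (mul_eq_zero.1 h0).resolve_left (by norm_num)
      rw [sandwich_jetFrame hl, h0', mul_zero]
  have hA' := fun j k => (hA j k).mono (y := 2 - weight sector S)
    (by have := softInd_nonneg sector S; omega)
  have h1 := OrderGE.jetFrame_conj (ht.spinor i) (hs.spinor_coll he) hd hA' key j k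
  refine (OrderGE.of_mul_pow 2 (h1.congr' ?_)).mono (by push_cast; omega)
  filter_upwards [(ht.angle he).ne] with l hl
  rw [← adjugate_jetFrame, det_smul_conj _ _ (det_jetFrame hl), Matrix.smul_apply, smul_eq_mul]

/-- The gauge used for the common power counting of all fields: light-cone gauges `t_j·A = 0` in the
jets and Coulomb-like gauge `A⁰ = 0` for the soft photons. -/
noncomputable def commonGauge (g : ℝ) (sp : Fin n → Species N) (χ ρ : ℝ → Fin n → Weyl)
    (sector : Fin n → WithTop (Fin N)) (τ : ℝ → Fin N → Weyl) (l : ℝ) : FieldAlg sp :=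
  gaugeParam g sp (χ l) (ρ l) sector (sectorDir timeDir (τ l))

/-- Soft fields in the original frame: undoing the dilatation costs one power of `λ` for spinor
fields and two for photon fields, and the weaker bound is stated for all. -/
theorem soft_common (hs : JetScaling sector χ)
    (hρ : ∀ᶠ l in 𝓝[>] (0 : ℝ), AdmissibleRef sp (χ l) (ρ l))
    {S : Finset (Fin n)} (hne : S.Nonempty) (hS : ∀ a ∈ S, sector a = ⊤) :
    FieldBound g sp χ ρ (commonGauge g sp χ ρ sector τ) (fun _ => 1) S (2 - weight sector S) := by
  obtain ⟨hb, hp, hA⟩ := soft_fieldBound (g := g) (τ := τ) hs (SoftDirection.timeDir hs) hρ S hne hS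
  rw [weight_soft hS]
  unfold commonGauge
  refine ⟨fun f k => ?_, fun f k => ?_, fun j k => ?_⟩
  · simp only [frameR_one, vecMul_one]
    refine (OrderGE.of_mul_pow 1 ((hb f k).congr' (Eventually.of_forall fun l => ?_))).mono
      (by push_cast; omega)
    rw [frameR_smul_one, vecMul_smul, vecMul_one, pow_one]
    rfl
  · simp only [frameL_one, one_mulVec]
    refine (OrderGE.of_mul_pow 1 ((hp f k).congr' (Eventually.of_forall fun l => ?_))).mono
      (by push_cast; omega)
    rw [frameL_smul_one, smul_mulVec, one_mulVec, pow_one]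
    rfl
  · simp only [Matrix.one_mul, conjTranspose_one, Matrix.mul_one]
    refine (OrderGE.of_mul_pow 2 ((hA j k).congr' (Eventually.of_forall fun l => ?_))).mono
      (by push_cast; omega)
    rw [frame_smul_one, Matrix.smul_apply, smul_eq_mul]

end Lab

/-! ### Changes of gauge -/

namespace FieldAlg

variable {sp : Fin n → Species N}

theorem orderGE_mul {F G : ℝ → FieldAlg sp} {S : Finset (Fin n)} {u v : Finset (Fin n) → ℤ} {z : ℤ}
    (hF : ∀ T ⊆ S, OrderGE (fun l => F l T) (u T)) (hG : ∀ T ⊆ S, OrderGE (fun l => G l T) (v T))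
    (h : ∀ T ⊆ S, z ≤ u T + v (S \ T)) : OrderGE (fun l => (F l * G l) S) z := by
  simp only [mul_apply]
  refine OrderGE.sum fun T hT => ?_
  have hT := Finset.mem_powerset.1 hT
  exact ((((hF T hT).const_mul _).mul (hG _ Finset.sdiff_subset))).mono (h T hT)

theorem orderGE_exp {sector : Fin n → WithTop (Fin N)} {F : ℝ → FieldAlg sp}
    (h0 : ∀ l, F l ∅ = 0) (h : ∀ S, OrderGE (fun l => F l S) (-weight sector S))
    (S : Finset (Fin n)) :
    OrderGE (fun l => IsNilpotent.exp (F l) S) (-weight sector S) := by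
  have hpow : ∀ m S, OrderGE (fun l => (F l ^ m) S) (-weight sector S) := by
    intro m
    induction m with
    | zero =>
      intro S
      simp only [pow_zero, one_apply]
      by_cases hS : S = ∅
      · subst hS
        simpa [weight] using OrderGE.const 1
      · simpa [hS] using OrderGE.zero
    | succ m ih =>
      intro S
      simp only [pow_succ]
      refine orderGE_mul (fun T _ => ih T) (fun T _ => h T) fun T hT => ?_
      have := weight_sdiff_add sector hT
      omega
  simp only [exp_eq (h0 _)]
  exact OrderGE.sum fun m _ => (hpow m S).const_mul _

end FieldAlg

section Gauge

variable (g : ℝ) (sp : Fin n → Species N) (χ ρ : Fin n → Weyl)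

theorem exp_smul_add {Λ D : FieldAlg sp} (hΛ : Λ.IsEven) (h0 : Λ ∅ = 0) (hD0 : D ∅ = 0) (c : ℂ) :
    IsNilpotent.exp (c • (Λ + D)) = IsNilpotent.exp (c • Λ) * IsNilpotent.exp (c • D) := by
  rw [smul_add]
  exact IsNilpotent.exp_add_of_commute ((hΛ.smul c).commute _)
    (FieldAlg.isNilpotent (smul_apply_empty sp h0 c))
    (FieldAlg.isNilpotent (smul_apply_empty sp hD0 c))

variable {g sp χ ρ}

theorem gaugeBar_add {Λ D : FieldAlg sp} (hΛ : Λ.IsEven) (h0 : Λ ∅ = 0) (hD : D ∅ = 0)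
    (f : Fin N) (i : DIdx) : gaugeBar g sp χ ρ (Λ + D) f i =
      gaugeBar g sp χ ρ Λ f i * IsNilpotent.exp (-(g : ℂ) • D) := by
  rw [gaugeBar, exp_smul_add sp hΛ h0 hD, gaugeBar, mul_assoc]

theorem gaugePsi_add {Λ D : FieldAlg sp} (hΛ : Λ.IsEven) (h0 : Λ ∅ = 0) (hDe : D.IsEven)
    (hD : D ∅ = 0) (f : Fin N) (i : DIdx) : gaugePsi g sp χ ρ (Λ + D) f i =
      gaugePsi g sp χ ρ Λ f i * IsNilpotent.exp ((g : ℂ) • D) := by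
  have he := (hDe.smul (g : ℂ)).exp (smul_apply_empty sp hD _)
  rw [gaugePsi, exp_smul_add sp hΛ h0 hD, gaugePsi, mul_assoc, (he.commute _).eq, mul_assoc]

/-- The gauge transformation from the gauge of the `i`-th jet to the common gauge. It involves soft
particles only: its exponential is the soft Wilson line of the `i`-th jet, in the common gauge. -/
noncomputable def softShift (g : ℝ) (sp : Fin n → Species N) (χ ρ : ℝ → Fin n → Weyl)
    (sector : Fin n → WithTop (Fin N)) (τ : ℝ → Fin N → Weyl) (i : Fin N) (l : ℝ) : FieldAlg sp :=
  commonGauge g sp χ ρ sector τ l - jetGauge g sp χ ρ sector τ i l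

variable {χ ρ : ℝ → Fin n → Weyl} {τ : ℝ → Fin N → Weyl} {sector : Fin n → WithTop (Fin N)}
  {i : Fin N} {e : Fin n}

theorem commonGauge_hasFlavor (l : ℝ) : (commonGauge g sp χ ρ sector τ l).HasFlavor 0 :=
  gaugeParam_hasFlavor g sp _ _ sector _

theorem jetGauge_hasFlavor (l : ℝ) : (jetGauge g sp χ ρ sector τ i l).HasFlavor 0 :=
  gaugeParam_hasFlavor g sp _ _ sector _

theorem commonGauge_empty (l : ℝ) : commonGauge g sp χ ρ sector τ l ∅ = 0 :=
  gaugeParam_empty g sp _ _ sector _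

theorem jetGauge_empty (l : ℝ) : jetGauge g sp χ ρ sector τ i l ∅ = 0 :=
  gaugeParam_empty g sp _ _ sector _

theorem softShift_isEven (l : ℝ) : (softShift g sp χ ρ sector τ i l).IsEven :=
  (commonGauge_hasFlavor l).isEven.sub (jetGauge_hasFlavor l).isEven

theorem softShift_empty (l : ℝ) : softShift g sp χ ρ sector τ i l ∅ = 0 := by
  rw [softShift, FieldAlg.sub_apply, commonGauge_empty, jetGauge_empty, sub_zero]

theorem commonGauge_eq_add (i : Fin N) (l : ℝ) : commonGauge g sp χ ρ sector τ l =
    jetGauge g sp χ ρ sector τ i l + softShift g sp χ ρ sector τ i l := by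
  rw [softShift, add_sub_cancel]

theorem softShift_of_coll {S : Finset (Fin n)} {a : Fin n} (ha : a ∈ S) (h : sector a ≠ ⊤)
    (l : ℝ) : softShift g sp χ ρ sector τ i l S = 0 := by
  rw [softShift, FieldAlg.sub_apply, commonGauge, jetGauge, sub_eq_zero]
  obtain ⟨j, hj⟩ := WithTop.ne_top_iff_exists.1 h
  by_cases hS : ∀ b ∈ S, sector b = j
  · rw [gaugeParam_of_subset _ _ _ _ _ ⟨a, ha⟩ hS, gaugeParam_of_subset _ _ _ _ _ ⟨a, ha⟩ hS]
    simp only [sectorDir_coe]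
  · push Not at hS
    obtain ⟨b, hb, hbj⟩ := hS
    rw [hj] at hbj
    rw [gaugeParam_of_ne _ _ _ _ _ hb ha hbj, gaugeParam_of_ne _ _ _ _ _ hb ha hbj]

/-- On soft particles the shift is `n·A / n·K` with `A` in the common gauge: there `A_S` is of order
`λ^(2 - 2|S|)`, and `1 / n·K` of order `λ⁻²`. -/
theorem softShift_order (hs : JetScaling sector χ)
    (hρ : ∀ᶠ l in 𝓝[>] (0 : ℝ), AdmissibleRef sp (χ l) (ρ l)) (he : sector e = i)
    (S : Finset (Fin n)) :
    OrderGE (fun l => softShift g sp χ ρ sector τ i l S) (-weight sector S) := by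
  rcases S.eq_empty_or_nonempty with rfl | hne
  · simp only [softShift_empty]
    exact OrderGE.zero
  by_cases hS : ∀ a ∈ S, sector a = ⊤
  · have hm := SoftDirection.jetDirection hs he
    have hA := OrderGE.of_bispinor fun j k => by
      simpa using (soft_common (g := g) (τ := τ) hs hρ hne hS).pho j k
    refine ((OrderGE.mdot hm.le hA).mul (hm.inv S hne hS)).mono (by omega) |>.congr' ?_
    filter_upwards [hm.ne S hne hS] with l hl
    rw [softShift, FieldAlg.sub_apply, commonGauge, jetGauge,
      gaugeParam_of_subset (v := sectorDir (jetDirection sector (χ l) i) (τ l)) _ _ _ _ hne hS,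
      gaugePho, mdot_add_right, mdot_smul_right, sectorDir_top]
    field_simp
    ring
  · push Not at hS
    obtain ⟨a, ha, h⟩ := hS
    simp only [softShift_of_coll ha h]
    exact OrderGE.zero

end Gauge

/-! ### The fields of the operator -/

namespace FieldAlg

variable {sp : Fin n → Species N}

theorem exp_eq_zero {F : FieldAlg sp} {a : Fin n} (h0 : F ∅ = 0) (h : ∀ S, a ∈ S → F S = 0)
    {S : Finset (Fin n)} (ha : a ∈ S) : IsNilpotent.exp F S = 0 := by
  have hpow : ∀ m S, a ∈ S → (F ^ m) S = 0 := by
    intro m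
    induction m with
    | zero => intro S ha; rw [pow_zero, one_apply, if_neg (Finset.ne_empty_of_mem ha)]
    | succ m ih =>
      intro S ha
      rw [pow_succ, mul_apply]
      refine Finset.sum_eq_zero fun T _ => ?_
      by_cases hT : a ∈ T
      · rw [ih T hT]; ring
      · rw [h (S \ T) (Finset.mem_sdiff.2 ⟨ha, hT⟩), mul_zero]
  rw [exp_eq h0]
  exact Finset.sum_eq_zero fun m _ => by rw [hpow m S ha, mul_zero]

end FieldAlg

/-- The jets that have particles in `S`. -/
noncomputable def touchedJets (sector : Fin n → WithTop (Fin N)) (S : Finset (Fin n)) :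
    Finset (Fin N) := by
  classical exact Finset.univ.filter fun i => ∃ a ∈ S, sector a = i

theorem mem_touchedJets {sector : Fin n → WithTop (Fin N)} {S : Finset (Fin n)} {i : Fin N} :
    i ∈ touchedJets sector S ↔ ∃ a ∈ S, sector a = i := by
  simp [touchedJets]

theorem card_touchedJets_le (sector : Fin n → WithTop (Fin N)) (S T : Finset (Fin n)) :
    (touchedJets sector S).card ≤ (touchedJets sector T).card +
      (touchedJets sector (S \ T)).card := by
  classical
  refine (Finset.card_le_card fun i hi => ?_).trans (Finset.card_union_le _ _)
  obtain ⟨a, ha, hai⟩ := mem_touchedJets.1 hi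
  by_cases hT : a ∈ T
  · exact Finset.mem_union_left _ (mem_touchedJets.2 ⟨a, hT, hai⟩)
  · exact Finset.mem_union_right _ (mem_touchedJets.2 ⟨a, Finset.mem_sdiff.2 ⟨ha, hT⟩, hai⟩)

section Common

variable {g : ℝ} {sp : Fin n → Species N} {χ ρ : ℝ → Fin n → Weyl}
  {τ : ℝ → Fin N → Weyl} {sector : Fin n → WithTop (Fin N)} {i : Fin N} {e : Fin n}

/-- The soft Wilson line along the `j`-th jet, in the common gauge, for the coupling `c`. -/
noncomputable def softWilson (g : ℝ) (sp : Fin n → Species N) (χ ρ : ℝ → Fin n → Weyl)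
    (sector : Fin n → WithTop (Fin N)) (τ : ℝ → Fin N → Weyl) (c : ℂ) (j : Fin N) (l : ℝ) :
    FieldAlg sp :=
  IsNilpotent.exp (c • softShift g sp χ ρ sector τ j l)

theorem softWilson_order (hs : JetScaling sector χ)
    (hρ : ∀ᶠ l in 𝓝[>] (0 : ℝ), AdmissibleRef sp (χ l) (ρ l)) (he : sector e = i) (c : ℂ)
    (S : Finset (Fin n)) :
    OrderGE (fun l => softWilson g sp χ ρ sector τ c i l S) (-weight sector S) :=
  FieldAlg.orderGE_exp (fun l => smul_apply_empty sp (softShift_empty l) c)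
    (fun S => (softShift_order hs hρ he S).const_mul c) S

theorem softWilson_of_coll {S : Finset (Fin n)} {a : Fin n} (ha : a ∈ S) (h : sector a ≠ ⊤)
    (c : ℂ) (l : ℝ) : softWilson g sp χ ρ sector τ c i l S = 0 :=
  FieldAlg.exp_eq_zero (smul_apply_empty sp (softShift_empty l) c) (fun S ha => by
    rw [FieldAlg.smul_apply, softShift_of_coll ha h, mul_zero]) ha

theorem softWilson_empty (c : ℂ) (l : ℝ) : softWilson g sp χ ρ sector τ c i l ∅ = 1 :=
  FieldAlg.exp_apply_empty (smul_apply_empty sp (softShift_empty l) c)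

theorem softWilson_isEven (c : ℂ) (l : ℝ) : (softWilson g sp χ ρ sector τ c i l).IsEven :=
  ((softShift_isEven l).smul c).exp (smul_apply_empty sp (softShift_empty l) c)

/-- The `j`-th field of the operator, gauge transformed by `Λ`. -/
noncomputable def gaugeField (g : ℝ) (sp : Fin n → Species N) (χ ρ : Fin n → Weyl)
    (barred : Fin N → Bool) (Λ : FieldAlg sp) (j : Fin N) (k : DIdx) : FieldAlg sp :=
  if barred j then gaugeBar g sp χ ρ Λ j k else gaugePsi g sp χ ρ Λ j k

variable (barred : Fin N → Bool)

theorem gaugeField_empty {χ ρ : Fin n → Weyl} {Λ : FieldAlg sp} (j : Fin N) (k : DIdx) :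
    gaugeField g sp χ ρ barred Λ j k ∅ = 0 := by
  unfold gaugeField
  split_ifs
  · exact gaugeBar_empty g sp χ ρ j k
  · exact gaugePsi_empty g sp χ ρ j k

theorem gaugeField_add {χ ρ : Fin n → Weyl} {Λ D : FieldAlg sp} (hΛ : Λ.IsEven) (h0 : Λ ∅ = 0)
    (hDe : D.IsEven) (hD : D ∅ = 0) (j : Fin N) (k : DIdx) :
    gaugeField g sp χ ρ barred (Λ + D) j k = gaugeField g sp χ ρ barred Λ j k *
      IsNilpotent.exp (-((opCharge barred j : ℂ) * g) • D) := by
  unfold gaugeField opCharge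
  split_ifs
  · rw [gaugeBar_add hΛ h0 hD]; simp
  · rw [gaugePsi_add hΛ h0 hDe hD]; simp

theorem gaugeField_hasFlavor {χ ρ : Fin n → Weyl} {Λ : FieldAlg sp} (hΛ : Λ.HasFlavor 0)
    (h0 : Λ ∅ = 0) (j : Fin N) (k : DIdx) :
    (gaugeField g sp χ ρ barred Λ j k).HasFlavor (Pi.single j (opCharge barred j)) := by
  unfold gaugeField opCharge
  split_ifs
  · have := (barEl_hasFlavor g sp χ ρ j k).mul
      ((hΛ.smul (-(g : ℂ))).exp (smul_apply_empty sp h0 _))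
    rwa [add_zero] at this
  · have := ((hΛ.smul (g : ℂ)).exp (smul_apply_empty sp h0 _)).mul (psiEl_hasFlavor g sp χ ρ j k)
    rwa [zero_add] at this

/-- A field in the common gauge is the field in the gauge of the `i`-th jet times a soft Wilson
line. Here `i` need not be the jet of the field. -/
theorem gaugeField_common (j i : Fin N) (k : DIdx) (l : ℝ) :
    gaugeField g sp (χ l) (ρ l) barred (commonGauge g sp χ ρ sector τ l) j k =
      gaugeField g sp (χ l) (ρ l) barred (jetGauge g sp χ ρ sector τ i l) j k *
        softWilson g sp χ ρ sector τ (-((opCharge barred j : ℂ) * g)) i l := by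
  rw [commonGauge_eq_add i, gaugeField_add barred (jetGauge_hasFlavor l).isEven (jetGauge_empty l)
    (softShift_isEven l) (softShift_empty l), softWilson]

variable {barred}

theorem gaugeField_jet (hs : JetScaling sector χ) (ht : WilsonDirections sector χ τ)
    (hρ : ∀ᶠ l in 𝓝[>] (0 : ℝ), AdmissibleRef sp (χ l) (ρ l))
    (he : sector e = i) (S : Finset (Fin n))
    (hS : ∀ a ∈ S, sector a = i ∨ sector a = ⊤) (j : Fin N) (k : DIdx) :
    OrderGE (fun l =>
      gaugeField g sp (χ l) (ρ l) barred (jetGauge g sp χ ρ sector τ i l) j k S)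
      (1 - weight sector S + softInd sector S) := by
  rcases S.eq_empty_or_nonempty with rfl | hne
  · simp only [gaugeField_empty]
    exact OrderGE.zero
  unfold gaugeField
  cases barred j
  · exact jet_psi hs ht hρ he S hne hS j k
  · exact jet_bar hs ht hρ he S hne hS j k

/-- Power counting of all fields in the common gauge: each collinear particle counts `λ⁻¹` and each
soft particle `λ⁻²`, and there is one power of `λ` for each jet involved. -/
theorem common_fieldBound (hs : JetScaling sector χ) (ht : WilsonDirections sector χ τ)
    (hρ : ∀ᶠ l in 𝓝[>] (0 : ℝ), AdmissibleRef sp (χ l) (ρ l)) (S : Finset (Fin n))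
    (hne : S.Nonempty) :
    FieldBound g sp χ ρ (commonGauge g sp χ ρ sector τ) (fun _ => 1) S
      ((touchedJets sector S).card - weight sector S) := by
  induction S using Finset.strongInduction with
  | H S ih =>
  by_cases h2 : ∃ a ∈ S, ∃ b ∈ S, ∃ i j : Fin N, i ≠ j ∧ sector a = i ∧ sector b = j
  -- several jets: the propagator is hard, and no gauge parameter connects the jets
  · obtain ⟨a, ha, b, hb, i, j, hij, hai, hbj⟩ := h2
    have hab : sector a ≠ sector b := by
      rw [hai, hbj]; exact fun h => hij (WithTop.coe_injective h)
    refine fieldBound_step (σ := 0) (gaugeFamily_gaugeParam hs _)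
      (hs.frame_hard ha hb hij hai hbj)
      (Finset.one_lt_card.2 ⟨a, ha, b, hb, fun h => hab (congrArg sector h)⟩)
      (β := fun T => (touchedJets sector T).card - weight sector T) ih (fun T hT _ => ?_) ?_
    · have h1 := weight_sdiff_add sector hT.subset
      have h2 := card_touchedJets_le sector S T
      push_cast [← Int.ofNat_le] at h2
      omega
    · refine OrderGE.zero.congr' (Eventually.of_forall fun l => ?_)
      exact gaugeParam_of_ne g sp _ _ _ ha hb hab
  by_cases hsoft : ∀ a ∈ S, sector a = ⊤
  · have h0 : (touchedJets sector S).card = 0 := by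
      rw [Finset.card_eq_zero, Finset.eq_empty_iff_forall_notMem]
      intro i hi
      obtain ⟨a, ha, hai⟩ := mem_touchedJets.1 hi
      rw [hsoft a ha] at hai
      exact WithTop.top_ne_coe hai
    obtain ⟨hb, hp, hA⟩ := soft_common (g := g) (τ := τ) hs hρ hne hsoft
    exact ⟨fun f k => (hb f k).mono (by omega), fun f k => (hp f k).mono (by omega),
      fun j k => (hA j k).mono (by omega)⟩
  · push Not at hsoft
    obtain ⟨e, heS, he⟩ := hsoft
    obtain ⟨i, hi⟩ := WithTop.ne_top_iff_exists.1 he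
    have hS : ∀ a ∈ S, sector a = i ∨ sector a = ⊤ := by
      intro a ha
      by_contra! h
      obtain ⟨j, hj⟩ := WithTop.ne_top_iff_exists.1 h.2
      refine h2 ⟨a, ha, e, heS, j, i, ?_, hj.symm, hi.symm⟩
      rintro rfl
      exact h.1 hj.symm
    have h1 : (touchedJets sector S).card = 1 := by
      rw [Finset.card_eq_one]
      refine ⟨i, ?_⟩
      ext j
      rw [mem_touchedJets, Finset.mem_singleton]
      constructor
      · rintro ⟨a, ha, haj⟩
        rcases hS a ha with h | h
        · rw [haj] at h; exact WithTop.coe_injective h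
        · rw [haj] at h; exact absurd h WithTop.coe_ne_top
      · rintro rfl; exact ⟨e, heS, hi.symm⟩
    rw [h1]
    -- one jet with soft particles: transform from the gauge of the jet by its soft Wilson line
    have hmul : ∀ {F : ℝ → FieldAlg sp} (c : ℂ), (∀ l, F l ∅ = 0) → (∀ T ⊆ S, T.Nonempty →
        OrderGE (fun l => F l T) (1 - weight sector T + softInd sector T)) →
        OrderGE (fun l => (F l * softWilson g sp χ ρ sector τ c i l) S)
          ((1 : ℕ) - weight sector S) := by
      intro F c hF0 hF
      refine FieldAlg.orderGE_mul (u := fun T => 1 - weight sector T) (fun T hT => ?_)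
        (fun T _ => softWilson_order hs hρ hi.symm c T) fun T hT => ?_
      · rcases T.eq_empty_or_nonempty with rfl | hTne
        · simp only [hF0]; exact OrderGE.zero
        · exact (hF T hT hTne).mono (by have := softInd_nonneg sector T; omega)
      · have := weight_sdiff_add sector hT
        push_cast; omega
    refine ⟨fun f k => ?_, fun f k => ?_, fun j k => ?_⟩
    · simp only [frameR_one, vecMul_one]
      refine (hmul (-(g : ℂ)) (fun l => gaugeBar_empty g sp (χ l) (ρ l) f k) fun T hT hTne =>
        jet_bar hs ht hρ hi.symm T hTne (fun a ha => hS a (hT ha)) f k).congr'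
          (Eventually.of_forall fun l => ?_)
      rw [commonGauge_eq_add i, gaugeBar_add (jetGauge_hasFlavor l).isEven (jetGauge_empty l)
        (softShift_empty l), softWilson]
    · simp only [frameL_one, one_mulVec]
      refine (hmul (g : ℂ) (fun l => gaugePsi_empty g sp (χ l) (ρ l) f k) fun T hT hTne =>
        jet_psi hs ht hρ hi.symm T hTne (fun a ha => hS a (hT ha)) f k).congr'
          (Eventually.of_forall fun l => ?_)
      rw [commonGauge_eq_add i, gaugePsi_add (jetGauge_hasFlavor l).isEven (jetGauge_empty l)
        (softShift_isEven l) (softShift_empty l), softWilson]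
    · simp only [Matrix.one_mul, conjTranspose_one, Matrix.mul_one]
      refine (jet_pho (g := g) hs ht hρ hi.symm S heS hS j k).congr'
        (Eventually.of_forall fun l => ?_)
      have h3 : commonGauge g sp χ ρ sector τ l S = jetGauge g sp χ ρ sector τ i l S := by
        rw [commonGauge_eq_add i, FieldAlg.add_apply, softShift_of_coll heS he, add_zero]
      rw [gaugePho, h3, gaugePho]

end Common

/-! ### Soft-collinear factorization of each field -/

namespace FieldAlg

variable {sp : Fin n → Species N}

theorem orderGE_mul_of_terms {F G : ℝ → FieldAlg sp} {S : Finset (Fin n)} {z : ℤ}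
    (h : ∀ T ⊆ S, OrderGE (fun l => F l T * G l (S \ T)) z) :
    OrderGE (fun l => (F l * G l) S) z := by
  simp only [mul_apply, mul_assoc]
  exact OrderGE.sum fun T hT => (h T (Finset.mem_powerset.1 hT)).const_mul _

/-- The operator with the matrix element `b` in the state `U`, and no others. -/
noncomputable def single (U : Finset (Fin n)) (b : ℂ) : FieldAlg sp :=
  fun S => if S = U then b else 0

theorem single_apply (U : Finset (Fin n)) (b : ℂ) (S : Finset (Fin n)) :
    (single U b : FieldAlg sp) S = if S = U then b else 0 := rfl

theorem single_mul_apply (U : Finset (Fin n)) (b : ℂ) (F : FieldAlg sp) (S : Finset (Fin n)) :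
    ((single U b : FieldAlg sp) * F : FieldAlg sp) S =
      if U ⊆ S then fermiSign sp U (S \ U) * b * F (S \ U) else 0 := by
  rw [mul_apply]
  split_ifs with h
  · rw [Finset.sum_eq_single U]
    · rw [single_apply, if_pos rfl]
    · intro T _ hT
      rw [single_apply, if_neg hT]; ring
    · intro h'
      exact absurd (Finset.mem_powerset.2 h) h'
  · refine Finset.sum_eq_zero fun T hT => ?_
    rw [single_apply, if_neg]
    · ring
    · rintro rfl
      exact h (Finset.mem_powerset.1 hT)

end FieldAlg

/-- The set `S` consists of the `i`-th jet and soft particles. -/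
def IsDressedJet (sector : Fin n → WithTop (Fin N)) (i : Fin N) (S : Finset (Fin n)) : Prop :=
  ∀ a, sector a ≠ ⊤ → (a ∈ S ↔ sector a = i)

open Classical in
/-- The number of powers of `λ` by which the field `j` falls below the power counting by particles
only. -/
noncomputable def excess (sector : Fin n → WithTop (Fin N)) (j : Fin N) (S : Finset (Fin n)) : ℤ :=
  if ∃ i, i ≠ j ∧ IsDressedJet sector i S then 2 else max 1 (touchedJets sector S).card

section

variable {g : ℝ} {sp : Fin n → Species N} {χ ρ : ℝ → Fin n → Weyl}
  {τ : ℝ → Fin N → Weyl} {sector : Fin n → WithTop (Fin N)} {i : Fin N} {e : Fin n}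
  {barred : Fin N → Bool}

theorem IsDressedJet.or_top {S : Finset (Fin n)} (h : IsDressedJet sector i S) {a : Fin n}
    (ha : a ∈ S) : sector a = i ∨ sector a = ⊤ := by
  by_cases ht : sector a = ⊤
  · exact Or.inr ht
  · exact Or.inl ((h a ht).1 ha)

theorem IsDressedJet.unique {S : Finset (Fin n)} {j : Fin N} (h : IsDressedJet sector i S)
    (h' : IsDressedJet sector j S) (he : sector e = i) : i = j := by
  have ht : sector e ≠ ⊤ := by rw [he]; exact WithTop.coe_ne_top
  have := (h' e ht).1 ((h e ht).2 he)
  rw [he] at this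
  exact WithTop.coe_injective this

theorem excess_eq_one {S : Finset (Fin n)} (h : IsDressedJet sector i S) (he : sector e = i) :
    excess sector i S = 1 := by
  have h1 : (touchedJets sector S).card ≤ 1 := by
    rw [Finset.card_le_one]
    have : ∀ j ∈ touchedJets sector S, j = i := by
      intro j hj
      obtain ⟨a, ha, haj⟩ := mem_touchedJets.1 hj
      rcases h.or_top ha with h' | h'
      · rw [haj] at h'; exact WithTop.coe_injective h'
      · rw [haj] at h'; exact absurd h' WithTop.coe_ne_top
    intro a ha b hb
    rw [this a ha, this b hb]
  rw [excess, if_neg, max_eq_left (by exact_mod_cast h1)]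
  rintro ⟨j, hj, hjS⟩
  exact hj (h.unique hjS he).symm

theorem FieldBound.gaugeField {Λ : ℝ → FieldAlg sp} {S : Finset (Fin n)} {z : ℤ}
    (h : FieldBound g sp χ ρ Λ (fun _ => 1) S z) (j : Fin N) (k : DIdx) :
    OrderGE (fun l => TreeQED.gaugeField g sp (χ l) (ρ l) barred (Λ l) j k S) z := by
  unfold TreeQED.gaugeField
  cases barred j
  · simpa using h.psi j k
  · simpa using h.bar j k

/-- A field that creates a dressed jet: soft particles are emitted either by the soft Wilson line or
at the cost of one more power of `λ`. -/
theorem soft_emission_order (hs : JetScaling sector χ)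
    (hρ : ∀ᶠ l in 𝓝[>] (0 : ℝ), AdmissibleRef sp (χ l) (ρ l)) (he : sector e = i)
    {S : Finset (Fin n)} (hS : IsDressedJet sector i S) {F : ℝ → FieldAlg sp}
    (hF : ∀ T ⊆ S, T ≠ sectorSet sector i →
      OrderGE (fun l => F l T) (1 - weight sector T + softInd sector T))
    (hF0 : ∀ l, F l (sectorSet sector i) = 0) (c : ℂ) :
    OrderGE (fun l => (F l * softWilson g sp χ ρ sector τ c i l) S) (2 - weight sector S) := by
  refine FieldAlg.orderGE_mul_of_terms fun T hT => ?_
  by_cases hcoll : ∃ a ∈ S \ T, sector a ≠ ⊤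
  · obtain ⟨a, ha, hat⟩ := hcoll
    simp only [softWilson_of_coll ha hat, mul_zero]
    exact OrderGE.zero
  by_cases hTi : T = sectorSet sector i
  · subst hTi
    simp only [hF0, zero_mul]
    exact OrderGE.zero
  have hsoft : ∃ a ∈ T, sector a = ⊤ := by
    by_contra! hno
    refine hTi (Finset.ext fun a => ?_)
    rw [mem_sectorSet]
    constructor
    · intro ha
      exact (hS.or_top (hT ha)).resolve_right (hno a ha)
    · intro ha
      have hat : sector a ≠ ⊤ := by rw [ha]; exact WithTop.coe_ne_top
      by_contra haT
      exact hcoll ⟨a, Finset.mem_sdiff.2 ⟨(hS a hat).2 ha, haT⟩, hat⟩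
  obtain ⟨a, ha, hat⟩ := hsoft
  have h1 := hF T hT hTi
  rw [softInd_of_soft ha hat] at h1
  have := weight_sdiff_add sector hT
  exact (h1.mul (softWilson_order hs hρ he c (S \ T))).mono (by omega)

/-- Power counting of the fields of the operator. A field cannot create the quantum numbers of
another jet by itself, which costs one more power of `λ`. -/
theorem gaugeField_order (hs : JetScaling sector χ) (ht : WilsonDirections sector χ τ)
    (hρ : ∀ᶠ l in 𝓝[>] (0 : ℝ), AdmissibleRef sp (χ l) (ρ l))
    (hflavor : FlavorsMatch sp barred sector) (hjet : ∀ i : Fin N, ∃ e, sector e = i)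
    (j : Fin N) (k : DIdx) (S : Finset (Fin n)) :
    OrderGE (fun l =>
      gaugeField g sp (χ l) (ρ l) barred (commonGauge g sp χ ρ sector τ l) j k S)
      (excess sector j S - weight sector S) := by
  unfold excess
  split_ifs with h
  · obtain ⟨i, hij, hS⟩ := h
    obtain ⟨e, he⟩ := hjet i
    simp only [gaugeField_common barred j i]
    refine soft_emission_order hs hρ he hS (fun T hT _ =>
      gaugeField_jet hs ht hρ he T (fun a ha => hS.or_top (hT ha)) j k) (fun l => ?_) _
    by_contra hne
    have h1 := gaugeField_hasFlavor barred (jetGauge_hasFlavor l) (jetGauge_empty l) j k _ hne j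
    rw [hflavor.1 i j, if_neg hij.symm, Pi.single_eq_same] at h1
    unfold opCharge at h1
    split_ifs at h1
    all_goals norm_num at h1
  · rcases S.eq_empty_or_nonempty with rfl | hne
    · simp only [gaugeField_empty]
      exact OrderGE.zero
    by_cases h0 : (touchedJets sector S).card = 0
    · have hsoft : ∀ a ∈ S, sector a = ⊤ := by
        intro a ha
        by_contra hat
        obtain ⟨i, hi⟩ := WithTop.ne_top_iff_exists.1 hat
        rw [Finset.card_eq_zero] at h0
        have : i ∈ touchedJets sector S := mem_touchedJets.2 ⟨a, ha, hi.symm⟩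
        rw [h0] at this
        exact absurd this (Finset.notMem_empty _)
      rw [h0]
      exact ((soft_common (g := g) (τ := τ) hs hρ hne hsoft).gaugeField j k).mono (by
        push_cast
        omega)
    · rw [max_eq_right (by exact_mod_cast Nat.one_le_iff_ne_zero.2 h0)]
      exact (common_fieldBound hs ht hρ S hne).gaugeField j k

/-- The factorized form of the `j`-th field: it creates the `j`-th jet, and its soft Wilson line the
soft particles. -/
noncomputable def factorField (g : ℝ) (sp : Fin n → Species N) (χ ρ : ℝ → Fin n → Weyl)
    (barred : Fin N → Bool) (sector : Fin n → WithTop (Fin N)) (τ : ℝ → Fin N → Weyl) (j : Fin N)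
    (k : DIdx) (l : ℝ) : FieldAlg sp :=
  FieldAlg.single (sectorSet sector j)
    (gaugeField g sp (χ l) (ρ l) barred (commonGauge g sp χ ρ sector τ l) j k (sectorSet sector j)) *
      softWilson g sp χ ρ sector τ (-((opCharge barred j : ℂ) * g)) j l

theorem isDressedJet_of_factorField {j : Fin N} {k : DIdx} {S : Finset (Fin n)} {l : ℝ}
    (h : factorField g sp χ ρ barred sector τ j k l S ≠ 0) : IsDressedJet sector j S := by
  rw [factorField, FieldAlg.single_mul_apply] at h
  split_ifs at h with hsub
  · intro a hat
    refine ⟨fun ha => ?_, fun ha => hsub (mem_sectorSet.2 ha)⟩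
    by_contra hja
    refine h ?_
    rw [softWilson_of_coll (Finset.mem_sdiff.2 ⟨ha, fun h => hja (mem_sectorSet.1 h)⟩) hat,
      mul_zero]
  · exact absurd rfl h

theorem factorField_order (hs : JetScaling sector χ) (ht : WilsonDirections sector χ τ)
    (hρ : ∀ᶠ l in 𝓝[>] (0 : ℝ), AdmissibleRef sp (χ l) (ρ l))
    (hflavor : FlavorsMatch sp barred sector) (hjet : ∀ i : Fin N, ∃ e, sector e = i)
    (j : Fin N) (k : DIdx) (S : Finset (Fin n)) :
    OrderGE (fun l => factorField g sp χ ρ barred sector τ j k l S)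
      (excess sector j S - weight sector S) := by
  by_cases hS : IsDressedJet sector j S
  · obtain ⟨e, he⟩ := hjet j
    have hsub : sectorSet sector j ⊆ S := fun a ha => by
      have ha := mem_sectorSet.1 ha
      exact (hS a (by rw [ha]; exact WithTop.coe_ne_top)).2 ha
    have hJ : IsDressedJet sector j (sectorSet sector j) := fun a _ => mem_sectorSet
    have h1 := gaugeField_order (g := g) hs ht hρ hflavor hjet j k (sectorSet sector j)
    rw [excess_eq_one hJ he] at h1
    have h2 := softWilson_order (g := g) (sp := sp) (τ := τ) hs hρ he (-((opCharge barred j : ℂ) * g))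
      (S \ sectorSet sector j)
    have h3 := weight_sdiff_add sector hsub
    rw [excess_eq_one hS he]
    simp only [factorField, FieldAlg.single_mul_apply, if_pos hsub]
    exact ((h1.const_mul _).mul h2).mono (by omega)
  · refine OrderGE.zero.congr' (Eventually.of_forall fun l => ?_)
    by_contra h
    exact hS (isDressedJet_of_factorField h)

/-- On collinear states the common gauge and that of the jet agree. -/
theorem gaugeField_common_of_coll {S : Finset (Fin n)} (hS : ∀ a ∈ S, sector a ≠ ⊤) (j : Fin N)
    (k : DIdx) (l : ℝ) :
    gaugeField g sp (χ l) (ρ l) barred (commonGauge g sp χ ρ sector τ l) j k S =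
      gaugeField g sp (χ l) (ρ l) barred (jetGauge g sp χ ρ sector τ i l) j k S := by
  rw [gaugeField_common barred j i]
  conv_rhs => rw [← mul_one (gaugeField g sp (χ l) (ρ l) barred _ j k)]
  refine FieldAlg.mul_congr (fun _ _ => rfl) fun T hT => ?_
  rw [FieldAlg.one_apply]
  split_ifs with h
  · rw [h, softWilson_empty]
  · obtain ⟨a, ha⟩ := Finset.nonempty_iff_ne_empty.2 h
    exact softWilson_of_coll ha (hS a (hT ha)) _ _

/-- Factorization of the `j`-th field in its dressed jet. -/
theorem gaugeField_sub_factorField (hs : JetScaling sector χ) (ht : WilsonDirections sector χ τ)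
    (hρ : ∀ᶠ l in 𝓝[>] (0 : ℝ), AdmissibleRef sp (χ l) (ρ l))
    {j : Fin N} (he : sector e = j) (k : DIdx) {S : Finset (Fin n)}
    (hS : IsDressedJet sector j S) :
    OrderGE (fun l =>
      gaugeField g sp (χ l) (ρ l) barred (commonGauge g sp χ ρ sector τ l) j k S -
        factorField g sp χ ρ barred sector τ j k l S) (2 - weight sector S) := by
  have hcoll : ∀ a ∈ sectorSet sector (j : WithTop (Fin N)), sector a ≠ ⊤ := fun a ha => by
    rw [mem_sectorSet.1 ha]; exact WithTop.coe_ne_top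
  refine (soft_emission_order (g := g) (τ := τ) hs hρ he hS (F := fun l =>
    gaugeField g sp (χ l) (ρ l) barred (jetGauge g sp χ ρ sector τ j l) j k -
      FieldAlg.single (sectorSet sector j) (gaugeField g sp (χ l) (ρ l) barred
        (commonGauge g sp χ ρ sector τ l) j k (sectorSet sector j))) (fun T hT hTj => ?_)
      (fun l => ?_) (-((opCharge barred j : ℂ) * g))).congr' (Eventually.of_forall fun l => ?_)
  · simp only [FieldAlg.sub_apply, FieldAlg.single_apply, if_neg hTj, sub_zero]
    exact gaugeField_jet hs ht hρ he T (fun a ha => hS.or_top (hT ha)) j k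
  · rw [FieldAlg.sub_apply, FieldAlg.single_apply, if_pos rfl,
      gaugeField_common_of_coll hcoll j k (i := j), sub_self]
  · rw [sub_mul, FieldAlg.sub_apply, ← gaugeField_common, factorField]

end

/-! ### Ordered products -/

namespace FieldAlg

variable {sp : Fin n → Species N} {m : ℕ}

/-- The sets `P j` form a partition of `S`, with empty parts allowed. -/
def IsPartition (P : Fin m → Finset (Fin n)) (S : Finset (Fin n)) : Prop :=
  (∀ j, P j ⊆ S) ∧ ∀ a ∈ S, ∃! j, a ∈ P j

theorem IsPartition.cons {T S : Finset (Fin n)} (hT : T ⊆ S) {P : Fin m → Finset (Fin n)}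
    (hP : IsPartition P (S \ T)) : IsPartition (Fin.cons T P : Fin (m + 1) → Finset (Fin n)) S := by
  refine ⟨fun j => ?_, fun a ha => ?_⟩
  · refine Fin.cases hT (fun j => ?_) j
    exact (hP.1 j).trans Finset.sdiff_subset
  · by_cases haT : a ∈ T
    · refine ⟨0, haT, fun j => ?_⟩
      refine Fin.cases (fun _ => rfl) (fun j hj => ?_) j
      exact absurd haT (Finset.mem_sdiff.1 (hP.1 j hj)).2
    · obtain ⟨j, hj, hu⟩ := hP.2 a (Finset.mem_sdiff.2 ⟨ha, haT⟩)
      refine ⟨j.succ, hj, fun j' => ?_⟩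
      refine Fin.cases (fun h => absurd h haT) (fun j' h => ?_) j'
      rw [hu j' h]

/-- Two ordered products agree up to a given order if the products of the matrix elements of their
factors do, for each distribution of the particles. -/
theorem orderGE_prod_sub (F G : Fin m → ℝ → FieldAlg sp) (u v : ℝ → ℂ) (S : Finset (Fin n)) {z : ℤ}
    (h : ∀ P, IsPartition P S →
      OrderGE (fun l => u l * ∏ j, F j l (P j) - v l * ∏ j, G j l (P j)) z) :
    OrderGE (fun l => u l * (List.ofFn fun j => F j l).prod S -
      v l * (List.ofFn fun j => G j l).prod S) z := by
  induction m generalizing u v S with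
  | zero =>
    simp only [List.ofFn_zero, List.prod_nil, one_apply]
    split_ifs with hS
    · have := h Fin.elim0 ⟨fun j => j.elim0, fun a ha => by simp [hS] at ha⟩
      simpa using this
    · simpa using OrderGE.zero
  | succ m ih =>
    have h1 : ∀ T ⊆ S, OrderGE (fun l => fermiSign sp T (S \ T) *
        ((u l * F 0 l T) * (List.ofFn fun j : Fin m => F j.succ l).prod (S \ T) -
          (v l * G 0 l T) * (List.ofFn fun j : Fin m => G j.succ l).prod (S \ T))) z := by
      intro T hT
      refine (ih (fun j => F j.succ) (fun j => G j.succ) (fun l => u l * F 0 l T)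
        (fun l => v l * G 0 l T) (S \ T) fun P hP => ?_).const_mul _
      refine (h _ (hP.cons hT)).congr' (Eventually.of_forall fun l => ?_)
      simp only [Fin.prod_univ_succ, Fin.cons_zero, Fin.cons_succ, mul_assoc]
    refine (OrderGE.sum (s := S.powerset) fun T hT => h1 T (Finset.mem_powerset.1 hT)).congr'
      (Eventually.of_forall fun l => ?_)
    simp only [List.ofFn_succ, List.prod_cons, mul_apply, Finset.mul_sum]
    rw [← Finset.sum_sub_distrib]
    refine Finset.sum_congr rfl fun T _ => ?_
    ring

theorem prod_congr {F G : Fin m → FieldAlg sp} {S : Finset (Fin n)}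
    (h : ∀ j, ∀ T ⊆ S, F j T = G j T) : ∀ T ⊆ S, (List.ofFn F).prod T = (List.ofFn G).prod T := by
  induction m with
  | zero => intro T _; simp only [List.ofFn_zero]
  | succ m ih =>
    intro T hT
    simp only [List.ofFn_succ, List.prod_cons]
    exact mul_congr (fun U hU => h 0 U (hU.trans hT))
      fun U hU => ih (fun j => h j.succ) U (hU.trans hT)

theorem prod_mul_of_isEven (F : Fin m → FieldAlg sp) {E : Fin m → FieldAlg sp}
    (h : ∀ j, (E j).IsEven) :
    (List.ofFn fun j => F j * E j).prod = (List.ofFn F).prod * (List.ofFn E).prod := by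
  induction m with
  | zero => simp
  | succ m ih =>
    simp only [List.ofFn_succ, List.prod_cons]
    rw [ih (fun j => F j.succ) fun j => h j.succ, mul_assoc, mul_assoc, ← mul_assoc (E 0),
      ((h 0).commute _).eq, mul_assoc]

theorem prod_exp_smul {Λ : FieldAlg sp} (h : Λ.IsEven) (h0 : Λ ∅ = 0) (c : Fin m → ℂ) :
    (List.ofFn fun j => IsNilpotent.exp (c j • Λ)).prod = IsNilpotent.exp ((∑ j, c j) • Λ) := by
  induction m with
  | zero => simp
  | succ m ih =>
    simp only [List.ofFn_succ, List.prod_cons, Fin.sum_univ_succ]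
    rw [ih, add_smul, IsNilpotent.exp_add_of_commute ((h.smul _).commute _)
      (isNilpotent (smul_apply_empty sp h0 _)) (isNilpotent (smul_apply_empty sp h0 _))]

theorem prod_single {U : Fin m → Finset (Fin n)} (b : Fin m → ℂ)
    (hU : ∀ i j, i < j → ∀ a ∈ U i, ∀ a' ∈ U j, a < a') :
    (List.ofFn fun j => (single (U j) (b j) : FieldAlg sp)).prod =
      single (Finset.univ.biUnion U) (∏ j, b j) := by
  induction m with
  | zero =>
    ext S
    simp [one_apply, single_apply]
  | succ m ih =>
    simp only [List.ofFn_succ, List.prod_cons]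
    rw [ih (fun j => b j.succ) fun i j hij => hU i.succ j.succ (Fin.succ_lt_succ_iff.2 hij)]
    ext S
    set V := Finset.univ.biUnion fun j : Fin m => U j.succ with hV
    have hlt : ∀ a ∈ U 0, ∀ a' ∈ V, a < a' := by
      intro a ha a' ha'
      obtain ⟨j, -, hj⟩ := Finset.mem_biUnion.1 ha'
      exact hU 0 j.succ (Fin.succ_pos j) a ha a' hj
    have hdisj : Disjoint (U 0) V := Finset.disjoint_left.2 fun a ha ha' =>
      lt_irrefl a (hlt a ha a ha')
    have hun : Finset.univ.biUnion U = U 0 ∪ V := by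
      ext a
      simp [hV, Fin.exists_fin_succ]
    rw [single_mul_apply, hun, single_apply, single_apply, Fin.prod_univ_succ]
    by_cases hS : S = U 0 ∪ V
    · subst hS
      have e : (U 0 ∪ V) \ U 0 = V := by
        rw [Finset.union_sdiff_left, Finset.sdiff_eq_self_of_disjoint hdisj.symm]
      rw [if_pos Finset.subset_union_left, if_pos e, if_pos rfl, e, fermiSign_of_lt sp hlt, one_mul]
    · rw [if_neg hS]
      split_ifs with h1 h2
      · exact absurd (by rw [← h2, Finset.union_sdiff_of_subset h1]) hS
      · rw [mul_zero]
      · rfl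

end FieldAlg

theorem OrderGE.prod_sub {ι : Type*} {s : Finset ι} {F G : ι → ℝ → ℂ} {w : ι → ℤ}
    (hF : ∀ i ∈ s, OrderGE (F i) (w i)) (hG : ∀ i ∈ s, OrderGE (G i) (w i))
    (h : ∀ i ∈ s, OrderGE (fun l => F i l - G i l) (w i + 1)) :
    OrderGE (fun l => ∏ i ∈ s, F i l - ∏ i ∈ s, G i l) (∑ i ∈ s, w i + 1) := by
  classical
  induction s using Finset.induction_on with
  | empty => simpa using OrderGE.zero
  | insert a s ha ih =>
    have hs : ∀ i ∈ s, i ∈ insert a s := fun i hi => Finset.mem_insert_of_mem hi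
    have ha' := Finset.mem_insert_self a s
    have h1 := (h a ha').mul (OrderGE.prod fun i hi => hF i (hs i hi))
    have h2 := (hG a ha').mul (ih (fun i hi => hF i (hs i hi)) (fun i hi => hG i (hs i hi))
      fun i hi => h i (hs i hi))
    rw [Finset.sum_insert ha]
    refine ((h1.mono (by omega)).add (h2.mono (by omega))).congr' (Eventually.of_forall fun l => ?_)
    rw [Finset.prod_insert ha, Finset.prod_insert ha]
    ring

/-! ### The leading distributions of the particles -/

section

variable {sector : Fin n → WithTop (Fin N)}

theorem one_le_excess (j : Fin N) (S : Finset (Fin n)) : 1 ≤ excess sector j S := by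
  unfold excess
  split_ifs
  · norm_num
  · exact le_max_left _ _

/-- The power counting of a product of fields is saturated only if each field creates its own
jet, dressed with soft particles. -/
theorem isDressedJet_or_excess (hjet : ∀ i : Fin N, ∃ e, sector e = i)
    {P : Fin N → Finset (Fin n)} (hP : ∀ a, ∃! j, a ∈ P j) :
    (∀ j, IsDressedJet sector j (P j)) ∨ (N : ℤ) + 1 ≤ ∑ j, excess sector j (P j) := by
  by_contra! hcon
  obtain ⟨hnot, hlt⟩ := hcon
  obtain ⟨j₀, hj₀⟩ := hnot
  have h1 : ∀ j, excess sector j (P j) = 1 := by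
    have h0 : ∀ j ∈ Finset.univ, 0 ≤ excess sector j (P j) - 1 := fun j _ => by
      have := one_le_excess (sector := sector) j (P j)
      omega
    have hsum : ∑ j, (excess sector j (P j) - 1) = 0 := by
      refine le_antisymm ?_ (Finset.sum_nonneg h0)
      rw [Finset.sum_sub_distrib]
      simp only [Finset.sum_const, Finset.card_univ, Fintype.card_fin, nsmul_eq_mul, mul_one]
      omega
    intro j
    have := (Finset.sum_eq_zero_iff_of_nonneg h0).1 hsum j (Finset.mem_univ j)
    omega
  have h2 : ∀ j, (∀ i, IsDressedJet sector i (P j) → i = j) ∧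
      ∀ i ∈ touchedJets sector (P j), ∀ i' ∈ touchedJets sector (P j), i = i' := by
    intro j
    have h := h1 j
    unfold excess at h
    split_ifs at h with hd
    · norm_num at h
    refine ⟨fun i hi => by_contra fun hij => hd ⟨i, hij, hi⟩, ?_⟩
    have hc : (touchedJets sector (P j)).card ≤ 1 := by
      have := le_max_right (1 : ℤ) (touchedJets sector (P j)).card
      rw [h] at this
      exact_mod_cast this
    exact fun i hi i' hi' => Finset.card_le_one.1 hc i hi i' hi'
  choose e he using hjet
  choose c hc using fun a => (hP a).exists
  have hu : ∀ a j, a ∈ P j → j = c a := fun a j h => (hP a).unique h (hc a)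
  -- no field touches two jets, so jets are assigned to fields injectively, hence bijectively; a field
  -- that touches a single jet, and shares it with no other field, creates all of it
  have hinj : Function.Injective fun i => c (e i) := by
    intro i i' h
    have h : c (e i) = c (e i') := h
    refine (h2 (c (e i))).2 i (mem_touchedJets.2 ⟨e i, hc _, he i⟩) i'
      (mem_touchedJets.2 ⟨e i', ?_, he i'⟩)
    rw [h]
    exact hc _
  have hsurj := Finite.injective_iff_surjective.1 hinj
  obtain ⟨i, hi⟩ := hsurj j₀
  have hi : c (e i) = j₀ := hi
  have hD : IsDressedJet sector i (P j₀) := by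
    have hmem : i ∈ touchedJets sector (P j₀) := mem_touchedJets.2 ⟨e i, hi ▸ hc _, he i⟩
    intro a hat
    obtain ⟨i', hi'⟩ := WithTop.ne_top_iff_exists.1 hat
    constructor
    · intro ha
      rw [← hi', (h2 j₀).2 i' (mem_touchedJets.2 ⟨a, ha, hi'.symm⟩) i hmem]
    · intro ha
      obtain ⟨i'', h''⟩ := hsurj (c a)
      have h'' : c (e i'') = c a := h''
      have : i'' = i := (h2 (c a)).2 i'' (mem_touchedJets.2 ⟨e i'', h'' ▸ hc _, he i''⟩) i
        (mem_touchedJets.2 ⟨a, hc a, ha⟩)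
      rw [← hi, ← this, h'']
      exact hc a
  exact hj₀ ((h2 j₀).1 i hD ▸ hD)

theorem sum_weight {P : Fin N → Finset (Fin n)} (hP : ∀ a, ∃! j, a ∈ P j) :
    ∑ j, weight sector (P j) = weight sector Finset.univ := by
  choose c hc using fun a => (hP a).exists
  have h : ∀ j, P j = Finset.univ.filter fun a => c a = j := by
    intro j
    ext a
    simp only [Finset.mem_filter, Finset.mem_univ, true_and]
    constructor
    · exact fun h => (hP a).unique (hc a) h
    · rintro rfl; exact hc a
  simp only [weight, h]
  exact Finset.sum_fiberwise _ _ _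

theorem leadingExponent_eq (hjet : ∀ i : Fin N, ∃ e, sector e = i) :
    (leadingExponent sector : ℤ) = weight sector Finset.univ - N := by
  have h1 : weight sector Finset.univ =
      ∑ s, ∑ a ∈ sectorSet sector s, if sector a = ⊤ then 2 else 1 :=
    (Finset.sum_fiberwise _ _ _).symm
  have h2 : ∀ s, (∑ a ∈ sectorSet sector s, if sector a = ⊤ then (2 : ℤ) else 1) =
      if s = ⊤ then 2 * (sectorSet sector s).card else (sectorSet sector s).card := by
    intro s
    rw [Finset.sum_congr rfl fun a ha => by rw [mem_sectorSet.1 ha]]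
    split_ifs <;> simp [mul_comm]
  have h3 : ∀ f : WithTop (Fin N) → ℤ, ∑ s, f s = f ⊤ + ∑ j : Fin N, f j := fun f =>
    Fintype.sum_option f
  rw [h1, Finset.sum_congr rfl fun s _ => h2 s, h3, if_pos rfl, leadingExponent]
  have h4 : ∀ j : Fin N, (((sectorSet sector (j : WithTop (Fin N))).card - 1 : ℕ) : ℤ) =
      (sectorSet sector (j : WithTop (Fin N))).card - 1 := by
    intro j
    obtain ⟨e, he⟩ := hjet j
    have : 0 < (sectorSet sector (j : WithTop (Fin N))).card :=
      Finset.card_pos.2 ⟨e, mem_sectorSet.2 he⟩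
    omega
  push_cast
  simp only [h4, WithTop.coe_ne_top, if_false, Finset.sum_sub_distrib]
  simp
  ring

end

/-! ### Factorization of the matrix element -/

section

variable {g : ℝ} {sp : Fin n → Species N} {χ ρ : ℝ → Fin n → Weyl}
  {τ : ℝ → Fin N → Weyl} {sector : Fin n → WithTop (Fin N)}
  {barred : Fin N → Bool}

/-- The `j`-th field as an element of the algebra of operators. -/
noncomputable def opFieldEl (g : ℝ) (sp : Fin n → Species N) (χ ρ : Fin n → Weyl)
    (barred : Fin N → Bool) (j : Fin N) (k : DIdx) : FieldAlg sp := opField g sp χ ρ barred j k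

/-- A Wilson line as an element of the algebra of operators. -/
noncomputable def wilsonEl (g : ℝ) (sp : Fin n → Species N) (χ ρ : Fin n → Weyl) (κ : ℤ)
    (m : Vec) : FieldAlg sp := wilson g sp χ ρ κ m

theorem gaugeField_eq_opField_mul {χ ρ : Fin n → Weyl} {Λ : FieldAlg sp} (h : Λ.IsEven)
    (h0 : Λ ∅ = 0) (j : Fin N) (k : DIdx) : gaugeField g sp χ ρ barred Λ j k =
      opFieldEl g sp χ ρ barred j k *
        IsNilpotent.exp (-((opCharge barred j : ℂ) * g) • Λ) := by
  have he := (h.smul (g : ℂ)).exp (smul_apply_empty sp h0 _)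
  unfold gaugeField opCharge
  split_ifs with hb
  · have e : opFieldEl g sp χ ρ barred j k = barEl g sp χ ρ j k :=
      funext fun S => if_pos hb
    rw [e, gaugeBar]
    simp
  · have e : opFieldEl g sp χ ρ barred j k = psiEl g sp χ ρ j k :=
      funext fun S => if_neg hb
    rw [e, gaugePsi, (he.commute _).eq]
    simp

/-- The matrix elements of an operator of total charge zero are gauge invariant. -/
theorem prod_opField_eq (hgauge : ∑ j, opCharge barred j = 0) {χ ρ : Fin n → Weyl}
    {Λ : FieldAlg sp} (h : Λ.IsEven) (h0 : Λ ∅ = 0) (α : Fin N → DIdx) :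
    MatEl.prod sp (fun j => opField g sp χ ρ barred j (α j)) =
      (List.ofFn fun j => gaugeField g sp χ ρ barred Λ j (α j)).prod := by
  change (List.ofFn fun j => opFieldEl g sp χ ρ barred j (α j)).prod = _
  simp only [gaugeField_eq_opField_mul h h0]
  rw [FieldAlg.prod_mul_of_isEven _ fun j => (h.smul _).exp (smul_apply_empty sp h0 _),
    FieldAlg.prod_exp_smul h h0, Finset.sum_neg_distrib, ← Finset.sum_mul,
    ← Int.cast_sum, hgauge]
  simp

/-- A Wilson line is the exponential of the gauge parameter of the axial gauge. -/
theorem wilson_apply_eq {χ ρ : Fin n → Weyl} {Λ : FieldAlg sp} (h0 : Λ ∅ = 0) (κ : ℤ) (m : Vec)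
    (S : Finset (Fin n)) (h : ∀ T ⊆ S, T.Nonempty → Λ T =
      -(mdot m (tree g sp χ ρ T).pho / mdot m (totalMomentum χ T))) :
    wilsonEl g sp χ ρ κ m S = IsNilpotent.exp (((κ : ℂ) * g) • Λ) S := by
  set L : FieldAlg sp := fun S => Complex.I * κ * g * mdot m (tree g sp χ ρ S).pho *
    (Complex.I / mdot m (totalMomentum χ S)) with hL
  have hL0 : L ∅ = 0 := by
    rw [hL]
    simp only [tree_empty, mdot_zero_right, mul_zero, zero_mul]
  have h1 : wilsonEl g sp χ ρ κ m = IsNilpotent.exp L := FieldAlg.matEl_exp_eq hL0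
  rw [h1]
  refine FieldAlg.exp_congr hL0 fun T hT => ?_
  rcases T.eq_empty_or_nonempty with rfl | hne
  · rw [hL0, smul_apply_empty sp h0]
  · rw [FieldAlg.smul_apply, h T hT hne, hL]
    linear_combination (κ * g * mdot m (tree g sp χ ρ T).pho / mdot m (totalMomentum χ T)) *
      Complex.I_mul_I

/-- A jet created by its field together with a Wilson line is a matrix element of the field in
light-cone gauge. -/
theorem mul_wilson_jet (j : Fin N) (k : DIdx) (l : ℝ) :
    MatEl.mul sp (opField g sp (χ l) (ρ l) barred j k)
      (wilson g sp (χ l) (ρ l) (-opCharge barred j) (momentum (τ l j))) (sectorSet sector j) =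
    gaugeField g sp (χ l) (ρ l) barred (commonGauge g sp χ ρ sector τ l) j k
      (sectorSet sector j) := by
  rw [gaugeField_eq_opField_mul (commonGauge_hasFlavor l).isEven (commonGauge_empty l)]
  refine FieldAlg.mul_congr (F := opFieldEl g sp (χ l) (ρ l) barred j k)
    (G := wilsonEl g sp (χ l) (ρ l) (-opCharge barred j) (momentum (τ l j)))
    (fun _ _ => rfl) fun T hT => ?_
  rw [wilson_apply_eq (commonGauge_empty (τ := τ) (sector := sector) l) _ _ T fun U hU hne => ?_]
  · push_cast
    rw [neg_mul]
  · rw [commonGauge, gaugeParam_of_subset g sp _ _ _ hne (subset_sectorSet.1 (hU.trans hT)),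
      sectorDir_coe]

/-- The soft Wilson lines in an arbitrary gauge and in the common gauge. -/
theorem prod_wilson_soft (hgauge : ∑ j, opCharge barred j = 0) (l : ℝ) :
    MatEl.prod sp (fun j => wilson g sp (χ l) (ρ l) (opCharge barred j)
      (jetDirection sector (χ l) j)) (sectorSet sector ⊤) =
    (List.ofFn fun j => softWilson g sp χ ρ sector τ (-((opCharge barred j : ℂ) * g)) j l).prod
      (sectorSet sector ⊤) := by
  have hc := (commonGauge_hasFlavor (g := g) (sp := sp) (χ := χ) (ρ := ρ) (τ := τ)
    (sector := sector) l).isEven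
  have hc0 := commonGauge_empty (g := g) (sp := sp) (χ := χ) (ρ := ρ) (τ := τ)
    (sector := sector) l
  have h1 : ∀ j, IsNilpotent.exp (((opCharge barred j : ℂ) * g) •
      jetGauge g sp χ ρ sector τ j l) =
      softWilson g sp χ ρ sector τ (-((opCharge barred j : ℂ) * g)) j l *
        IsNilpotent.exp (((opCharge barred j : ℂ) * g) • commonGauge g sp χ ρ sector τ l) := by
    intro j
    have hj := (jetGauge_hasFlavor (g := g) (sp := sp) (χ := χ) (ρ := ρ) (τ := τ)
      (sector := sector) (i := j) l).isEven
    rw [softWilson, commonGauge_eq_add j, exp_smul_add sp hj (jetGauge_empty l)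
      (softShift_empty l), (((hj.smul _).exp (smul_apply_empty sp (jetGauge_empty l) _)).commute
      _).eq, ← mul_assoc, neg_smul, IsNilpotent.exp_neg_mul_exp_self
      (FieldAlg.isNilpotent (smul_apply_empty sp (softShift_empty l) _)), one_mul]
  change (List.ofFn fun j => wilsonEl g sp (χ l) (ρ l) (opCharge barred j)
    (jetDirection sector (χ l) j)).prod _ = _
  rw [FieldAlg.prod_congr (G := fun j => softWilson g sp χ ρ sector τ
    (-((opCharge barred j : ℂ) * g)) j l * IsNilpotent.exp (((opCharge barred j : ℂ) * g) •
      commonGauge g sp χ ρ sector τ l)) (S := sectorSet sector ⊤) (fun j T hT => ?_) _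
    subset_rfl, FieldAlg.prod_mul_of_isEven _ fun j => (hc.smul _).exp (smul_apply_empty sp hc0 _),
    FieldAlg.prod_exp_smul hc hc0, ← Finset.sum_mul, ← Int.cast_sum, hgauge]
  · simp
  · rw [← h1, wilson_apply_eq (jetGauge_empty (τ := τ) (sector := sector) (i := j) l) _ _ T
      fun U hU hne => ?_]
    rw [jetGauge, gaugeParam_of_subset g sp _ _ _ hne (subset_sectorSet.1 (hU.trans hT)),
      sectorDir_top]

/-- The factorized expression is the product of the factorized fields. The particles are listed
sector by sector, so there are no signs. -/
theorem prod_factorField (hsector : Monotone sector) (α : Fin N → DIdx) (l : ℝ) :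
    (List.ofFn fun j => factorField g sp χ ρ barred sector τ j (α j) l).prod Finset.univ =
      (∏ j, gaugeField g sp (χ l) (ρ l) barred (commonGauge g sp χ ρ sector τ l) j (α j)
        (sectorSet sector j)) *
      (List.ofFn fun j => softWilson g sp χ ρ sector τ (-((opCharge barred j : ℂ) * g)) j l).prod
        (sectorSet sector ⊤) := by
  have hlt : ∀ {a b : Fin n}, sector a < sector b → a < b := fun h => hsector.reflect_lt h
  unfold factorField
  rw [FieldAlg.prod_mul_of_isEven _ fun j => softWilson_isEven _ l, FieldAlg.prod_single,
    FieldAlg.single_mul_apply, if_pos (Finset.subset_univ _)]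
  · have h1 : Finset.univ \ (Finset.univ.biUnion fun j : Fin N =>
        sectorSet sector (j : WithTop (Fin N))) = sectorSet sector ⊤ := by
      ext a
      simp only [Finset.mem_sdiff, Finset.mem_univ, true_and, Finset.mem_biUnion, mem_sectorSet]
      constructor
      · intro h
        by_contra hat
        obtain ⟨j, hj⟩ := WithTop.ne_top_iff_exists.1 hat
        exact h ⟨j, hj.symm⟩
      · rintro h ⟨j, hj⟩
        rw [h] at hj
        exact WithTop.top_ne_coe hj
    rw [h1, fermiSign_of_lt, one_mul]
    intro a ha b hb
    obtain ⟨j, -, hj⟩ := Finset.mem_biUnion.1 ha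
    refine hlt ?_
    rw [mem_sectorSet.1 hj, mem_sectorSet.1 hb]
    exact WithTop.coe_lt_top j
  · intro i j hij a ha b hb
    refine hlt ?_
    rw [mem_sectorSet.1 ha, mem_sectorSet.1 hb]
    exact WithTop.coe_lt_coe.2 hij

theorem OrderGE.isBigO_pow {F : ℝ → ℂ} {m : ℕ} (h : OrderGE F (-m)) :
    F =O[𝓝[>] 0] fun l : ℝ => (l ^ m)⁻¹ := by
  simpa [OrderGE, _root_.zpow_neg] using h

theorem OrderGE.isLittleO_pow {F : ℝ → ℂ} {m : ℕ} (h : OrderGE F (-m + 1)) :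
    F =o[𝓝[>] 0] fun l : ℝ => (l ^ m)⁻¹ := by
  refine IsBigO.trans_isLittleO h ?_
  have h1 : (fun l : ℝ => l) =o[𝓝[>] 0] fun _ => (1 : ℝ) :=
    (isLittleO_one_iff ℝ).2 (tendsto_nhdsWithin_of_tendsto_nhds tendsto_id)
  have h2 := (isBigO_refl (fun l : ℝ => (l ^ m)⁻¹) (𝓝[>] 0)).mul_isLittleO h1
  refine IsLittleO.congr' h2 ?_ (by simp)
  filter_upwards [eventually_pos] with l hl
  rw [zpow_add₀ hl.ne', _root_.zpow_neg, zpow_natCast, _root_.zpow_one]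

theorem exists_of_flavorsMatch (h : FlavorsMatch sp barred sector) (i : Fin N) :
    ∃ e, sector e = i := by
  by_contra! hno
  have h1 := h.1 i i
  have h2 : sectorSet sector (i : WithTop (Fin N)) = ∅ :=
    Finset.eq_empty_iff_forall_notMem.2 fun a ha => hno a (mem_sectorSet.1 ha)
  rw [h2, Finset.sum_empty, if_pos rfl] at h1
  unfold opCharge at h1
  split_ifs at h1
  all_goals norm_num at h1

/-- Soft-collinear factorization: both sides are products of `N` fields in the common gauge, summed
over the distributions of the particles. -/
theorem agreeAtLeadingPower (hgauge : ∑ j, opCharge barred j = 0)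
    (Γ : (Fin N → DIdx) → ℂ) (hsector : Monotone sector) (hflavor : FlavorsMatch sp barred sector)
    (hs : JetScaling sector χ) (ht : WilsonDirections sector χ τ)
    (hρ : ∀ᶠ l in 𝓝[>] (0 : ℝ), AdmissibleRef sp (χ l) (ρ l)) :
    AgreeAtLeadingPower (leadingExponent sector)
      (fun l => fullMatrixElement g sp (χ l) (ρ l) barred Γ)
      (fun l => factorizedMatrixElement g sp (χ l) (ρ l) barred Γ sector
        (fun j => momentum (τ l j))) := by
  have hjet := exists_of_flavorsMatch hflavor
  set F : (Fin N → DIdx) → Fin N → ℝ → FieldAlg sp := fun α j l =>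
    gaugeField g sp (χ l) (ρ l) barred (commonGauge g sp χ ρ sector τ l) j (α j) with hF
  set G : (Fin N → DIdx) → Fin N → ℝ → FieldAlg sp := fun α j l =>
    factorField g sp χ ρ barred sector τ j (α j) l with hG
  have hfull : ∀ l, fullMatrixElement g sp (χ l) (ρ l) barred Γ =
      ∑ α, Γ α * (List.ofFn fun j => F α j l).prod Finset.univ := fun l => by
    unfold fullMatrixElement
    refine Finset.sum_congr rfl fun α _ => ?_
    rw [prod_opField_eq hgauge (commonGauge_hasFlavor (τ := τ) (sector := sector) l).isEven
      (commonGauge_empty l)]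
  have hfact : ∀ l, factorizedMatrixElement g sp (χ l) (ρ l) barred Γ sector
      (fun j => momentum (τ l j)) = ∑ α, Γ α * (List.ofFn fun j => G α j l).prod Finset.univ :=
    fun l => by
      unfold factorizedMatrixElement
      rw [Finset.sum_mul]
      refine Finset.sum_congr rfl fun α _ => ?_
      rw [hG, prod_factorField hsector, prod_wilson_soft (τ := τ) hgauge, mul_assoc]
      simp only [mul_wilson_jet]
  have hFo : ∀ α j S, OrderGE (fun l => F α j l S) (excess sector j S - weight sector S) :=
    fun α j S => gaugeField_order hs ht hρ hflavor hjet j (α j) S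
  have hGo : ∀ α j S, OrderGE (fun l => G α j l S) (excess sector j S - weight sector S) :=
    fun α j S => factorField_order hs ht hρ hflavor hjet j (α j) S
  have hsum : ∀ P : Fin N → Finset (Fin n), (∀ a, ∃! j, a ∈ P j) →
      ∑ j, (excess sector j (P j) - weight sector (P j)) =
        ∑ j, excess sector j (P j) - N - leadingExponent sector := fun P hP => by
    rw [Finset.sum_sub_distrib, sum_weight hP, leadingExponent_eq hjet]
    ring
  have hN : ∀ P : Fin N → Finset (Fin n), (N : ℤ) ≤ ∑ j, excess sector j (P j) := fun P => by
    have := Finset.card_nsmul_le_sum Finset.univ (fun j => excess sector j (P j)) 1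
      fun j _ => one_le_excess j (P j)
    simpa using this
  have hdiff : ∀ α, OrderGE (fun l => (List.ofFn fun j => F α j l).prod Finset.univ -
      (List.ofFn fun j => G α j l).prod Finset.univ) (-(leadingExponent sector : ℤ) + 1) := by
    intro α
    have h := FieldAlg.orderGE_prod_sub (F α) (G α) (fun _ => 1) (fun _ => 1) Finset.univ
      (z := -(leadingExponent sector : ℤ) + 1) fun P hP => ?_
    · simpa using h
    · have hP' : ∀ a, ∃! j, a ∈ P j := fun a => hP.2 a (Finset.mem_univ a)
      simp only [one_mul]
      -- either every field creates its own dressed jet and factorizes, or both products are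
      -- subleading
      rcases isDressedJet_or_excess hjet hP' with hD | hE
      · refine (OrderGE.prod_sub (fun j _ => hFo α j (P j)) (fun j _ => hGo α j (P j))
          fun j _ => ?_).mono ?_
        · obtain ⟨e, he⟩ := hjet j
          rw [excess_eq_one (hD j) he]
          exact (gaugeField_sub_factorField hs ht hρ he (α j) (hD j)).mono (by omega)
        · rw [hsum P hP']
          have := hN P
          omega
      · refine ((OrderGE.prod fun j _ => hFo α j (P j)).sub
          (OrderGE.prod fun j _ => hGo α j (P j))).mono ?_
        rw [hsum P hP']
        omega
  have hGb : ∀ α, OrderGE (fun l => (List.ofFn fun j => G α j l).prod Finset.univ)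
      (-(leadingExponent sector : ℤ)) := by
    intro α
    have h := FieldAlg.orderGE_prod_sub (G α) (G α) (fun _ => 1) (fun _ => 0) Finset.univ
      (z := -(leadingExponent sector : ℤ)) fun P hP => ?_
    · simpa using h
    · have hP' : ∀ a, ∃! j, a ∈ P j := fun a => hP.2 a (Finset.mem_univ a)
      simp only [one_mul, zero_mul, sub_zero]
      refine (OrderGE.prod fun j _ => hGo α j (P j)).mono ?_
      rw [hsum P hP']
      have := hN P
      omega
  have hd : OrderGE (fun l => fullMatrixElement g sp (χ l) (ρ l) barred Γ -
      factorizedMatrixElement g sp (χ l) (ρ l) barred Γ sector (fun j => momentum (τ l j)))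
      (-(leadingExponent sector : ℤ) + 1) := by
    refine (OrderGE.sum (s := Finset.univ) fun α _ => (hdiff α).const_mul (Γ α)).congr'
      (Eventually.of_forall fun l => ?_)
    rw [hfull, hfact, ← Finset.sum_sub_distrib]
    exact Finset.sum_congr rfl fun α _ => (mul_sub _ _ _).symm
  have hG' : OrderGE (fun l => factorizedMatrixElement g sp (χ l) (ρ l) barred Γ sector
      (fun j => momentum (τ l j))) (-(leadingExponent sector : ℤ)) := by
    simp only [hfact]
    exact OrderGE.sum fun α _ => (hGb α).const_mul (Γ α)
  refine ⟨OrderGE.isBigO_pow ?_, hG'.isBigO_pow, hd.isLittleO_pow⟩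
  refine (hG'.add (hd.mono (by omega))).congr' (Eventually.of_forall fun l => ?_)
  ring

end

/-! ### Emission of one photon from a charged leg -/

theorem slash_mul_slash_add (V W : Vec) :
    slash V * slash W + slash W * slash V = (2 * mdot V W) • (1 : Matrix DIdx DIdx ℂ) := by
  have h := slash_mul_slash_self (V + W)
  rw [slash_add, mdot_add_left, mdot_add_right, mdot_add_right, mdot_comm W V] at h
  have hV := slash_mul_slash_self V
  have hW := slash_mul_slash_self W
  have e : slash V * slash W + slash W * slash V =
      (slash V + slash W) * (slash V + slash W) - slash V * slash V - slash W * slash W := by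
    noncomm_ring
  rw [e, h, hV, hW, ← sub_smul, ← sub_smul]
  congr 1
  ring

theorem fermiSign_of_neutral {sp : Fin n → Species N} (T : Finset (Fin n)) {a : Fin n}
    (ha : (sp a).charge = 0) : fermiSign sp T {a} = 1 ∧ fermiSign sp {a} T = 1 := by
  unfold fermiSign
  constructor
  all_goals
    rw [Finset.filter_false_of_mem, Finset.card_empty, pow_zero]
    rintro ⟨x, y⟩ hx
    rw [Finset.mem_product, Finset.mem_singleton] at hx
    simp_all

theorem sum_powerset_pair {M : Type*} [AddCommMonoid M] {a b : Fin n} (hab : b ≠ a)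
    (f : Finset (Fin n) → M) :
    ∑ T ∈ ({b, a} : Finset (Fin n)).powerset, f T = f ∅ + f {b} + f {a} + f {b, a} := by
  rw [show ({b, a} : Finset (Fin n)) = insert b {a} from rfl,
    Finset.sum_powerset_insert (by simpa using hab), powerset_singleton', Finset.sum_pair
    (Finset.singleton_ne_empty a).symm, Finset.sum_pair (Finset.singleton_ne_empty a).symm]
  simp only [insert_empty_eq]
  abel

section Emission

variable {g : ℝ} {sp : Fin n → Species N} {χ ρ : Fin n → Weyl} {a b : Fin n}

theorem totalMomentum_pair (hab : b ≠ a) (χ : Fin n → Weyl) :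
    totalMomentum χ {b, a} = momentum (χ b) + momentum (χ a) := Finset.sum_pair hab

theorem mdot_totalMomentum_pair (hab : b ≠ a) (χ : Fin n → Weyl) :
    mdot (totalMomentum χ {b, a}) (totalMomentum χ {b, a}) =
      2 * mdot (momentum (χ b)) (momentum (χ a)) := by
  rw [totalMomentum_pair hab, mdot_add_left, mdot_add_right, mdot_add_right, mdot_momentum_self,
    mdot_momentum_self, mdot_comm (momentum (χ a))]
  ring

theorem tree_bar_pair (hab : b ≠ a) (ha : (sp a).charge = 0) (f : Fin N)
    (hb : (externalLeg (sp b) (χ b) (ρ b)).pho = 0) :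
    (tree g sp χ ρ {b, a}).bar f = (-(g : ℂ) / (2 * mdot (momentum (χ b)) (momentum (χ a)))) •
      (((externalLeg (sp b) (χ b) (ρ b)).bar f ᵥ* slash (polOf sp χ ρ a)) ᵥ*
        slash (momentum (χ b) + momentum (χ a))) := by
  have e1 : ({b, a} : Finset (Fin n)) \ {b} = {a} := by ext x; simp; aesop
  have e2 : ({b, a} : Finset (Fin n)) \ {a} = {b} := by ext x; simp; aesop
  rw [tree_bar g sp χ ρ (by rw [Finset.card_pair hab]), mdot_totalMomentum_pair hab,
    totalMomentum_pair hab, sum_powerset_pair hab, Finset.sdiff_self, e1, e2, tree_empty,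
    tree_singleton, tree_singleton, (fermiSign_of_neutral {b} ha).1, hb, slash_zero]
  simp [polOf]

theorem tree_psi_pair (hab : b ≠ a) (ha : (sp a).charge = 0) (f : Fin N)
    (hb : (externalLeg (sp b) (χ b) (ρ b)).pho = 0) :
    (tree g sp χ ρ {b, a}).psi f = ((g : ℂ) / (2 * mdot (momentum (χ b)) (momentum (χ a)))) •
      (slash (momentum (χ b) + momentum (χ a)) *ᵥ (slash (polOf sp χ ρ a) *ᵥ
        (externalLeg (sp b) (χ b) (ρ b)).psi f)) := by
  have e1 : ({b, a} : Finset (Fin n)) \ {b} = {a} := by ext x; simp; aesop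
  have e2 : ({b, a} : Finset (Fin n)) \ {a} = {b} := by ext x; simp; aesop
  rw [tree_psi g sp χ ρ (by rw [Finset.card_pair hab]), mdot_totalMomentum_pair hab,
    totalMomentum_pair hab, sum_powerset_pair hab, Finset.sdiff_self, e1, e2, tree_empty,
    tree_singleton, tree_singleton, (fermiSign_of_neutral {b} ha).2, hb, slash_zero]
  simp [polOf]

theorem uBar_vecMul_slash_slash (c : Bool) (p : Weyl) (V : Vec) :
    (uBar c p ᵥ* slash V) ᵥ* slash (momentum p) = (2 * mdot (momentum p) V) • uBar c p := by
  have h := congrArg (fun M => uBar c p ᵥ* M) (slash_mul_slash_add V (momentum p))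
  simp only [vecMul_add, ← vecMul_vecMul, uBar_vecMul_slash, zero_vecMul, add_zero, vecMul_smul,
    vecMul_one] at h
  rw [h, mdot_comm]

theorem slash_mulVec_slash_uSpinor (c : Bool) (p : Weyl) (V : Vec) :
    slash (momentum p) *ᵥ (slash V *ᵥ uSpinor c p) = (2 * mdot (momentum p) V) • uSpinor c p := by
  have h := congrArg (fun M => M *ᵥ uSpinor c p) (slash_mul_slash_add (momentum p) V)
  simpa only [add_mulVec, ← mulVec_mulVec, slash_mulVec_uSpinor, mulVec_zero, add_zero,
    smul_mulVec, one_mulVec] using h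

/-- Clifford algebra moves `slash p` through `slash ε` onto the wave function, which it annihilates;
the anticommutator `2 p·ε` is the eikonal term. -/
theorem emissionLine_eq (ha : (sp a).charge = 0) (hb : (sp b).charge ≠ 0)
    (hpq : mdot (momentum (χ b)) (momentum (χ a)) ≠ 0) :
    emissionLine g sp χ ρ b a = eikonalTerm g sp χ ρ b a + spinTerm g sp χ ρ b a := by
  have hab : b ≠ a := by rintro rfl; exact hb ha
  unfold emissionLine eikonalTerm spinTerm waveFunction
  cases hsp : sp b with
  | photon h => rw [hsp] at hb; exact absurd rfl hb
  | fermion f c =>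
    simp only [Fields.leg]
    rw [tree_bar_pair hab ha f (by rw [hsp]; rfl), hsp]
    simp only [externalLeg, if_true, slash_add, vecMul_add, uBar_vecMul_slash_slash,
      Species.charge]
    ext i
    simp only [Pi.smul_apply, Pi.add_apply, Pi.neg_apply, smul_eq_mul]
    field_simp
    push_cast
    ring
  | antifermion f c =>
    simp only [Fields.leg]
    rw [tree_psi_pair hab ha f (by rw [hsp]; rfl), hsp]
    simp only [externalLeg, if_true, slash_add, add_mulVec, slash_mulVec_slash_uSpinor,
      Species.charge]
    ext i
    simp only [Pi.smul_apply, Pi.add_apply, smul_eq_mul]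
    field_simp
    push_cast
    ring

theorem slash_momentum_sq (q : Weyl) : slash (momentum q) * slash (momentum q) = 0 := by
  rw [slash_mul_slash_self, mdot_momentum_self, zero_smul]

/-- Polarization vectors of the same helicity differ by a multiple of `q`, which the spin term
annihilates because `q` is lightlike. -/
theorem spinTerm_eq_of_admissible {ρ' : Fin n → Weyl} (ha : (sp a).charge = 0)
    (hρ : AdmissibleRef sp χ ρ) (hρ' : AdmissibleRef sp χ ρ') :
    spinTerm g sp χ ρ' b a = spinTerm g sp χ ρ b a := by
  cases hspa : sp a with
  | fermion f c => rw [hspa] at ha; exact absurd ha (by norm_num [Species.charge])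
  | antifermion f c => rw [hspa] at ha; exact absurd ha (by norm_num [Species.charge])
  | photon h =>
    obtain ⟨c, hc⟩ := pol_eq_add_momentum h (hρ a ha) (hρ' a ha)
    have hpol : polOf sp χ ρ' a = polOf sp χ ρ a + c • momentum (χ a) := by
      simp only [polOf, hspa, externalLeg, hc]
    unfold spinTerm waveFunction
    rw [hpol, slash_add, slash_smul]
    cases sp b with
    | photon _ => rfl
    | fermion f c' =>
      simp only [externalLeg, Fields.leg, vecMul_add, vecMul_smul, add_vecMul, smul_vecMul]
      rw [vecMul_vecMul (M := slash (momentum (χ a))), slash_momentum_sq, vecMul_zero, smul_zero,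
        add_zero]
    | antifermion f c' =>
      simp only [externalLeg, Fields.leg, add_mulVec, smul_mulVec, mulVec_add, mulVec_smul]
      rw [mulVec_mulVec _ (slash (momentum (χ a))) (slash (momentum (χ a))), slash_momentum_sq,
        zero_mulVec, smul_zero, add_zero]

theorem uBar_bivec_slash (c : Bool) (p q r s : Weyl) :
    (uBar c p ᵥ* slash (bivec r s)) ᵥ* slash (momentum q) =
      (if c then -(angle p r * star (angle s q)) else -(star (angle p s) * angle r q)) •
        uBar c q := by
  ext j
  rw [slash_eq, slash_eq]
  cases c <;> rcases j with j | j <;> fin_cases j <;>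
    simp [uBar, uSpinor, Matrix.vecMul, dotProduct, gam, sigBar, metric, sig,
      bispinor_momentum, bispinor_bivec, adjugate_fin_two, Fin.sum_univ_two, angle] <;> ring

theorem slash_bivec_uSpinor (c : Bool) (p q r s : Weyl) :
    slash (momentum q) *ᵥ (slash (bivec r s) *ᵥ uSpinor c p) =
      (if c then -(star (angle p s) * angle r q) else -(angle p r * star (angle s q))) •
        uSpinor c q := by
  ext j
  rw [slash_eq, slash_eq]
  cases c <;> rcases j with j | j <;> fin_cases j <;>
    simp [uSpinor, Matrix.mulVec, dotProduct,
      bispinor_momentum, bispinor_bivec, adjugate_fin_two, Fin.sum_univ_two, angle] <;> ring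

/-- The spin-dependent emission has the size of a single spinor product: for one helicity it
vanishes, and for the other one the reference spinor cancels. -/
theorem uBar_pol_slash (c h : Bool) {p q r : Weyl} (hr : angle r q ≠ 0) : ∃ k : ℂ,
    ‖k‖ ≤ Real.sqrt 2 * ‖angle p q‖ ∧
      (uBar c p ᵥ* slash (pol h q r)) ᵥ* slash (momentum q) = k • uBar c q := by
  have hr' : star (angle r q) ≠ 0 := star_ne_zero.2 hr
  cases h <;> cases c <;> simp only [pol, Bool.false_eq_true, if_false, if_true, slash_smul,
    vecMul_smul, smul_vecMul, uBar_bivec_slash, smul_smul, square, angle_self, star_zero, mul_zero,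
    neg_zero]
  · exact ⟨0, by simp, by simp⟩
  · refine ⟨_, le_of_eq ?_, rfl⟩
    have : (Real.sqrt 2 : ℂ) / star (angle r q) * -(angle p q * star (angle r q)) =
        -(Real.sqrt 2 * angle p q) := by field_simp
    rw [this, norm_neg, norm_mul, Complex.norm_real, Real.norm_of_nonneg (Real.sqrt_nonneg 2)]
  · refine ⟨_, le_of_eq ?_, rfl⟩
    have : (Real.sqrt 2 : ℂ) / angle r q * -(star (angle p q) * angle r q) =
        -(Real.sqrt 2 * star (angle p q)) := by field_simp
    rw [this, norm_neg, norm_mul, norm_star, Complex.norm_real,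
      Real.norm_of_nonneg (Real.sqrt_nonneg 2)]
  · exact ⟨0, by simp, by simp⟩

/-- The analogue of `uBar_pol_slash` for antifermions. -/
theorem slash_pol_uSpinor (c h : Bool) {p q r : Weyl} (hr : angle r q ≠ 0) : ∃ k : ℂ,
    ‖k‖ ≤ Real.sqrt 2 * ‖angle p q‖ ∧
      slash (momentum q) *ᵥ (slash (pol h q r) *ᵥ uSpinor c p) = k • uSpinor c q := by
  have hr' : star (angle r q) ≠ 0 := star_ne_zero.2 hr
  cases h <;> cases c <;> simp only [pol, Bool.false_eq_true, if_false, if_true, slash_smul,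
    smul_mulVec, mulVec_smul, slash_bivec_uSpinor, smul_smul, square, angle_self, star_zero,
    mul_zero, neg_zero]
  · refine ⟨_, le_of_eq ?_, rfl⟩
    have : (Real.sqrt 2 : ℂ) / star (angle r q) * -(angle p q * star (angle r q)) =
        -(Real.sqrt 2 * angle p q) := by field_simp
    rw [this, norm_neg, norm_mul, Complex.norm_real, Real.norm_of_nonneg (Real.sqrt_nonneg 2)]
  · exact ⟨0, by simp, by simp⟩
  · exact ⟨0, by simp, by simp⟩
  · refine ⟨_, le_of_eq ?_, rfl⟩
    have : (Real.sqrt 2 : ℂ) / angle r q * -(star (angle p q) * angle r q) =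
        -(Real.sqrt 2 * star (angle p q)) := by field_simp
    rw [this, norm_neg, norm_mul, norm_star, Complex.norm_real,
      Real.norm_of_nonneg (Real.sqrt_nonneg 2)]

theorem norm_emission_le {k w : ℂ} {p q : Weyl} (hk : ‖k‖ ≤ Real.sqrt 2 * ‖angle p q‖) (g : ℝ) :
    ‖(g : ℂ) / (2 * mdot (momentum p) (momentum q)) * (k * w)‖ ≤
      ‖(g * Real.sqrt 2 : ℂ) * ((angle p q)⁻¹ * w)‖ := by
  rw [mdot_momentum_momentum, norm_mul, norm_mul, norm_div, norm_mul, norm_mul, norm_mul, norm_mul,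
    norm_mul, norm_inv, Complex.norm_real, Complex.norm_real, Complex.norm_real]
  rw [Real.norm_of_nonneg (Real.sqrt_nonneg 2), Real.norm_of_nonneg (sq_nonneg ‖angle p q‖)]
  have h2 : ‖(2 : ℂ)‖ * (‖(1 / 2 : ℂ)‖ * ‖angle p q‖ ^ 2) = ‖angle p q‖ ^ 2 := by
    norm_num
    ring
  rw [h2]
  by_cases h : ‖angle p q‖ = 0
  · rw [h]; simp
  calc ‖g‖ / ‖angle p q‖ ^ 2 * (‖k‖ * ‖w‖)
      ≤ ‖g‖ / ‖angle p q‖ ^ 2 * (Real.sqrt 2 * ‖angle p q‖ * ‖w‖) := by gcongr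
    _ = ‖g‖ * Real.sqrt 2 * (‖angle p q‖⁻¹ * ‖w‖) := by field_simp

end Emission

section

variable {g : ℝ} {sp : Fin n → Species N} {χ ρ : ℝ → Fin n → Weyl} {a b : Fin n}

/-- The spin term has the size of the spinor of the photon divided by one spinor product, since `2
p·q` is the square of the modulus of the spinor product. -/
theorem spinTerm_order (ha : (sp a).charge = 0) {y z : ℤ}
    (hang : ExactOrder (fun l => angle (χ l b) (χ l a)) z) (hq : ∀ i, OrderGE (fun l => χ l a i) y)
    (hρ : ∀ᶠ l in 𝓝[>] (0 : ℝ), AdmissibleRef sp (χ l) (ρ l)) (i : DIdx) :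
    OrderGE (fun l => spinTerm g sp (χ l) (ρ l) b a i) (y - z) := by
  cases hspa : sp a with
  | fermion f c => rw [hspa] at ha; exact absurd ha (by norm_num [Species.charge])
  | antifermion f c => rw [hspa] at ha; exact absurd ha (by norm_num [Species.charge])
  | photon h =>
  have hpol : ∀ l, polOf sp (χ l) (ρ l) a = pol h (χ l a) (ρ l a) := fun l => by
    simp only [polOf, hspa, externalLeg]
  unfold spinTerm waveFunction
  cases hspb : sp b with
  | photon h => simpa using OrderGE.zero
  | fermion f c =>
    refine OrderGE.of_norm_le (((hang.inv.mul (OrderGE.uBar c hq i)).const_mul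
      (g * Real.sqrt 2 : ℂ)).mono (by omega)) ?_
    filter_upwards [hρ] with l hl
    obtain ⟨k, hk, hkw⟩ := uBar_pol_slash c h (p := χ l b) (hl a ha)
    simp only [externalLeg, Fields.leg, if_true, hpol, hkw, Pi.smul_apply, Pi.neg_apply,
      smul_eq_mul, mul_neg, norm_neg]
    exact norm_emission_le hk g
  | antifermion f c =>
    refine OrderGE.of_norm_le (((hang.inv.mul (OrderGE.uSpinor c hq i)).const_mul
      (g * Real.sqrt 2 : ℂ)).mono (by omega)) ?_
    filter_upwards [hρ] with l hl
    obtain ⟨k, hk, hkw⟩ := slash_pol_uSpinor c h (p := χ l b) (hl a ha)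
    simp only [externalLeg, Fields.leg, if_true, hpol, hkw, Pi.smul_apply, smul_eq_mul]
    exact norm_emission_le hk g

variable {sector : Fin n → WithTop (Fin N)}

theorem JetScaling.mdot_ne_zero (hs : JetScaling sector χ) (hab : b ≠ a) :
    ∀ᶠ l in 𝓝[>] (0 : ℝ), mdot (momentum (χ l b)) (momentum (χ l a)) ≠ 0 := by
  obtain ⟨z, hz⟩ := hs.exists_angle hab
  filter_upwards [hz.ne] with l hl
  rw [mdot_momentum_momentum]
  simpa using hl

end

end TreeQED

theorem mainTheorem8 {N n : ℕ} (g : ℝ)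
    (barred : Fin N → Bool) (hgauge : ∑ j, opCharge barred j = 0)
    (Γ : (Fin N → DIdx) → ℂ)
    (sp : Fin n → Species N) (sector : Fin n → WithTop (Fin N))
    (hsector : Monotone sector) (hflavor : FlavorsMatch sp barred sector)
    (χ ρ : ℝ → Fin n → Weyl) (τ : ℝ → Fin N → Weyl)
    (hscaling : JetScaling sector χ)
    (hτ : WilsonDirections sector χ τ)
    (hρ : ∀ᶠ l in 𝓝[>] (0 : ℝ), AdmissibleRef sp (χ l) (ρ l)) :
    -- soft-collinear factorization
    AgreeAtLeadingPower (leadingExponent sector)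
      (fun l => fullMatrixElement g sp (χ l) (ρ l) barred Γ)
      (fun l => factorizedMatrixElement g sp (χ l) (ρ l) barred Γ sector
        (fun j => momentum (τ l j))) ∧
    -- one emission from a charged leg is the eikonal term plus a spin term, and the spin term
    -- does not depend on the reference vectors
    (∀ a b, (sp a).charge = 0 → (sp b).charge ≠ 0 → ∀ᶠ l in 𝓝[>] (0 : ℝ),
      emissionLine g sp (χ l) (ρ l) b a =
        eikonalTerm g sp (χ l) (ρ l) b a + spinTerm g sp (χ l) (ρ l) b a ∧
      ∀ ρ' : Fin n → Weyl, AdmissibleRef sp (χ l) ρ' →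
        spinTerm g sp (χ l) ρ' b a = spinTerm g sp (χ l) (ρ l) b a) ∧
    -- for a collinear photon the spin term has the leading size `1 / λ` only if the emission is
    -- self-collinear
    (∀ a b (i j : Fin N), (sp a).charge = 0 → (sp b).charge ≠ 0 → sector a = i → sector b = j →
      (i = j → (fun l => spinTerm g sp (χ l) (ρ l) b a) =O[𝓝[>] 0] fun l : ℝ => l⁻¹) ∧
      (i ≠ j → (fun l => spinTerm g sp (χ l) (ρ l) b a) =O[𝓝[>] 0] fun _ => (1 : ℝ))) ∧
    -- the soft limit is spin-independent
    (∀ a b (j : Fin N), (sp a).charge = 0 → (sp b).charge ≠ 0 → sector a = ⊤ → sector b = j →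
      (fun l => emissionLine g sp (χ l) (ρ l) b a - eikonalTerm g sp (χ l) (ρ l) b a)
        =o[𝓝[>] 0] fun l : ℝ => (l ^ 2)⁻¹) := by
  refine ⟨agreeAtLeadingPower hgauge Γ hsector hflavor hscaling hτ hρ, fun a b ha hb => ?_,
    fun a b i j ha hb hai hbj => ⟨fun hij => ?_, fun hij => ?_⟩, fun a b j ha hb has hbj => ?_⟩
  · have hab : b ≠ a := by rintro rfl; exact hb ha
    filter_upwards [hscaling.mdot_ne_zero hab, hρ] with l hl hl'
    exact ⟨emissionLine_eq ha hb hl, fun ρ' h => spinTerm_eq_of_admissible ha hl' h⟩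
  · subst hij
    have hab : b ≠ a := by rintro rfl; exact hb ha
    refine isBigO_pi.2 fun k => ?_
    have h := spinTerm_order (g := g) ha (hscaling.angle_same hab hbj hai)
      (hscaling.spinor_coll hai) hρ k
    simpa [OrderGE] using h
  · refine isBigO_pi.2 fun k => ?_
    have h := spinTerm_order (g := g) ha (hscaling.angle_diff hij.symm hbj hai)
      (hscaling.spinor_coll hai) hρ k
    simpa [OrderGE] using h
  · have hab : b ≠ a := by rintro rfl; exact hb ha
    refine isLittleO_pi.2 fun k => OrderGE.isLittleO_pow (m := 2) ?_
    have h := spinTerm_order (g := g) ha (hscaling.angle_soft_jet has hbj).angle_swap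
      (hscaling.spinor_soft has) hρ k
    refine (h.mono (by norm_num)).congr' ?_
    filter_upwards [hscaling.mdot_ne_zero hab] with l hl
    rw [emissionLine_eq ha hb hl, add_sub_cancel_left]
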